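/- Let $\mathbf k$ be an algebraically closed field and $\Lambda=\mathbf kQ/I$ a (finite-dimensional) gentle algebra. Paths are read from right to left, modules are left modules, maps are composed from left to right, $P(x)=\Lambda e_x$, and a path $p$ in $(Q,I)$ (i.e. with no subpath in $I$) with end $x$ and start $y$ is regarded as the map $P(x)\to P(y)$ given by right multiplication by $p$. A (possibly infinite) homotopy string, or a homotopy band, is written as a product of its homotopy letters; each letter is a nontrivial path in $(Q,I)$ (a direct letter) or the formal inverse $\bar p$ of one (an inverse letter). The string complex $P^\bullet_\tau$ has as terms the sums of the $P(y)$, where $y$ runs over the vertices between the letters of $\tau$ (and at its ends), and its differential is given by the letters: a direct letter $p$ with left vertex $x$ and right vertex $y$ gives $p\colon P(x)\to P(y)$, and the inverse letter $\bar p$, with left vertex $y$ and right vertex $x$, gives the same map $p$ from right to left. The one-dimensional band complex $B^\bullet_{\sigma,\lambda}$, $\lambda\in\mathbf k^*$, is defined in the same way from the cyclic word $\sigma$, with one direct letter multiplied by $\lambda$. Let $\sigma=\beta\sigma_L\sigma_C\sigma_R\alpha$ be a homotopy band (up to cyclic permutation; $\sigma_L$ and $\sigma_R$ are the cyclic neighbours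 of $\sigma_C$, and coincide if $\sigma$ has only two letters) and let $\tau=\delta\tau_L\tau_C\tau_R\gamma$ be a finite or infinite homotopy string, where $\sigma_C,\tau_C$ are direct homotopy letters, $\tau_L,\tau_R$ are homotopy letters or empty (in which case $\delta$, respectively $\gamma$, is empty too), and $\alpha,\beta,\gamma,\delta$ are homotopy substrings. Let $f_L$ and $f_R$ be nontrivial paths in $(Q,I)$, regarded as maps between the projectives at the left ends, respectively at the right ends, of $\sigma_C$ and $\tau_C$ (placed in equal degrees), such that $f_L\tau_C=\sigma_Cf_R$ has no subpath in $I$ and * (L1) if $\sigma_L$ is direct, then $\sigma_Lf_L$ has a subpath in $I$; * (L2) if $\tau_L$ is nonempty and inverse, then $f_L\bar\tau_L$ has a subpath in $I$; * (R1) if $\sigma_R$ is inverse, then $\bar\sigma_Rf_R$ has a subpath in $I$; * (R2) if $\tau_R$ is nonempty and direct, then $f_R\tau_R$ has a subpath in $I$. Let $f^\bullet\colon B^\bullet_{\sigma,\lambda}\to P^\bullet_\tau$ be a double map with components $(f_L,f_R)$, i.e. a cochain map whose only nonzero components are nonzero scalar multiples of $f_L$ and $f_R$, and suppose that $f^\bullet$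 is not null-homotopic. Then $$c=\delta\,\tau_L\,\bar f_L\,\bar\sigma_L\,\bar\beta\,\bar\alpha\,\bar\sigma_R\,f_R\,\tau_R\,\gamma$$ (that is, $\sigma$ with $\sigma_C$ removed, inverted, and joined to the two parts of $\tau$ by the letters $\bar f_L$ and $f_R$) is a homotopy string, and the mapping cone of $f^\bullet$ is isomorphic in the homotopy category of complexes of projective $\Lambda$-modules to the string complex $P^\bullet_c$, graded so that the projectives coming from $\tau$ keep their degrees and those coming from $\sigma$ are moved down by one degree. -/

import Mathlib

open CategoryTheory

universe u v w

namespace Gentle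

/-- A bound quiver `(Q, I)` with vertices `V` and arrows `A`, whose ideal `I` is generated by paths
of length two, subject to the axioms of a gentle algebra. Words of arrows are written
from left to right but read from right to left: in `a b` the arrow `b` comes first, so `a b` is a
path when `src a = tgt b`, and `rel a b` says that the path `a b` is one of the generators of `I`.
-/
structure GentleQuiver (V : Type u) (A : Type v) [Fintype V] [Fintype A] where
  src : A → V
  tgt : A → V
  rel : A → A → Prop
  rel_comp : ∀ a b, rel a b → src a = tgt b
  src_le_two : ∀ x : V, {a : A | src a = x}.ncard ≤ 2
  tgt_le_two : ∀ x : V, {a : A | tgt a = x}.ncard ≤ 2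
  nonrel_left : ∀ a b b' : A, src b = tgt a → src b' = tgt a → ¬ rel b a → ¬ rel b' a → b = b'
  nonrel_right : ∀ a c c' : A, src a = tgt c → src a = tgt c' → ¬ rel a c → ¬ rel a c' → c = c'
  rel_left : ∀ a b b' : A, rel b a → rel b' a → b = b'
  rel_right : ∀ a c c' : A, rel a c → rel a c' → c = c'
  /-- `I` is admissible: all sufficiently long paths of `Q` lie in `I`. -/
  admissible : ∃ N : ℕ, ∀ p : List A,
    p.IsChain (fun a b => src a = tgt b ∧ ¬ rel a b) → p.length ≤ N

variable {V : Type u} {A : Type v} [Fintype V] [Fintype A]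

/-! ### The algebra `Λ = k Q / I` -/

/-- The defining relations of `k Q / I` on the generators `e_x` (`x` a vertex) and `a`
(`a` an arrow). -/
inductive AlgRel (k : Type w) [Field k] (Q : GentleQuiver V A) :
    FreeAlgebra k (V ⊕ A) → FreeAlgebra k (V ⊕ A) → Prop
  | idem (x : V) : AlgRel k Q
      (FreeAlgebra.ι k (Sum.inl x) * FreeAlgebra.ι k (Sum.inl x)) (FreeAlgebra.ι k (Sum.inl x))
  | orth (x y : V) : x ≠ y → AlgRel k Q
      (FreeAlgebra.ι k (Sum.inl x) * FreeAlgebra.ι k (Sum.inl y)) 0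
  | one : AlgRel k Q (∑ x : V, FreeAlgebra.ι k (Sum.inl x)) 1
  | tgt (a : A) : AlgRel k Q
      (FreeAlgebra.ι k (Sum.inl (Q.tgt a)) * FreeAlgebra.ι k (Sum.inr a))
      (FreeAlgebra.ι k (Sum.inr a))
  | src (a : A) : AlgRel k Q
      (FreeAlgebra.ι k (Sum.inr a) * FreeAlgebra.ι k (Sum.inl (Q.src a)))
      (FreeAlgebra.ι k (Sum.inr a))
  | rel (a b : A) : Q.rel a b → AlgRel k Q
      (FreeAlgebra.ι k (Sum.inr a) * FreeAlgebra.ι k (Sum.inr b)) 0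

/-- The gentle algebra `Λ = k Q / I`. -/
def Alg (k : Type w) [Field k] (Q : GentleQuiver V A) : Type (max u v w) :=
  RingQuot (AlgRel k Q)

section

variable (k : Type w) [Field k] (Q : GentleQuiver V A)

noncomputable instance instRing : Ring (Alg k Q) := RingQuot.instRing (AlgRel k Q)

noncomputable instance instAlgebra : Algebra k (Alg k Q) := RingQuot.instAlgebra (AlgRel k Q)

/-- The quotient map from the free algebra. -/
noncomputable def Alg.mk : FreeAlgebra k (V ⊕ A) →ₐ[k] Alg k Q := RingQuot.mkAlgHom k (AlgRel k Q)

theorem Alg.mk_rel {x y : FreeAlgebra k (V ⊕ A)} (h : AlgRel k Q x y) :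
    Alg.mk k Q x = Alg.mk k Q y :=
  RingQuot.mkAlgHom_rel k h

/-- The idempotent of a vertex. -/
noncomputable def idem (x : V) : Alg k Q :=
  Alg.mk k Q (FreeAlgebra.ι k (Sum.inl x))

/-- The element of `Λ` given by an arrow. -/
noncomputable def arr (a : A) : Alg k Q :=
  Alg.mk k Q (FreeAlgebra.ι k (Sum.inr a))

/-- The element of `Λ` given by a nonempty word of arrows. -/
noncomputable def word (p : List A) : Alg k Q := (p.map (arr k Q)).prod

/-- The indecomposable projective left module `P(x) = Λ e_x`, as a left ideal of `Λ`. -/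
noncomputable def proj (x : V) : Submodule (Alg k Q) (Alg k Q) :=
  Submodule.span (Alg k Q) {idem k Q x}

end

/-! ### Paths, homotopy letters, homotopy strings and bands -/

/-- `p` is a nontrivial path in `(Q, I)`, that is, without subpath in `I`, with end `x` and
start `y`. Right multiplication by `p` is a map `P(x) → P(y)`. -/
structure IsPath (Q : GentleQuiver V A) (p : List A) (x y : V) : Prop where
  ne_nil : p ≠ []
  chain : p.IsChain (fun a b => Q.src a = Q.tgt b ∧ ¬ Q.rel a b)
  tgt_head : ∀ a ∈ p.head?, Q.tgt a = x
  src_last : ∀ a ∈ p.getLast?, Q.src a = y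

/-- The path `p` of the quiver has a subpath in `I`. -/
def HasZero (Q : GentleQuiver V A) (p : List A) : Prop :=
  ∃ a b : A, [a, b] <:+: p ∧ Q.rel a b

/-- A homotopy letter: the path `p` (if `direct`), or its formal inverse `p̄` (if not). -/
structure Letter (A : Type v) where
  path : List A
  direct : Bool

/-- The inverse homotopy letter. -/
def Letter.inv (l : Letter A) : Letter A := ⟨l.path, !l.direct⟩

/-- `l` is a homotopy letter which, in a walk written from left to right, has the vertex `x` on
its left and the vertex `y` on its right. -/
def Letter.Joins (Q : GentleQuiver V A) (l : Letter A) (x y : V) : Prop :=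
  if l.direct then IsPath Q l.path x y else IsPath Q l.path y x

/-- The homotopy letters `l` (on the left) and `r` (on the right) may follow each other in a walk,
and are then different homotopy letters: there is a relation at the junction if both have the same
direction, and no cancellation `a ā` or `ā a` if they have opposite directions. -/
def Junction (Q : GentleQuiver V A) (l r : Letter A) : Prop :=
  match l.direct, r.direct with
  | true, true => ∃ a ∈ l.path.getLast?, ∃ b ∈ r.path.head?, Q.rel a b
  | false, false => ∃ a ∈ r.path.getLast?, ∃ b ∈ l.path.head?, Q.rel a b
  | true, false => l.path.getLast? ≠ r.path.getLast?
  | false, true => l.path.head? ≠ r.path.head?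

/-- The data of a sequence of homotopy letters. The positions `i ∈ carrier` carry the vertices
`vtx i`, and `letter i` stands between the position `i` on its left and the position `i + 1` on its
right whenever both belong to `carrier`; other values are irrelevant. Strings have positions in
`ℤ` and bands have cyclic positions in `ZMod m`. -/
structure Walk (V : Type u) (A : Type v) (ι : Type) where
  carrier : Set ι
  vtx : ι → V
  letter : ι → Letter A

variable {ι : Type} [Ring ι]

/-- The sequence is a walk in `(Q, I)`, written through its decomposition into homotopy
letters. -/
structure IsWalk (Q : GentleQuiver V A) (W : Walk V A ι) : Prop where
  joins : ∀ i, i ∈ W.carrier → i + 1 ∈ W.carrier →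
    (W.letter i).Joins Q (W.vtx i) (W.vtx (i + 1))
  junction : ∀ i, i ∈ W.carrier → i + 1 ∈ W.carrier → i + 1 + 1 ∈ W.carrier →
    Junction Q (W.letter i) (W.letter (i + 1))

/-- A homotopy string, possibly trivial (one position, no letter) or infinite. An infinite left
end has to be a direct antipath, an infinite right end an inverse antipath. -/
structure IsHomotopyString (Q : GentleQuiver V A) (W : Walk V A ℤ) : Prop extends IsWalk Q W where
  nonempty : W.carrier.Nonempty
  ordConnected : W.carrier.OrdConnected
  left_end : ¬ BddBelow W.carrier →
    ∃ n, ∀ i ≤ n, (W.letter i).direct = true ∧ (W.letter i).path.length = 1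
  right_end : ¬ BddAbove W.carrier →
    ∃ n, ∀ i ≥ n, (W.letter i).direct = false ∧ (W.letter i).path.length = 1

/-- A homotopy band with `m` homotopy letters: a cyclic walk which is not a proper power and has
equal numbers of direct and inverse homotopy letters. -/
structure IsHomotopyBand (Q : GentleQuiver V A) {m : ℕ} (W : Walk V A (ZMod m)) : Prop
    extends IsWalk Q W where
  carrier_eq : W.carrier = Set.univ
  primitive : ∀ d : ZMod m, (∀ i, W.letter (i + d) = W.letter i) → d = 0
  balanced : {i | (W.letter i).direct = true}.ncard = {i | (W.letter i).direct = false}.ncard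

/-- `deg` is a cohomological grading of the walk: the position `i` is placed in degree `deg i`,
and each homotopy letter raises the degree by one in its direction. -/
def IsGrading (W : Walk V A ι) (deg : ι → ℤ) : Prop :=
  ∀ i, i ∈ W.carrier → i + 1 ∈ W.carrier →
    if (W.letter i).direct then deg (i + 1) = deg i + 1 else deg i = deg (i + 1) + 1

/-! ### String and band complexes -/

section

variable (k : Type w) [Field k] (Q : GentleQuiver V A)

/-- The direct sum of the `P(vtx i)` over the positions `i` of degree `n`, realised as the
left submodule of those finitely supported families `(u i)` with `u i ∈ P(vtx i)` which vanish
outside of these positions. -/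
noncomputable def term (W : Walk V A ι) (deg : ι → ℤ) (n : ℤ) :
    Submodule (Alg k Q) (ι →₀ Alg k Q) where
  carrier := {u | ∀ i, u i ∈ proj k Q (W.vtx i) ∧ (u i ≠ 0 → i ∈ W.carrier ∧ deg i = n)}
  zero_mem' := fun i => by simp
  add_mem' := fun {a b} ha hb i => by
    refine ⟨by simpa using add_mem (ha i).1 (hb i).1, fun h => ?_⟩
    by_cases h1 : a i = 0
    · exact (hb i).2 (fun h2 => h (by simp [h1, h2]))
    · exact (ha i).2 h1
  smul_mem' := fun c u hu i => by
    refine ⟨by simpa using Submodule.smul_mem _ c (hu i).1, fun h => (hu i).2 (fun h1 => h ?_)⟩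
    simp [h1]

open Classical in
/-- The components of the differential that start at the position `i`: a direct letter `p` between
`i` and `i + 1` contributes `p : P(vtx i) → P(vtx (i + 1))`, and an inverse letter `p̄` between
`i - 1` and `i` contributes `p : P(vtx i) → P(vtx (i - 1))`. The letter `j` is multiplied
by the scalar `coef j`. -/
noncomputable def row (W : Walk V A ι) (coef : ι → k) (i : ι) : ι →₀ Alg k Q :=
  (if i ∈ W.carrier ∧ i + 1 ∈ W.carrier ∧ (W.letter i).direct = true then
    Finsupp.single (i + 1) (coef i • word k Q (W.letter i).path) else 0) +
  (if i ∈ W.carrier ∧ i - 1 ∈ W.carrier ∧ (W.letter (i - 1)).direct = false then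
    Finsupp.single (i - 1) (coef (i - 1) • word k Q (W.letter (i - 1)).path) else 0)

/-- The differential on the sum of all `P(vtx i)`: right multiplication by the matrix `row`. -/
noncomputable def diff (W : Walk V A ι) (coef : ι → k) :
    (ι →₀ Alg k Q) →ₗ[Alg k Q] (ι →₀ Alg k Q) :=
  Finsupp.linearCombination (Alg k Q) (row k Q W coef)

variable {k Q}

theorem arr_mul_idem (a : A) : arr k Q a * idem k Q (Q.src a) = arr k Q a := by
  unfold arr idem
  rw [← map_mul]
  exact Alg.mk_rel k Q (AlgRel.src a)

theorem arr_mul_arr {a b : A} (h : Q.rel a b) : arr k Q a * arr k Q b = 0 := by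
  unfold arr
  rw [← map_mul, Alg.mk_rel k Q (AlgRel.rel a b h), map_zero]

theorem word_mem_proj {p : List A} {x y : V} (h : IsPath Q p x y) :
    word k Q p ∈ proj k Q y := by
  obtain ⟨q, a, rfl⟩ : ∃ q a, p = q ++ [a] :=
    ⟨_, _, (List.dropLast_append_getLast h.ne_nil).symm⟩
  have hs : Q.src a = y := h.src_last a (by simp)
  refine Submodule.mem_span_singleton.2 ⟨word k Q (q ++ [a]), ?_⟩
  rw [smul_eq_mul]
  simp only [word, List.map_append, List.prod_append, List.map_cons, List.map_nil, List.prod_cons,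
    List.prod_nil, mul_one]
  rw [mul_assoc, ← hs, arr_mul_idem]

theorem word_mul_word {p q : List A} {a b : A} (ha : a ∈ p.getLast?) (hb : b ∈ q.head?)
    (h : Q.rel a b) : word k Q p * word k Q q = 0 := by
  obtain ⟨p', rfl⟩ := List.mem_getLast?_eq_getLast ha |> fun ⟨h1, h2⟩ =>
    (⟨_, by rw [h2]; exact (List.dropLast_append_getLast h1).symm⟩ : ∃ p', p = p' ++ [a])
  obtain ⟨q', rfl⟩ : ∃ q', q = b :: q' := by
    cases q with
    | nil => simp at hb
    | cons c q' => exact ⟨q', by simp at hb; rw [hb]⟩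
  simp only [word, List.map_append, List.prod_append, List.map_cons, List.map_nil, List.prod_cons,
    List.prod_nil, mul_one]
  rw [mul_assoc, ← mul_assoc (arr k Q a), arr_mul_arr h, zero_mul, mul_zero]

theorem row_mem (W : Walk V A ι) (coef : ι → k) {deg : ι → ℤ} (hW : IsWalk Q W)
    (hdeg : IsGrading W deg) (i : ι) (n : ℤ) (hi : deg i = n) :
    row k Q W coef i ∈ term k Q W deg (n + 1) := by
  classical
  have key : ∀ (j : ι) (x : Alg k Q), x ∈ proj k Q (W.vtx j) → j ∈ W.carrier → deg j = n + 1 →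
      Finsupp.single j x ∈ term k Q W deg (n + 1) := by
    intro j x hx hj hd l
    by_cases hl : j = l
    · subst hl; simp [hx, hj, hd]
    · simp [Finsupp.single_eq_of_ne' hl]
  have smul_key : ∀ (c : k) (x : Alg k Q) (y : V), x ∈ proj k Q y → c • x ∈ proj k Q y := by
    intro c x y hx
    rw [← algebraMap_smul (Alg k Q) c x]
    exact Submodule.smul_mem _ _ hx
  unfold row
  refine add_mem ?_ ?_
  · split_ifs with h
    · obtain ⟨h1, h2, h3⟩ := h
      have hj := hW.joins i h1 h2
      have hg := hdeg i h1 h2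
      simp only [Letter.Joins, h3, if_true] at hj hg
      exact key _ _ (smul_key _ _ _ (word_mem_proj hj)) h2 (by rw [hg, hi])
    · exact zero_mem _
  · split_ifs with h
    · obtain ⟨h1, h2, h3⟩ := h
      have hj := hW.joins (i - 1) h2 (by simpa using h1)
      have hg := hdeg (i - 1) h2 (by simpa using h1)
      simp only [Letter.Joins, h3, sub_add_cancel] at hj hg
      exact key _ _ (smul_key _ _ _ (word_mem_proj hj)) h2 (by simp at hg; omega)
    · exact zero_mem _

theorem diff_mem (W : Walk V A ι) (coef : ι → k) {deg : ι → ℤ} (hW : IsWalk Q W)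
    (hdeg : IsGrading W deg) {n n' : ℤ} (h : n + 1 = n') (u : ι →₀ Alg k Q)
    (hu : u ∈ term k Q W deg n) : diff k Q W coef u ∈ term k Q W deg n' := by
  subst h
  unfold diff
  rw [Finsupp.linearCombination_apply]
  refine Submodule.sum_mem _ fun i hi => Submodule.smul_mem _ _ ?_
  exact row_mem W coef hW hdeg i n ((hu i).2 (Finsupp.mem_support_iff.1 hi)).2

theorem diff_diff (W : Walk V A ι) (coef : ι → k) (hW : IsWalk Q W) (u : ι →₀ Alg k Q) :
    diff k Q W coef (diff k Q W coef u) = 0 := by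
  classical
  suffices h : ∀ i, diff k Q W coef (row k Q W coef i) = 0 by
    conv_lhs => arg 2; unfold diff
    rw [Finsupp.linearCombination_apply, Finsupp.sum, map_sum]
    exact Finset.sum_eq_zero fun i _ => by rw [map_smul, h, smul_zero]
  intro i
  have hs : ∀ (j : ι) (x : Alg k Q), diff k Q W coef (Finsupp.single j x) =
      x • row k Q W coef j := fun j x => by simp [diff]
  have h1 : i ∈ W.carrier ∧ i + 1 ∈ W.carrier ∧ (W.letter i).direct = true →
      ∀ c : k, (c • word k Q (W.letter i).path) • row k Q W coef (i + 1) = 0 := by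
    rintro ⟨a1, a2, a3⟩ c
    unfold row
    rw [add_sub_cancel_right]
    simp only [a3, Bool.true_eq_false, and_false, if_false, add_zero]
    split_ifs with h
    · have hj := hW.junction i a1 a2 h.2.1
      simp only [Junction, a3, h.2.2] at hj
      obtain ⟨a, ha, b, hb, hr⟩ := hj
      simp [Finsupp.smul_single, word_mul_word ha hb hr]
    · simp
  have h2 : i ∈ W.carrier ∧ i - 1 ∈ W.carrier ∧ (W.letter (i - 1)).direct = false →
      ∀ c : k, (c • word k Q (W.letter (i - 1)).path) • row k Q W coef (i - 1) = 0 := by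
    rintro ⟨a1, a2, a3⟩ c
    unfold row
    simp only [a3, Bool.false_eq_true, and_false, if_false, zero_add]
    split_ifs with h
    · have hj := hW.junction (i - 1 - 1) h.2.1 (by simpa using a2) (by simpa using a1)
      simp only [sub_add_cancel, Junction, a3, h.2.2] at hj
      obtain ⟨a, ha, b, hb, hr⟩ := hj
      simp [Finsupp.smul_single, word_mul_word ha hb hr]
    · simp
  conv_lhs => arg 2; unfold row
  rw [map_add]
  split_ifs with c1 c2 c2
  · rw [hs, hs, h1 c1, h2 c2, add_zero]
  · rw [hs, h1 c1, map_zero, add_zero]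
  · rw [hs, h2 c2, map_zero, add_zero]
  · simp

variable (k) in
/-- The complex of projective left `Λ`-modules whose unfolded diagram is the walk `W`, with the
homotopy letter `j` scaled by `coef j`, in the grading `deg`. -/
noncomputable def walkComplex {W : Walk V A ι} (hW : IsWalk Q W) (coef : ι → k) {deg : ι → ℤ}
    (hdeg : IsGrading W deg) :
    CochainComplex (ModuleCat.{max u v w} (Alg k Q)) ℤ where
  X n := ModuleCat.of (Alg k Q) (term k Q W deg n)
  d n n' := open Classical in if h : n + 1 = n' then
    ModuleCat.ofHom ((diff k Q W coef).restrict (diff_mem W coef hW hdeg h)) else 0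
  shape n n' h := dif_neg h
  d_comp_d' n n' n'' h h' := by
    rw [dif_pos (show n + 1 = n' from h), dif_pos (show n' + 1 = n'' from h')]
    exact ModuleCat.hom_ext (LinearMap.ext fun u => Subtype.ext (diff_diff W coef hW u.1))

variable (k) in
/-- The string complex `P_τ` of a homotopy string. -/
noncomputable abbrev stringComplex {W : Walk V A ℤ} (hW : IsHomotopyString Q W) {deg : ℤ → ℤ}
    (hdeg : IsGrading W deg) : CochainComplex (ModuleCat.{max u v w} (Alg k Q)) ℤ :=
  walkComplex k hW.toIsWalk (fun _ => 1) hdeg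

open Classical in
/-- The band complex `B_{σ,lam}` (one-dimensional), with the scalar `lam` on the letter `p`. -/
noncomputable abbrev bandComplex {m : ℕ} {W : Walk V A (ZMod m)} (hW : IsHomotopyBand Q W)
    (p : ZMod m) (lam : k) {deg : ZMod m → ℤ} (hdeg : IsGrading W deg) :
    CochainComplex (ModuleCat.{max u v w} (Alg k Q)) ℤ :=
  walkComplex k hW.toIsWalk (fun i => if i = p then lam else 1) hdeg

end

/-! ### Double maps and the string of the mapping cone -/

/-- The combinatorial data of a double map from (the complex of) `σ` to (the complex of) `τ`:
direct letters `σ_C` at the position `s` of `σ` and `τ_C` at the position `t` of `τ`, and nontrivial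
paths `fL`, `fR` from the left ends and right ends of `σ_C` to those of `τ_C`. Here `σ_L`, `σ_R` are
the letters of `σ` next to `σ_C` at the positions `s - 1` and `s + 1`, and similarly for `τ`;
a condition on a letter is imposed only if that letter exists. -/
structure IsDoubleData (Q : GentleQuiver V A) {ι ι' : Type} [Ring ι] [Ring ι']
    (σ : Walk V A ι) (degσ : ι → ℤ) (τ : Walk V A ι') (degτ : ι' → ℤ) (s : ι) (t : ι')
    (fL fR : List A) : Prop where
  s_mem : s ∈ σ.carrier
  s_succ_mem : s + 1 ∈ σ.carrier
  t_mem : t ∈ τ.carrier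
  t_succ_mem : t + 1 ∈ τ.carrier
  deg_eq : degσ s = degτ t
  direct_s : (σ.letter s).direct = true
  direct_t : (τ.letter t).direct = true
  path_L : IsPath Q fL (σ.vtx s) (τ.vtx t)
  path_R : IsPath Q fR (σ.vtx (s + 1)) (τ.vtx (t + 1))
  comm : fL ++ (τ.letter t).path = (σ.letter s).path ++ fR
  nonzero : ¬ HasZero Q (fL ++ (τ.letter t).path)
  /-- (L1) -/
  L1 : s - 1 ∈ σ.carrier → (σ.letter (s - 1)).direct = true →
    HasZero Q ((σ.letter (s - 1)).path ++ fL)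
  /-- (L2) -/
  L2 : t - 1 ∈ τ.carrier → (τ.letter (t - 1)).direct = false →
    HasZero Q (fL ++ (τ.letter (t - 1)).path)
  /-- (R1) -/
  R1 : s + 1 + 1 ∈ σ.carrier → (σ.letter (s + 1)).direct = false →
    HasZero Q ((σ.letter (s + 1)).path ++ fR)
  /-- (R2) -/
  R2 : t + 1 + 1 ∈ τ.carrier → (τ.letter (t + 1)).direct = true →
    HasZero Q (fR ++ (τ.letter (t + 1)).path)

section

variable {k : Type w} [Field k] {Q : GentleQuiver V A}

open Classical in
/-- The cochain map `f` has exactly the two components `a fL : P(vtx s) → P(vtx t)` and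
`b fR : P(vtx (s + 1)) → P(vtx (t + 1))`, with nonzero scalars `a`, `b`. -/
def HasComponents {ι ι' : Type} [Ring ι] [Ring ι']
    {σ : Walk V A ι} {hσ : IsWalk Q σ} {coefσ : ι → k} {degσ : ι → ℤ} {hdσ : IsGrading σ degσ}
    {τ : Walk V A ι'} {hτ : IsWalk Q τ} {coefτ : ι' → k} {degτ : ι' → ℤ} {hdτ : IsGrading τ degτ}
    (f : walkComplex k hσ coefσ hdσ ⟶ walkComplex k hτ coefτ hdτ) (s : ι) (t : ι')
    (fL fR : List A) : Prop :=
  ∃ a b : k, a ≠ 0 ∧ b ≠ 0 ∧ ∀ (n : ℤ) (u : term k Q σ degσ n),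
    (show term k Q τ degτ n from (f.f n).hom u).1 =
      Finsupp.single t (u.1 s * (a • word k Q fL)) +
        Finsupp.single (t + 1) (u.1 (s + 1) * (b • word k Q fR))

end

open Classical in
/-- For a band `σ = β σ_L σ_C σ_R α` with `m` letters and a string `τ = δ τ_L τ_C τ_R γ`, where
`σ_C` and `τ_C` are the letters at `s` and `t`, the sequence
`c = δ τ_L f̄_L (σ̄_L β̄ ᾱ σ̄_R) f_R τ_R γ`.
The part of `τ` to the left of `τ_C` keeps its positions `≤ t`, the positions `t + 1, …, t + m` are
the `m` positions of `σ`, taken from right to left and starting with the left end of `σ_C`,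
and the part of `τ` to the right of `τ_C` is moved by `m`. -/
noncomputable def coneWalk {m : ℕ} (σ : Walk V A (ZMod m)) (τ : Walk V A ℤ) (s : ZMod m) (t : ℤ)
    (fL fR : List A) : Walk V A ℤ where
  carrier := {i | if i ≤ t then i ∈ τ.carrier
    else if i ≤ t + m then s - ((i - t - 1 : ℤ) : ZMod m) ∈ σ.carrier else i - m ∈ τ.carrier}
  vtx i := if i ≤ t then τ.vtx i
    else if i ≤ t + m then σ.vtx (s - ((i - t - 1 : ℤ) : ZMod m)) else τ.vtx (i - m)
  letter i := if i < t then τ.letter i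
    else if i = t then ⟨fL, false⟩
    else if i < t + m then (σ.letter (s - ((i - t : ℤ) : ZMod m))).inv
    else if i = t + m then ⟨fR, true⟩
    else τ.letter (i - m)

/-- The grading of `c` in the mapping cone: the positions coming from `τ` keep their degrees and
those coming from `σ` are moved down by one. -/
def coneDeg {m : ℕ} (degσ : ZMod m → ℤ) (degτ : ℤ → ℤ) (s : ZMod m) (t : ℤ) (i : ℤ) : ℤ :=
  if i ≤ t then degτ i
  else if i ≤ t + m then degσ (s - ((i - t - 1 : ℤ) : ZMod m)) - 1 else degτ (i - m)

end Gentle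

namespace Gentle

/-! ### Words of arrows -/

section Lists

variable {α : Type*} {R : α → α → Prop}

/-! The cone of `f` has the same summands as the string complex of `c`: those of τ, and those of σ
one degree lower. Its differential consists of the letters of τ, the negated letters of σ and the
two components of `f`. Up to scalars it therefore differs from the differential of `c` only by the
two letters σ_C and τ_C, which `c` omits. A change of basis clears these two letters, so the two are
isomorphic already as complexes.

Since f_L τ_C = σ_C f_R is a single path, there are three cases. (1) σ_C = f_L h and τ_C = h f_R
with h nontrivial. The map h from the left end of τ_C to the right end of σ_C clears both letters at
once (`isLadder_of_short`). (2) f_L = σ_C h and f_R = h τ_C with h nontrivial. Then a multiple of h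
is a null-homotopy of `f` (`isLadder_of_long`, `map_eq_zero`), which is excluded. (3) f_L = σ_C and
f_R = τ_C. Now h is an identity, and it has to be continued along the two walks that leave this
vertex, τ to the left of τ_C and σ to the right of σ_C. Where they first differ, gentleness makes
one letter a proper factor of the other, unless the directions are opposite or a walk ends. This
yields a ladder of maps from τ to σ, or a finite one from σ to τ (`exists_isLadder`). The second is
again a null-homotopy; the first is the required change of basis.

The change of basis is `1 - N`, where `N` maps the position `t - i` of `c` to `t - i + m`. A ladder
may be longer than one turn of the band; its targets then lie in τ again, and `N` need not have
square zero. But `N` moves to the right and vanishes beyond `t`, so it is locally nilpotent and `1 -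
N` is bijective (`unipotent_injective`, `unipotent_surjective`). The remaining scalars are absorbed
because a string has no cycle (`nonempty_iso_stringComplex`).

That `c` is a homotopy string concerns only its four new junctions; they follow from (L1)–(R2) and
from the common path having no relation. -/

theorem List.isPrefix_or_isPrefix_of_isChain (hR : ∀ a b c, R a b → R a c → b = c) :
    ∀ {p q : List α}, p.IsChain R → q.IsChain R → p.head? = q.head? → p <+: q ∨ q <+: p
  | [], _, _, _, _ => Or.inl List.nil_prefix
  | _ :: _, [], _, _, _ => Or.inr List.nil_prefix
  | a :: p, b :: q, hp, hq, h => by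
    obtain rfl : a = b := by simpa using h
    rcases p with _ | ⟨c, p⟩
    · left; simp
    rcases q with _ | ⟨d, q⟩
    · right; simp
    rw [List.isChain_cons_cons] at hp hq
    have hcd := hR a c d hp.1 hq.1
    have := List.isPrefix_or_isPrefix_of_isChain hR hp.2 hq.2 (by simp [hcd])
    simpa [List.cons_prefix_cons] using this

theorem List.isSuffix_or_isSuffix_of_isChain (hR : ∀ a b c, R a c → R b c → a = b)
    {p q : List α} (hp : p.IsChain R) (hq : q.IsChain R) (h : p.getLast? = q.getLast?) :
    p <:+ q ∨ q <:+ p := by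
  have := List.isPrefix_or_isPrefix_of_isChain (R := fun a b => R b a)
    (fun a b c h1 h2 => hR b c a h1 h2) (p := p.reverse) (q := q.reverse)
    (by rwa [List.isChain_reverse]) (by rwa [List.isChain_reverse]) (by simpa using h)
  simpa [List.reverse_prefix] using this

end Lists

/-! ### Paths without relations, and uniqueness of arrows at a vertex -/

section Paths

variable {V : Type u} {A : Type v} [Fintype V] [Fintype A] {Q : GentleQuiver V A}

/-- Two composable arrows without relation. -/
def GentleQuiver.Good (Q : GentleQuiver V A) (a b : A) : Prop := Q.src a = Q.tgt b ∧ ¬ Q.rel a b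

theorem GentleQuiver.Good.right_unique {a b c : A} (h : Q.Good a b) (h' : Q.Good a c) : b = c :=
  Q.nonrel_right a b c h.1 h'.1 h.2 h'.2

theorem GentleQuiver.Good.left_unique {a b c : A} (h : Q.Good a c) (h' : Q.Good b c) : a = b :=
  Q.nonrel_left c a b h.1 h'.1 h.2 h'.2

/-- Neither factor contains a relation, so one in the product must sit at the junction. This turns
(L1)–(R2) into statements about two adjacent arrows. -/
theorem hasZero_append {p q : List A} {x y y' z : V} (hp : IsPath Q p x y) (hq : IsPath Q q y' z)
    (h : HasZero Q (p ++ q)) : ∃ a ∈ p.getLast?, ∃ b ∈ q.head?, Q.rel a b := by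
  by_contra! hn
  have hno : ∀ {r : List A} {x y : V} {a b : A}, IsPath Q r x y → [a, b] <:+: r → ¬ Q.rel a b := by
    rintro r x y a b hr ⟨s, t, rfl⟩
    have := hr.chain
    rw [List.append_assoc, List.isChain_append] at this
    have := this.2.1
    simp only [List.cons_append, List.nil_append, List.isChain_cons_cons] at this
    exact this.1.2
  obtain ⟨a, b, hab, hr⟩ := h
  have : (p ++ q).IsChain (fun a b => ¬ Q.rel a b) :=
    List.isChain_append.2 ⟨hp.chain.imp fun _ _ h => h.2, hq.chain.imp fun _ _ h => h.2, hn⟩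
  obtain ⟨s, t, hst⟩ := hab
  rw [← hst, List.append_assoc, List.isChain_append] at this
  have := this.2.1
  simp only [List.cons_append, List.nil_append, List.isChain_cons_cons] at this
  exact this.1 hr

theorem isPath_append_of_not_hasZero {p q : List A} {x y z : V} (hp : IsPath Q p x y)
    (hq : IsPath Q q y z) (h : ¬ HasZero Q (p ++ q)) : IsPath Q (p ++ q) x z where
  ne_nil := by simp [hp.ne_nil]
  chain := by
    refine List.isChain_append.2 ⟨hp.chain, hq.chain, fun a ha b hb => ⟨?_, fun hr => h ?_⟩⟩
    · rw [hp.src_last a ha, hq.tgt_head b hb]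
    · obtain ⟨p', rfl⟩ := List.mem_getLast?_eq_getLast ha |> fun ⟨h1, h2⟩ =>
        (⟨_, by rw [h2]; exact (List.dropLast_append_getLast h1).symm⟩ : ∃ p', p = p' ++ [a])
      obtain ⟨q', rfl⟩ : ∃ q', q = b :: q' := by
        cases q with
        | nil => simp at hb
        | cons c q' => exact ⟨q', by simp at hb; rw [hb]⟩
      exact ⟨a, b, ⟨p', q', by simp⟩, hr⟩
  tgt_head := by
    intro a ha
    apply hp.tgt_head a
    obtain ⟨c, p', rfl⟩ := List.exists_cons_of_ne_nil hp.ne_nil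
    simpa using ha
  src_last := by
    intro a ha
    apply hq.src_last a
    rwa [List.getLast?_append_of_ne_nil _ hq.ne_nil] at ha

theorem IsPath.exists_head {p : List A} {x y : V} (hp : IsPath Q p x y) :
    ∃ a ∈ p.head?, Q.tgt a = x := by
  obtain ⟨c, p', rfl⟩ := List.exists_cons_of_ne_nil hp.ne_nil
  exact ⟨c, by simp, hp.tgt_head c (by simp)⟩

theorem IsPath.exists_last {p : List A} {x y : V} (hp : IsPath Q p x y) :
    ∃ a ∈ p.getLast?, Q.src a = y := by
  have := List.getLast?_eq_some_getLast hp.ne_nil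
  exact ⟨_, this, hp.src_last _ this⟩

theorem IsPath.good_of_append {p q : List A} {x y : V} (h : IsPath Q (p ++ q) x y) {a b : A}
    (ha : a ∈ p.getLast?) (hb : b ∈ q.head?) : Q.Good a b :=
  (List.isChain_append.1 h.chain).2.2 a ha b hb

/-- The left factor of a path, given that the right factor is a path. -/
theorem IsPath.left_of_append {p q : List A} {x y y' z : V} (h : IsPath Q (p ++ q) x z)
    (hp : p ≠ []) (hq : IsPath Q q y' y) : IsPath Q p x y' where
  ne_nil := hp
  chain := (List.isChain_append.1 h.chain).1
  tgt_head := by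
    intro a ha
    apply h.tgt_head a
    obtain ⟨c, p', rfl⟩ := List.exists_cons_of_ne_nil hp
    simpa using ha
  src_last := by
    intro a ha
    obtain ⟨b, hb, rfl⟩ := hq.exists_head
    exact (h.good_of_append ha hb).1

theorem IsPath.right_of_append {p q : List A} {x y y' z : V} (h : IsPath Q (p ++ q) x z)
    (hq : q ≠ []) (hp : IsPath Q p y' y) : IsPath Q q y z where
  ne_nil := hq
  chain := (List.isChain_append.1 h.chain).2.1
  tgt_head := by
    intro b hb
    obtain ⟨a, ha, rfl⟩ := hp.exists_last
    exact (h.good_of_append ha hb).1.symm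
  src_last := by
    intro a ha
    apply h.src_last a
    rwa [List.getLast?_append_of_ne_nil _ hq]

theorem IsPath.eq_left {p : List A} {x y x' y' : V} (h : IsPath Q p x y) (h' : IsPath Q p x' y') :
    x = x' := by
  obtain ⟨a, ha, rfl⟩ := h.exists_head
  exact h'.tgt_head a ha

theorem IsPath.eq_right {p : List A} {x y x' y' : V} (h : IsPath Q p x y)
    (h' : IsPath Q p x' y') : y = y' := by
  obtain ⟨a, ha, rfl⟩ := h.exists_last
  exact h'.src_last a ha

/-- A third arrow starting at the vertex would be one too many. Where cancellation is forbidden,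
this determines the next arrow. -/
theorem GentleQuiver.src_unique (Q : GentleQuiver V A) {a b c : A} (h : Q.src b = Q.src a)
    (h' : Q.src c = Q.src a) (hb : b ≠ a) (hc : c ≠ a) : b = c := by
  by_contra hbc
  have h3 : ({a, b, c} : Set A).ncard = 3 := Set.ncard_eq_three.2 ⟨a, b, c, hb.symm, hc.symm, hbc, rfl⟩
  have := Set.ncard_le_ncard (s := ({a, b, c} : Set A)) (t := {d | Q.src d = Q.src a})
    (by rintro d (rfl | rfl | rfl) <;> simp [h, h']) (Set.toFinite _)
  have := Q.src_le_two (Q.src a)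
  omega

theorem GentleQuiver.tgt_unique (Q : GentleQuiver V A) {a b c : A} (h : Q.tgt b = Q.tgt a)
    (h' : Q.tgt c = Q.tgt a) (hb : b ≠ a) (hc : c ≠ a) : b = c := by
  by_contra hbc
  have h3 : ({a, b, c} : Set A).ncard = 3 := Set.ncard_eq_three.2 ⟨a, b, c, hb.symm, hc.symm, hbc, rfl⟩
  have := Set.ncard_le_ncard (s := ({a, b, c} : Set A)) (t := {d | Q.tgt d = Q.tgt a})
    (by rintro d (rfl | rfl | rfl) <;> simp [h, h']) (Set.toFinite _)
  have := Q.tgt_le_two (Q.tgt a)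
  omega

end Paths

/-! ### Words in the algebra -/

section Algebra

variable {V : Type u} {A : Type v} [Fintype V] [Fintype A] {k : Type w} [Field k]
  {Q : GentleQuiver V A}

@[simp] theorem word_nil : word k Q [] = 1 := by simp [word]

theorem word_append (p q : List A) : word k Q (p ++ q) = word k Q p * word k Q q := by
  simp [word]

theorem word_eq_zero_of_hasZero {p : List A} (h : HasZero Q p) : word k Q p = 0 := by
  obtain ⟨a, b, ⟨s, t, rfl⟩, hr⟩ := h
  have : word k Q [a, b] = 0 := by simp [word, arr_mul_arr hr]
  rw [word_append, word_append, this, mul_zero, zero_mul]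

theorem mul_mem_proj {p : List A} {x y : V} (h : IsPath Q p x y) (r : Alg k Q) :
    r * word k Q p ∈ proj k Q y :=
  Submodule.smul_mem _ r (word_mem_proj h)

theorem smul_mem_proj (c : k) {r : Alg k Q} {x : V} (h : r ∈ proj k Q x) :
    c • r ∈ proj k Q x := by
  rw [← algebraMap_smul (Alg k Q) c r]
  exact Submodule.smul_mem _ _ h

theorem idem_mem_proj (x : V) : idem k Q x ∈ proj k Q x := Submodule.mem_span_singleton_self _

/-- The action of a generator of `Λ` on the functions on the vertices of a path `p`, where the
position `i` carries the vertex `x i`. -/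
noncomputable def pathAction (k : Type w) [Field k] (p : List A) (x : ℕ → V) (g : V ⊕ A) :
    Module.End k (ℕ → k) := open Classical in
  match g with
  | Sum.inl y =>
    { toFun := fun φ i => if x i = y then φ i else 0
      map_add' := fun φ ψ => by ext i; simp only [Pi.add_apply]; split_ifs <;> simp
      map_smul' := fun c φ => by ext i; simp }
  | Sum.inr a =>
    { toFun := fun φ i => if p[i]? = some a then φ (i + 1) else 0
      map_add' := fun φ ψ => by ext i; simp only [Pi.add_apply]; split_ifs <;> simp
      map_smul' := fun c φ => by ext i; simp }

/-- The positions of a path carry a representation of the bound quiver: the idempotents partition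
the positions by their vertices, and a product of two arrows acts nontrivially only if they are
consecutive in `p`, where there is no relation. -/
theorem pathAction_rel {p : List A} (hp : p.IsChain Q.Good) {x : ℕ → V}
    (hx : ∀ i a, p[i]? = some a → x i = Q.tgt a ∧ x (i + 1) = Q.src a)
    {r s : FreeAlgebra k (V ⊕ A)} (h : AlgRel k Q r s) :
    FreeAlgebra.lift k (pathAction k p x) r = FreeAlgebra.lift k (pathAction k p x) s := by
  classical
  cases h with
  | idem y =>
    ext φ i
    simp only [map_mul, FreeAlgebra.lift_ι_apply, pathAction, Module.End.mul_apply,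
      LinearMap.coe_mk, AddHom.coe_mk]
    split_ifs <;> rfl
  | orth y z hyz =>
    ext φ i
    simp only [map_mul, FreeAlgebra.lift_ι_apply, pathAction, Module.End.mul_apply,
      LinearMap.coe_mk, AddHom.coe_mk, map_zero, LinearMap.zero_apply, Pi.zero_apply]
    split_ifs with h1 h2
    · exact absurd (h1.symm.trans h2) hyz
    · rfl
    · rfl
  | one =>
    ext φ i
    simp [pathAction, LinearMap.sum_apply, Finset.sum_apply]
  | tgt a =>
    ext φ i
    simp only [map_mul, FreeAlgebra.lift_ι_apply, pathAction, Module.End.mul_apply,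
      LinearMap.coe_mk, AddHom.coe_mk]
    split_ifs with h1 h2 h2
    · rfl
    · rfl
    · exact absurd (hx i a h2).1 h1
    · rfl
  | src a =>
    ext φ i
    simp only [map_mul, FreeAlgebra.lift_ι_apply, pathAction, Module.End.mul_apply,
      LinearMap.coe_mk, AddHom.coe_mk]
    split_ifs with h1 h2
    · rfl
    · exact absurd (hx i a h1).2 h2
    · rfl
  | rel a b hr =>
    ext φ i
    simp only [map_mul, FreeAlgebra.lift_ι_apply, pathAction, Module.End.mul_apply,
      LinearMap.coe_mk, AddHom.coe_mk, map_zero, LinearMap.zero_apply, Pi.zero_apply]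
    split_ifs with h1 h2
    · obtain ⟨l1, e1⟩ := List.getElem?_eq_some_iff.1 h1
      obtain ⟨l2, e2⟩ := List.getElem?_eq_some_iff.1 h2
      have := List.isChain_iff_getElem.1 hp i l2
      rw [e1, e2] at this
      exact absurd hr this.2
    · rfl
    · rfl

/-- Nonvanishing is detected in the representation on the positions of `p`: the word sends the
constant function `1` to a function with value `1` at the position `0`. It is needed to compare the
scalars of the two components of `f`. -/
theorem word_ne_zero {p : List A} {x y : V} (h : IsPath Q p x y) : word k Q p ≠ 0 := by
  classical
  -- The position `p.length` must carry the start `y` of the last arrow; later values do not matter.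
  let X : ℕ → V := fun i => if hi : i < p.length then Q.tgt p[i] else y
  have hX : ∀ i a, p[i]? = some a → X i = Q.tgt a ∧ X (i + 1) = Q.src a := by
    intro i a hi
    obtain ⟨l, e⟩ := List.getElem?_eq_some_iff.1 hi
    refine ⟨by simp [X, l, e], ?_⟩
    by_cases l' : i + 1 < p.length
    · have := (List.isChain_iff_getElem.1 h.chain i l').1
      simp [X, l', ← e, this]
    · simp only [X, dif_neg l']
      refine (h.src_last a ?_).symm
      rw [List.getLast?_eq_getElem?, show p.length - 1 = i by omega, hi]
      rfl
  let φ : Alg k Q →ₐ[k] Module.End k (ℕ → k) := RingQuot.liftAlgHom k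
    ⟨FreeAlgebra.lift k (pathAction k p X), fun _ _ hr => pathAction_rel h.chain hX hr⟩
  have hφ : ∀ a, φ (arr k Q a) = pathAction k p X (Sum.inr a) := fun a => by
    simp only [φ, arr, Alg.mk]
    erw [RingQuot.liftAlgHom_mkAlgHom_apply]
    simp
  -- Induction over the suffixes `q` of `p`; the evaluation takes place where `q` begins.
  have key : ∀ (q r : List A), p = r ++ q → φ (word k Q q) 1 r.length = 1 := by
    intro q
    induction q with
    | nil => intro r _; simp
    | cons a q ih =>
      intro r hr
      have := ih (r ++ [a]) (by simp [hr])
      rw [show a :: q = [a] ++ q from rfl, word_append, map_mul, Module.End.mul_apply]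
      have ha : word k Q [a] = arr k Q a := by simp [word]
      rw [ha, hφ]
      simp only [pathAction, LinearMap.coe_mk, AddHom.coe_mk]
      rw [if_pos (by simp [hr])]
      simpa using this
  intro h0
  have := key p [] rfl
  simp [h0] at this

end Algebra

/-! ### Ladders between two walks -/

section Ladder

variable {V : Type u} {A : Type v} [Fintype V] [Fintype A]

@[simp] theorem Letter.inv_path {A : Type v} (l : Letter A) : l.inv.path = l.path := rfl

@[simp] theorem Letter.inv_direct {A : Type v} (l : Letter A) : l.inv.direct = !l.direct := rfl

theorem Letter.Joins.inv {Q : GentleQuiver V A} {l : Letter A} {x y : V} (h : l.Joins Q x y) :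
    l.inv.Joins Q y x := by
  cases hl : l.direct <;> simpa [Letter.Joins, hl] using h

theorem Junction.inv {Q : GentleQuiver V A} {l r : Letter A} (h : Junction Q l r) :
    Junction Q r.inv l.inv := by
  cases hl : l.direct <;> cases hr : r.direct <;> simp only [Junction, hl, hr, Letter.inv_direct,
    Letter.inv_path, Bool.not_true, Bool.not_false] at h ⊢
  · exact h
  · exact h.symm
  · exact h.symm
  · exact h

variable (k : Type w) [Field k] (Q : GentleQuiver V A)

/-- The path of a direct letter as an element of `Λ`; zero if there is no letter or an inverse
letter. -/
noncomputable def fwd (l : Option (Letter A)) : Alg k Q :=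
  match l with
  | none => 0
  | some l => if l.direct then word k Q l.path else 0

/-- The path of an inverse letter as an element of `Λ`; zero if there is no letter or a direct
letter. -/
noncomputable def bwd (l : Option (Letter A)) : Alg k Q :=
  match l with
  | none => 0
  | some l => if l.direct then 0 else word k Q l.path

variable {k Q}

@[simp] theorem fwd_none : fwd k Q none = 0 := rfl
@[simp] theorem bwd_none : bwd k Q none = 0 := rfl
theorem fwd_direct {l : Letter A} (h : l.direct = true) : fwd k Q (some l) = word k Q l.path := by
  simp [fwd, h]
theorem bwd_inverse {l : Letter A} (h : l.direct = false) :
    bwd k Q (some l) = word k Q l.path := by simp [bwd, h]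
theorem fwd_inverse {l : Letter A} (h : l.direct = false) : fwd k Q (some l) = 0 := by
  simp [fwd, h]
theorem bwd_direct {l : Letter A} (h : l.direct = true) : bwd k Q (some l) = 0 := by
  simp [bwd, h]
theorem fwd_inv (l : Letter A) : fwd k Q (some l.inv) = bwd k Q (some l) := by
  cases h : l.direct <;> simp [fwd, bwd, h]
theorem bwd_inv (l : Letter A) : bwd k Q (some l.inv) = fwd k Q (some l) := by
  cases h : l.direct <;> simp [fwd, bwd, h]

/-- A walk running from right to left, with vertices `vtx i` and with the letter `letter i` between
`vtx (i + 1)` on its left and `vtx i` on its right. -/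
structure IsLeftWalk (Q : GentleQuiver V A) (vtx : ℕ → V) (letter : ℕ → Option (Letter A)) :
    Prop where
  joins : ∀ i, ∀ l ∈ letter i, l.Joins Q (vtx (i + 1)) (vtx i)
  junction : ∀ i, ∀ l ∈ letter (i + 1), ∀ r ∈ letter i, Junction Q l r

/-- A ladder `G` between two walks running from right to left: a family of elements of `Λ` which
intertwine their letters. -/
structure IsLadder (vx : ℕ → V) (x : ℕ → Option (Letter A)) (vy : ℕ → V)
    (y : ℕ → Option (Letter A)) (G : ℕ → Alg k Q) : Prop where
  fwd : ∀ i, fwd k Q (x i) * G i = G (i + 1) * fwd k Q (y i)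
  bwd : ∀ i, bwd k Q (x i) * G (i + 1) = G i * bwd k Q (y i)
  mem : ∀ i, G i ≠ 0 → ∀ r ∈ proj k Q (vx i), r * G i ∈ proj k Q (vy i)
  agree : ∀ i, G (i + 1) ≠ 0 → G i ≠ 0 ∧ ∃ l ∈ x i, ∃ l' ∈ y i, l.direct = l'.direct
  agree_succ : ∀ i, G (i + 2) ≠ 0 → x i = y i

variable {vx vy : ℕ → V} {x y : ℕ → Option (Letter A)} {G : ℕ → Alg k Q}

theorem IsLadder.ne_zero_of_le (h : IsLadder vx x vy y G) {i j : ℕ} (hij : i ≤ j)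
    (hj : G j ≠ 0) : G i ≠ 0 := by
  induction j, hij using Nat.le_induction with
  | base => exact hj
  | succ j _ ih => exact ih (h.agree j hj).1

/-- A ladder with independent scalars on the letters. -/
theorem IsLadder.exists_scalars (h : IsLadder vx x vy y G) (ξ υ : ℕ → k) (hξ : ∀ i, ξ i ≠ 0)
    (hυ : ∀ i, υ i ≠ 0) (c : k) : ∃ ν : ℕ → k, ν 0 = c ∧
      (∀ i, (ξ i • Gentle.fwd k Q (x i)) * (ν i • G i) =
        (ν (i + 1) • G (i + 1)) * (υ i • Gentle.fwd k Q (y i))) ∧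
      (∀ i, (ξ i • Gentle.bwd k Q (x i)) * (ν (i + 1) • G (i + 1)) =
        (ν i • G i) * (υ i • Gentle.bwd k Q (y i))) := by
  classical
  -- A letter is direct or inverse, so one of the two equations at each `i` reads `0 = 0`. The other
  -- one is solved for the scalar of the next rung.
  let ν : ℕ → k := fun i => Nat.rec c (fun i r =>
    if ∃ l ∈ x i, l.direct = true then ξ i * r / υ i else r * υ i / ξ i) i
  have hν : ∀ i, ν (i + 1) =
    if ∃ l ∈ x i, l.direct = true then ξ i * ν i / υ i else ν i * υ i / ξ i := fun i => rfl
  refine ⟨ν, rfl, fun i => ?_, fun i => ?_⟩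
  · simp only [smul_mul_smul_comm]
    rw [h.fwd i]
    by_cases hx : ∃ l ∈ x i, l.direct = true
    · rw [hν, if_pos hx, div_mul_cancel₀ _ (hυ i)]
    · have : Gentle.fwd k Q (x i) = 0 := by
        rcases hl : x i with _ | l
        · rfl
        · exact fwd_inverse (by simpa [hl] using hx)
      rw [← h.fwd i, this, zero_mul, smul_zero, smul_zero]
  · simp only [smul_mul_smul_comm]
    rw [h.bwd i]
    by_cases hx : ∃ l ∈ x i, l.direct = true
    · have : Gentle.bwd k Q (x i) = 0 := by
        obtain ⟨l, hl, hd⟩ := hx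
        rw [Option.mem_def.1 hl, bwd_direct hd]
      rw [← h.bwd i, this, zero_mul, smul_zero, smul_zero]
    · rw [hν, if_neg hx, mul_div_cancel₀ _ (hξ i)]

/-- The ladder with a single rung. -/
theorem isLadder_single {g : Alg k Q} (h1 : fwd k Q (x 0) * g = 0) (h2 : g * bwd k Q (y 0) = 0)
    (hg : ∀ r ∈ proj k Q (vx 0), r * g ∈ proj k Q (vy 0)) :
    IsLadder vx x vy y (fun i => if i = 0 then g else 0) where
  fwd i := by
    rcases i with _ | i
    · simpa using h1
    · simp
  bwd i := by
    rcases i with _ | i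
    · simpa using h2.symm
    · simp
  mem i hi := by
    rcases i with _ | i
    · simpa using hg
    · simp at hi
  agree i hi := by simp at hi
  agree_succ i hi := by simp at hi

/-- The ladder of identities along letters which agree, ending with one more rung. -/
theorem isLadder_of_agree (hx : IsLeftWalk Q vx x) (hy : IsLeftWalk Q vy y) (h0 : vx 0 = vy 0)
    (L : ℕ) (hL : ∀ i < L, x i = y i ∧ x i ≠ none) (g : Alg k Q)
    (h1 : fwd k Q (x L) = g * fwd k Q (y L)) (h2 : bwd k Q (x L) * g = bwd k Q (y L))
    (h3 : fwd k Q (x (L + 1)) * g = 0) (h4 : g * bwd k Q (y (L + 1)) = 0)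
    (hg : g ≠ 0 → (∀ r ∈ proj k Q (vx (L + 1)), r * g ∈ proj k Q (vy (L + 1))) ∧
      ∃ l ∈ x L, ∃ l' ∈ y L, l.direct = l'.direct) :
    IsLadder vx x vy y (fun i => if i ≤ L then 1 else if i = L + 1 then g else 0) := by
  have hv : ∀ i ≤ L, vx i = vy i := by
    intro i
    induction i with
    | zero => exact fun _ => h0
    | succ i ih =>
      intro hi
      obtain ⟨e, hn⟩ := hL i hi
      obtain ⟨l, hl⟩ := Option.ne_none_iff_exists'.1 hn
      have hjx := hx.joins i l hl
      have hjy := hy.joins i l (e ▸ hl)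
      cases hd : l.direct <;> simp only [Letter.Joins, hd, if_true, Bool.false_eq_true, if_false]
        at hjx hjy
      · exact hjx.eq_right hjy
      · exact hjx.eq_left hjy
  constructor
  · intro i
    rcases lt_trichotomy i L with h | rfl | h
    · rw [if_pos h.le, if_pos (by omega), (hL i h).1, mul_one, one_mul]
    · simpa using h1
    · by_cases h' : i = L + 1
      · subst h'; simpa using h3
      · simp [show ¬ i ≤ L by omega, h', show ¬ i < L by omega, show i ≠ L by omega]
  · intro i
    rcases lt_trichotomy i L with h | rfl | h
    · rw [if_pos h.le, if_pos (by omega), (hL i h).1, mul_one, one_mul]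
    · simpa using h2
    · by_cases h' : i = L + 1
      · subst h'; simpa using h4.symm
      · simp [show ¬ i ≤ L by omega, h', show ¬ i < L by omega, show i ≠ L by omega]
  · intro i hi
    by_cases h : i ≤ L
    · simp [h, hv i h]
    · by_cases h' : i = L + 1
      · subst h'; simp at hi ⊢; exact (hg hi).1
      · simp [h, h'] at hi
  · intro i hi
    have hiL : i ≤ L := by
      by_contra hn
      simp [show ¬ i + 1 ≤ L by omega, show i ≠ L by omega] at hi
    -- The rung `i` is `1`, which is nonzero because the rung `i + 1` is a nonzero element of the
    -- algebra.
    have : Nontrivial (Alg k Q) := ⟨_, _, hi⟩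
    refine ⟨by simp [hiL], ?_⟩
    rcases hiL.lt_or_eq with h | rfl
    · obtain ⟨e, hn⟩ := hL i h
      obtain ⟨l, hl⟩ := Option.ne_none_iff_exists'.1 hn
      exact ⟨l, hl, l, e ▸ hl, rfl⟩
    · simp at hi; exact (hg hi).2
  · intro i hi
    apply (hL i _).1
    by_contra hn
    simp [show ¬ i + 2 ≤ L by omega, show i + 1 ≠ L by omega] at hi

theorem Letter.Joins.isPath_of_direct {l : Letter A} {x y : V} (h : l.Joins Q x y)
    (hd : l.direct = true) : IsPath Q l.path x y := by simpa [Letter.Joins, hd] using h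

theorem Letter.Joins.isPath_of_inverse {l : Letter A} {x y : V} (h : l.Joins Q x y)
    (hd : l.direct = false) : IsPath Q l.path y x := by simpa [Letter.Joins, hd] using h

/-- Why a ladder may stop after the rung `g`. If the letter `x i` starts with the same arrow as `g`,
its junction with a direct letter `x (i + 1)` is a relation that also kills `g`. If `x i` is inverse
and its last arrow composes with `g`, the last arrow of `x (i + 1)` is a different one, and
gentleness allows only one nonzero composition with `a`. -/
theorem fwd_mul_word_eq_zero (hx : IsLeftWalk Q vx x) {i : ℕ} {g : List A} {a : A}
    (ha : a ∈ g.head?) (hta : Q.tgt a = vx (i + 1))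
    (h : (∃ l ∈ x i, l.direct = true ∧ a ∈ l.path.head?) ∨
      ∃ l ∈ x i, l.direct = false ∧ ∃ b ∈ l.path.getLast?, Q.Good b a) :
    fwd k Q (x (i + 1)) * word k Q g = 0 := by
  rcases hl2 : x (i + 1) with _ | l2
  · simp
  cases hd2 : l2.direct
  · simp [fwd_inverse hd2]
  rw [fwd_direct hd2]
  have hp := (hx.joins _ l2 hl2).isPath_of_direct hd2
  obtain ⟨c, hc, hcs⟩ := hp.exists_last
  refine word_mul_word hc ha ?_
  rcases h with ⟨l, hl, hd, hal⟩ | ⟨l, hl, hd, b, hb, hba⟩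
  · have hj := hx.junction i l2 hl2 l hl
    simp only [Junction, hd, hd2] at hj
    obtain ⟨c', hc', a', ha', hr⟩ := hj
    rw [Option.mem_def] at hc hc' ha' hal
    obtain rfl : c = c' := by simpa using hc.symm.trans hc'
    obtain rfl : a = a' := by simpa using hal.symm.trans ha'
    exact hr
  · have hj := hx.junction i l2 hl2 l hl
    simp only [Junction, hd, hd2] at hj
    by_contra hr
    have : c = b := GentleQuiver.Good.left_unique ⟨hcs.trans hta.symm, hr⟩ hba
    subst this
    exact hj (hc.trans hb.symm)

/-- The dual of `fwd_mul_word_eq_zero`, on the target side of the rung. -/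
theorem word_mul_bwd_eq_zero (hy : IsLeftWalk Q vy y) {i : ℕ} {g : List A} {a : A}
    (ha : a ∈ g.getLast?) (hta : Q.src a = vy (i + 1))
    (h : (∃ l ∈ y i, l.direct = false ∧ a ∈ l.path.getLast?) ∨
      ∃ l ∈ y i, l.direct = true ∧ ∃ b ∈ l.path.head?, Q.Good a b) :
    word k Q g * bwd k Q (y (i + 1)) = 0 := by
  rcases hl2 : y (i + 1) with _ | l2
  · simp
  cases hd2 : l2.direct
  swap
  · simp [bwd_direct hd2]
  rw [bwd_inverse hd2]
  have hp := (hy.joins _ l2 hl2).isPath_of_inverse hd2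
  obtain ⟨c, hc, hcs⟩ := hp.exists_head
  refine word_mul_word ha hc ?_
  rcases h with ⟨l, hl, hd, hal⟩ | ⟨l, hl, hd, b, hb, hba⟩
  · have hj := hy.junction i l2 hl2 l hl
    simp only [Junction, hd, hd2] at hj
    obtain ⟨a', ha', c', hc', hr⟩ := hj
    rw [Option.mem_def] at hc hc' ha' hal
    obtain rfl : c = c' := by simpa using hc.symm.trans hc'
    obtain rfl : a = a' := by simpa using hal.symm.trans ha'
    exact hr
  · have hj := hy.junction i l2 hl2 l hl
    simp only [Junction, hd, hd2] at hj
    by_contra hr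
    have : c = b := GentleQuiver.Good.right_unique ⟨hta.trans hcs.symm, hr⟩ hba
    subst this
    exact hj (hc.trans hb.symm)

/-- At the first difference of the walks `x` and `y`, the walk `x` maps to the walk `y`. -/
def Descends (l l' : Option (Letter A)) : Prop :=
  ((∀ a ∈ l, a.direct = false) ∧ ∀ a ∈ l', a.direct = true) ∨
  (∃ a ∈ l, ∃ b ∈ l', a.direct = true ∧ b.direct = true ∧ ∃ g, g ≠ [] ∧ a.path = g ++ b.path) ∨
  (∃ a ∈ l, ∃ b ∈ l', a.direct = false ∧ b.direct = false ∧ ∃ g, g ≠ [] ∧ b.path = a.path ++ g)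

/-- Identities up to the vertex before the first difference, then one rung: zero, or the path `g` by
which the two letters differ. The ladder ends there because `g` composes to zero with the following
letters. -/
theorem exists_isLadder_of_descends (hx : IsLeftWalk Q vx x) (hy : IsLeftWalk Q vy y)
    (h0 : vx 0 = vy 0) (L : ℕ) (hL : ∀ i < L, x i = y i ∧ x i ≠ none)
    (hD : Descends (x L) (y L)) :
    ∃ G : ℕ → Alg k Q, IsLadder vx x vy y G ∧ G 0 = 1 ∧ ∃ n, ∀ i ≥ n, G i = 0 := by
  have hv : vx L = vy L := by
    rcases L with _ | L
    · exact h0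
    · obtain ⟨e, hn⟩ := hL L L.lt_succ_self
      obtain ⟨l, hl⟩ := Option.ne_none_iff_exists'.1 hn
      have hjx := hx.joins L l hl
      have hjy := hy.joins L l (e ▸ hl)
      cases hd : l.direct
      · exact (hjx.isPath_of_inverse hd).eq_right (hjy.isPath_of_inverse hd)
      · exact (hjx.isPath_of_direct hd).eq_left (hjy.isPath_of_direct hd)
  suffices h : ∃ g : Alg k Q, fwd k Q (x L) = g * fwd k Q (y L) ∧
      bwd k Q (x L) * g = bwd k Q (y L) ∧
      fwd k Q (x (L + 1)) * g = 0 ∧ g * bwd k Q (y (L + 1)) = 0 ∧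
      (g ≠ 0 → (∀ r ∈ proj k Q (vx (L + 1)), r * g ∈ proj k Q (vy (L + 1))) ∧
      ∃ l ∈ x L, ∃ l' ∈ y L, l.direct = l'.direct) by
    obtain ⟨g, h1, h2, h3, h4, h5⟩ := h
    refine ⟨_, isLadder_of_agree hx hy h0 L hL g h1 h2 h3 h4 h5, by simp, L + 2, fun i hi => ?_⟩
    simp [show ¬ i ≤ L by omega, show i ≠ L + 1 by omega]
  rcases hD with ⟨h1, h2⟩ | ⟨a, ha, b, hb, hda, hdb, g, hg, e⟩ | ⟨a, ha, b, hb, hda, hdb, g, hg, e⟩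
  · refine ⟨0, ?_, ?_, by simp, by simp, by simp⟩
    · rcases h : x L with _ | l
      · simp
      · simp [fwd_inverse (h1 l h)]
    · rcases h : y L with _ | l
      · simp
      · simp [bwd_direct (h2 l h)]
  · have pa := (hx.joins L a ha).isPath_of_direct hda
    have pb := (hy.joins L b hb).isPath_of_direct hdb
    rw [e] at pa
    have pg := pa.left_of_append hg pb
    obtain ⟨c, hc, hc'⟩ := pg.exists_head
    obtain ⟨d, hd, hd'⟩ := pg.exists_last
    obtain ⟨b0, hb0, -⟩ := pb.exists_head
    refine ⟨word k Q g, ?_, ?_, ?_, ?_, fun _ => ⟨fun r _ => mul_mem_proj pg r, a, ha, b, hb,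
      by rw [hda, hdb]⟩⟩
    · rw [Option.mem_def.1 ha, Option.mem_def.1 hb, fwd_direct hda, fwd_direct hdb, e, word_append]
    · rw [Option.mem_def.1 ha, Option.mem_def.1 hb, bwd_direct hda, bwd_direct hdb, zero_mul]
    · refine fwd_mul_word_eq_zero hx hc hc' (Or.inl ⟨a, ha, hda, ?_⟩)
      rw [e, List.head?_append_of_ne_nil _ hg]
      exact hc
    · exact word_mul_bwd_eq_zero hy hd hd' (Or.inr ⟨b, hb, hdb, b0, hb0,
        pa.good_of_append hd hb0⟩)
  · have pa := (hx.joins L a ha).isPath_of_inverse hda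
    have pb := (hy.joins L b hb).isPath_of_inverse hdb
    rw [e] at pb
    have pg := pb.right_of_append hg pa
    obtain ⟨c, hc, hc'⟩ := pg.exists_head
    obtain ⟨d, hd, hd'⟩ := pg.exists_last
    obtain ⟨b0, hb0, -⟩ := pa.exists_last
    refine ⟨word k Q g, ?_, ?_, ?_, ?_, fun _ => ⟨fun r _ => mul_mem_proj pg r, a, ha, b, hb,
      by rw [hda, hdb]⟩⟩
    · rw [Option.mem_def.1 ha, Option.mem_def.1 hb, fwd_inverse hda, fwd_inverse hdb, mul_zero]
    · rw [Option.mem_def.1 ha, Option.mem_def.1 hb, bwd_inverse hda, bwd_inverse hdb, e,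
        word_append]
    · exact fwd_mul_word_eq_zero hx hc hc' (Or.inr ⟨a, ha, hda, b0, hb0,
        pb.good_of_append hb0 hc⟩)
    · refine word_mul_bwd_eq_zero hy hd hd' (Or.inl ⟨b, hb, hdb, ?_⟩)
      rw [e, List.getLast?_append_of_ne_nil _ hg]
      exact hd

/-- Two different letters with the same right vertex and the same neighbour on the right. -/
theorem descends_or_descends {l l' r : Letter A} {v v' z z' : V} (hl : l.Joins Q v z)
    (hl' : l'.Joins Q v' z) (hr : r.Joins Q z z') (h : Junction Q l r) (h' : Junction Q l' r)
    (hne : l ≠ l') : Descends (some l) (some l') ∨ Descends (some l') (some l) := by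
  have hne' : l.direct = l'.direct → l.path ≠ l'.path := by
    intro h1 h2
    cases l; cases l'; simp_all
  cases hd : l.direct <;> cases hd' : l'.direct
  · have p := hl.isPath_of_inverse hd
    have p' := hl'.isPath_of_inverse hd'
    obtain ⟨a, ha, has⟩ := p.exists_head
    obtain ⟨a', ha', has'⟩ := p'.exists_head
    -- The neighbour `r` fixes the arrow at the junction: either it is the only one in relation with
    -- the arrow of `r`, or the only one at this vertex other than the arrow of `r`.
    have : a = a' := by
      cases hdr : r.direct <;> simp only [Junction, hd, hd', hdr] at h h'
      · obtain ⟨b, hb, c, hc, hbc⟩ := h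
        obtain ⟨b', hb', c', hc', hbc'⟩ := h'
        rw [Option.mem_unique ha hc, Option.mem_unique ha' hc']
        rw [Option.mem_unique hb' hb] at hbc'
        exact Q.rel_right _ _ _ hbc hbc'
      · obtain ⟨c, hc, hcs⟩ := (hr.isPath_of_direct hdr).exists_head
        refine Q.tgt_unique (a := c) (has.trans hcs.symm) (has'.trans hcs.symm) ?_ ?_
        · rintro rfl; exact h (ha.trans hc.symm)
        · rintro rfl; exact h' (ha'.trans hc.symm)
    subst this
    -- A path without relations continues in only one way, so two of them with the same first arrow
    -- are comparable.
    rcases List.isPrefix_or_isPrefix_of_isChain (R := Q.Good)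
      (fun _ _ _ => GentleQuiver.Good.right_unique) p.chain p'.chain
      (by rw [Option.mem_def.1 ha, Option.mem_def.1 ha']) with ⟨g, hg⟩ | ⟨g, hg⟩
    · exact Or.inl (Or.inr (Or.inr ⟨l, rfl, l', rfl, hd, hd', g, by
        rintro rfl; exact hne' (hd.trans hd'.symm) (by simpa using hg), hg.symm⟩))
    · exact Or.inr (Or.inr (Or.inr ⟨l', rfl, l, rfl, hd', hd, g, by
        rintro rfl; exact hne' (hd.trans hd'.symm) (by simpa using hg.symm), hg.symm⟩))
  -- Opposite directions: the walk with the inverse letter maps to the other one, with a zero rung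
  -- at the end.
  · left; left; simp [hd, hd']
  · right; left; simp [hd, hd']
  · have p := hl.isPath_of_direct hd
    have p' := hl'.isPath_of_direct hd'
    obtain ⟨a, ha, has⟩ := p.exists_last
    obtain ⟨a', ha', has'⟩ := p'.exists_last
    have : a = a' := by
      cases hdr : r.direct <;> simp only [Junction, hd, hd', hdr] at h h'
      · obtain ⟨c, hc, hcs⟩ := (hr.isPath_of_inverse hdr).exists_last
        refine Q.src_unique (a := c) (has.trans hcs.symm) (has'.trans hcs.symm) ?_ ?_
        · rintro rfl; exact h (ha.trans hc.symm)
        · rintro rfl; exact h' (ha'.trans hc.symm)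
      · obtain ⟨b, hb, c, hc, hbc⟩ := h
        obtain ⟨b', hb', c', hc', hbc'⟩ := h'
        rw [Option.mem_unique ha hb, Option.mem_unique ha' hb']
        rw [Option.mem_unique hc' hc] at hbc'
        exact Q.rel_left _ _ _ hbc hbc'
    subst this
    rcases List.isSuffix_or_isSuffix_of_isChain (R := Q.Good)
      (fun _ _ _ => GentleQuiver.Good.left_unique) p.chain p'.chain
      (by rw [Option.mem_def.1 ha, Option.mem_def.1 ha']) with ⟨g, hg⟩ | ⟨g, hg⟩
    · exact Or.inr (Or.inr (Or.inl ⟨l', rfl, l, rfl, hd', hd, g, by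
        rintro rfl; exact hne' (hd.trans hd'.symm) (by simpa using hg), hg.symm⟩))
    · exact Or.inl (Or.inr (Or.inl ⟨l, rfl, l', rfl, hd, hd', g, by
        rintro rfl; exact hne' (hd.trans hd'.symm) (by simpa using hg.symm), hg.symm⟩))

/-- Two walks with the same right neighbour `z`: one of them maps to the other by a
ladder starting with an identity; the ladder from `y` to `x` can be taken finite. -/
theorem exists_isLadder (hx : IsLeftWalk Q vx x) (hy : IsLeftWalk Q vy y) (h0 : vx 0 = vy 0)
    {z : Letter A} {z' : V} (hz : z.Joins Q (vx 0) z') (hxz : ∀ l ∈ x 0, Junction Q l z)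
    (hyz : ∀ l ∈ y 0, Junction Q l z) :
    (∃ G : ℕ → Alg k Q, IsLadder vx x vy y G ∧ G 0 = 1) ∨
    (∃ G : ℕ → Alg k Q, IsLadder vy y vx x G ∧ G 0 = 1 ∧ ∃ n, ∀ i ≥ n, G i = 0) := by
  classical
  by_cases hall : ∀ i, x i = y i ∧ x i ≠ none
  -- Walks that never differ give an infinite ladder of identities. It has to be used from `x` to
  -- `y`, the alternative being required to be finite.
  · left
    refine ⟨fun _ => 1, ⟨fun i => ?_, fun i => ?_, fun i _ => ?_, fun i h => ⟨h, ?_⟩, fun i _ =>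
      (hall i).1⟩, rfl⟩
    · rw [(hall i).1, mul_one, one_mul]
    · rw [(hall i).1, mul_one, one_mul]
    · suffices vx i = vy i by simp [this]
      induction i with
      | zero => exact h0
      | succ i _ =>
        obtain ⟨l, hl⟩ := Option.ne_none_iff_exists'.1 (hall i).2
        have hjx := hx.joins i l hl
        have hjy := hy.joins i l ((hall i).1 ▸ hl)
        cases hd : l.direct
        · exact (hjx.isPath_of_inverse hd).eq_right (hjy.isPath_of_inverse hd)
        · exact (hjx.isPath_of_direct hd).eq_left (hjy.isPath_of_direct hd)
    · obtain ⟨l, hl⟩ := Option.ne_none_iff_exists'.1 (hall i).2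
      exact ⟨l, hl, l, (hall i).1 ▸ hl, rfl⟩
  · have hex : ∃ i, ¬ (x i = y i ∧ x i ≠ none) := by simpa only [not_forall] using hall
    have hL : ∀ i < Nat.find hex, x i = y i ∧ x i ≠ none := fun i hi =>
      not_not.1 (Nat.find_min hex hi)
    have hL' := Nat.find_spec hex
    generalize Nat.find hex = L at hL hL'
    have hyL : ∀ i < L, y i = x i ∧ y i ≠ none := fun i hi =>
      ⟨(hL i hi).1.symm, (hL i hi).1 ▸ (hL i hi).2⟩
    have hD : Descends (x L) (y L) ∨ Descends (y L) (x L) := by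
      -- A walk that has ended behaves like an inverse letter as a source and like a direct letter
      -- as a target.
      rcases hxL : x L with _ | l <;> rcases hyL : y L with _ | l'
      · left; left; simp
      · cases h : l'.direct
        · right; left; simp [h]
        · left; left; simp [h]
      · cases h : l.direct
        · left; left; simp [h]
        · right; left; simp [h]
      · have hne : l ≠ l' := by
          rintro rfl
          exact hL' ⟨by rw [hxL, hyL], by simp [hxL]⟩
        rcases L with _ | L
        · exact descends_or_descends (hx.joins 0 l hxL) (h0 ▸ hy.joins 0 l' hyL) hz (hxz l hxL)
            (hyz l' hyL) hne
        · obtain ⟨e, hn⟩ := hL L L.lt_succ_self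
          obtain ⟨r, hr⟩ := Option.ne_none_iff_exists'.1 hn
          have hr' : y L = some r := e ▸ hr
          have hjx := hx.joins L r hr
          have hjy := hy.joins L r hr'
          have hv : vx (L + 1) = vy (L + 1) := by
            cases hd : r.direct
            · exact (hjx.isPath_of_inverse hd).eq_right (hjy.isPath_of_inverse hd)
            · exact (hjx.isPath_of_direct hd).eq_left (hjy.isPath_of_direct hd)
          exact descends_or_descends (hx.joins (L + 1) l hxL) (hv ▸ hy.joins (L + 1) l' hyL) hjx
            (hx.junction L l hxL r hr) (hy.junction L l' hyL r hr') hne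
    rcases hD with hD | hD
    · obtain ⟨G, h1, h2, -⟩ := exists_isLadder_of_descends (k := k) hx hy h0 L hL hD
      exact Or.inl ⟨G, h1, h2⟩
    · exact Or.inr (exists_isLadder_of_descends (k := k) hy hx h0.symm L hyL hD)

end Ladder

/-! ### Maps between walk complexes given by matrices -/

section Matrices

open CochainComplex HomComplex

variable {V : Type u} {A : Type v} [Fintype V] [Fintype A] {k : Type w} [Field k]
  {Q : GentleQuiver V A} {ι ι' ι'' : Type}

theorem single_mem_term {W : Walk V A ι} {deg : ι → ℤ} {n : ℤ} {j : ι} {r : Alg k Q}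
    (hr : r ∈ proj k Q (W.vtx j)) (h : r ≠ 0 → j ∈ W.carrier ∧ deg j = n) :
    Finsupp.single j r ∈ term k Q W deg n := by
  classical
  intro l
  by_cases hl : j = l
  · subst hl; simpa [hr] using h
  · simp [Finsupp.single_eq_of_ne' hl]

theorem linearCombination_mem_term {W : Walk V A ι} {W' : Walk V A ι'}
    {r : ι → ι' →₀ Alg k Q} {deg : ι → ℤ} {deg' : ι' → ℤ} {n n' : ℤ}
    (h : ∀ i ∈ W.carrier, deg i = n → ∀ u ∈ proj k Q (W.vtx i), u • r i ∈ term k Q W' deg' n')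
    {u : ι →₀ Alg k Q} (hu : u ∈ term k Q W deg n) :
    Finsupp.linearCombination (Alg k Q) r u ∈ term k Q W' deg' n' := by
  rw [Finsupp.linearCombination_apply]
  refine Submodule.sum_mem _ fun i hi => ?_
  obtain ⟨h1, h2⟩ := (hu i).2 (Finsupp.mem_support_iff.1 hi)
  exact h i h1 h2 _ (hu i).1

variable [Ring ι] [Ring ι'] [Ring ι'']

variable {W : Walk V A ι} {hW : IsWalk Q W} {coef : ι → k} {deg : ι → ℤ} {hdeg : IsGrading W deg}
  {W' : Walk V A ι'} {hW' : IsWalk Q W'} {coef' : ι' → k} {deg' : ι' → ℤ}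
  {hdeg' : IsGrading W' deg'}
  {W'' : Walk V A ι''} {hW'' : IsWalk Q W''} {coef'' : ι'' → k} {deg'' : ι'' → ℤ}
  {hdeg'' : IsGrading W'' deg''}

theorem walkComplex_d {n n' : ℤ} (h : n + 1 = n') : (walkComplex k hW coef hdeg).d n n' =
    ModuleCat.ofHom ((diff k Q W coef).restrict (diff_mem W coef hW hdeg h)) := dif_pos h

variable (hW coef hdeg hW' coef' hdeg') in
/-- The cochain of degree `e` given by a linear map of the underlying free modules. -/
noncomputable def linCochain (Φ : (ι →₀ Alg k Q) →ₗ[Alg k Q] (ι' →₀ Alg k Q)) (e : ℤ)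
    (h : ∀ n n', n + e = n' → ∀ u ∈ term k Q W deg n, Φ u ∈ term k Q W' deg' n') :
    Cochain (walkComplex k hW coef hdeg) (walkComplex k hW' coef' hdeg') e :=
  Cochain.mk fun p q hpq => ModuleCat.ofHom (Φ.restrict (h p q hpq))

variable (hW coef hdeg hW' coef' hdeg') in
/-- The chain map given by a linear map of the underlying free modules. -/
noncomputable def linHom (Φ : (ι →₀ Alg k Q) →ₗ[Alg k Q] (ι' →₀ Alg k Q))
    (h : ∀ n, ∀ u ∈ term k Q W deg n, Φ u ∈ term k Q W' deg' n)
    (hc : ∀ u, diff k Q W' coef' (Φ u) = Φ (diff k Q W coef u)) :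
    walkComplex k hW coef hdeg ⟶ walkComplex k hW' coef' hdeg' where
  f n := ModuleCat.ofHom (Φ.restrict (h n))
  comm' n n' hn := by
    have hn' : n + 1 = n' := hn
    rw [walkComplex_d hn', walkComplex_d hn']
    exact ModuleCat.hom_ext (LinearMap.ext fun u => Subtype.ext (hc u.1))

/-- The chain map `f` is given by the linear map `F` of the underlying free modules. -/
def Represents (f : walkComplex k hW coef hdeg ⟶ walkComplex k hW' coef' hdeg')
    (F : (ι →₀ Alg k Q) →ₗ[Alg k Q] (ι' →₀ Alg k Q)) : Prop :=
  ∀ (n : ℤ) (u : term k Q W deg n),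
    (show term k Q W' deg' n from (f.f n).hom u).1 = F u.1

/-- A matrix `Φ` of degree `-1` is a homotopy as soon as one identity holds on the free modules,
with all degrees treated at once. -/
theorem map_eq_zero_of_homotopy {f : walkComplex k hW coef hdeg ⟶ walkComplex k hW' coef' hdeg'}
    {F : (ι →₀ Alg k Q) →ₗ[Alg k Q] (ι' →₀ Alg k Q)} (hf : Represents f F)
    (Φ : (ι →₀ Alg k Q) →ₗ[Alg k Q] (ι' →₀ Alg k Q))
    (h : ∀ n n', n + (-1) = n' → ∀ u ∈ term k Q W deg n, Φ u ∈ term k Q W' deg' n')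
    (hΦ : ∀ u, F u = Φ (diff k Q W coef u) + diff k Q W' coef' (Φ u)) :
    (HomotopyCategory.quotient (ModuleCat.{max u v w} (Alg k Q)) (ComplexShape.up ℤ)).map f = 0 := by
  have : Homotopy f 0 := by
    refine Cochain.equivHomotopy f 0 |>.symm ⟨linCochain hW coef hdeg hW' coef' hdeg' Φ (-1) h, ?_⟩
    rw [Cochain.ofHom_zero, add_zero]
    ext p : 1
    rw [δ_v (-1) 0 (by simp) _ p p (by simp) (p - 1) (p + 1) (by simp) (by simp)]
    simp only [Cochain.ofHom_v, linCochain]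
    rw [walkComplex_d (show p + 1 = p + 1 by simp), walkComplex_d (show p - 1 + 1 = p by simp)]
    refine ModuleCat.hom_ext (LinearMap.ext fun u => Subtype.ext ?_)
    refine (hf p u).trans ((hΦ u.1).trans ?_)
    simp only [Int.negOnePow_zero, one_smul]
    rw [add_comm]
    rfl
  rw [HomotopyCategory.eq_of_homotopy _ _ this, Functor.map_zero]

/-- A map out of the cone is a cochain `Φ` of degree `-1` on the source together with a chain map
`Ψ` on the target such that `f` followed by `Ψ` is the boundary of `Φ`. `inj` and `surj` make it
bijective in each degree, hence an isomorphism of complexes. -/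
theorem nonempty_mappingCone_iso
    {f : walkComplex k hW coef hdeg ⟶ walkComplex k hW' coef' hdeg'}
    {F : (ι →₀ Alg k Q) →ₗ[Alg k Q] (ι' →₀ Alg k Q)} (hf : Represents f F)
    (Φ : (ι →₀ Alg k Q) →ₗ[Alg k Q] (ι'' →₀ Alg k Q))
    (Ψ : (ι' →₀ Alg k Q) →ₗ[Alg k Q] (ι'' →₀ Alg k Q))
    (hΦ : ∀ n n', n + (-1) = n' → ∀ u ∈ term k Q W deg n, Φ u ∈ term k Q W'' deg'' n')
    (hΨ : ∀ n, ∀ u ∈ term k Q W' deg' n, Ψ u ∈ term k Q W'' deg'' n)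
    (hΨd : ∀ u, diff k Q W'' coef'' (Ψ u) = Ψ (diff k Q W' coef' u))
    (hΦd : ∀ u, diff k Q W'' coef'' (Φ u) + Φ (diff k Q W coef u) = Ψ (F u))
    (inj : ∀ u v, Φ u + Ψ v = 0 → u = 0 ∧ v = 0)
    (surj : ∀ n, ∀ z ∈ term k Q W'' deg'' n, ∃ u ∈ term k Q W deg (n + 1),
      ∃ v ∈ term k Q W' deg' n, Φ u + Ψ v = z) :
    Nonempty (CochainComplex.mappingCone f ≅ walkComplex k hW'' coef'' hdeg'') := by
  let α := linCochain hW coef hdeg hW'' coef'' hdeg'' Φ (-1) hΦ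
  let β := linHom hW' coef' hdeg' hW'' coef'' hdeg'' Ψ hΨ hΨd
  have eq : δ (-1) 0 α = Cochain.ofHom (f ≫ β) := by
    ext p : 1
    rw [δ_v (-1) 0 (by simp) _ p p (by simp) (p - 1) (p + 1) (by simp) (by simp)]
    simp only [Cochain.ofHom_v, α, linCochain]
    rw [walkComplex_d (show p + 1 = p + 1 by simp), walkComplex_d (show p - 1 + 1 = p by simp)]
    refine ModuleCat.hom_ext (LinearMap.ext fun u => Subtype.ext ?_)
    refine Eq.trans ?_ ((hΦd u.1).trans (congrArg Ψ (hf p u)).symm)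
    simp only [Int.negOnePow_zero, one_smul]
    rfl
  let g := mappingCone.desc f α β eq
  have hg : ∀ n, IsIso (g.f n) := by
    intro n
    rw [ConcreteCategory.isIso_iff_bijective]
    have hinl : ∀ u, g.f n ((mappingCone.inl f).v (n + 1) n (by omega) u) =
        α.v (n + 1) n (by omega) u := fun u => by
      rw [← mappingCone.inl_v_desc_f f α β eq (n + 1) n (by omega)]; rfl
    have hinr : ∀ v, g.f n ((mappingCone.inr f).f n v) = β.f n v := fun v => by
      rw [← mappingCone.inr_f_desc_f f α β eq n]; rfl
    constructor
    · rw [injective_iff_map_eq_zero]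
      intro z hz
      have hz' : z = (mappingCone.inl f).v (n + 1) n (by omega)
          ((mappingCone.fst f).1.v n (n + 1) rfl z) +
          (mappingCone.inr f).f n ((mappingCone.snd f).v n n (add_zero n) z) := by
        have := congrArg (fun φ => φ z) (congrArg (fun φ => ModuleCat.Hom.hom φ)
          (mappingCone.id_X f n (n + 1) rfl))
        exact this.symm
      generalize (mappingCone.fst f).1.v n (n + 1) rfl z = u at hz'
      generalize (mappingCone.snd f).v n n (add_zero n) z = v at hz'
      rw [hz', map_add, hinl, hinr] at hz
      obtain ⟨h1, h2⟩ := inj u.1 v.1 (congrArg Subtype.val hz)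
      obtain rfl : u = 0 := Subtype.ext h1
      obtain rfl : v = 0 := Subtype.ext h2
      rw [hz', map_zero, map_zero, add_zero]
    · intro z
      obtain ⟨u, hu, v, hv, huv⟩ := surj n z.1 z.2
      exact ⟨(mappingCone.inl f).v (n + 1) n (by omega) ⟨u, hu⟩ +
        (mappingCone.inr f).f n ⟨v, hv⟩, (map_add _ _ _).trans
        ((congrArg₂ (· + ·) (hinl _) (hinr _)).trans (Subtype.ext huv))⟩
  have : IsIso g := HomologicalComplex.Hom.isIso_of_components g
  exact ⟨asIso g⟩

end Matrices

/-! ### Entries of the differential, and rescaling of letters -/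

section Rows

variable {V : Type u} {A : Type v} [Fintype V] [Fintype A] {k : Type w} [Field k]
  {Q : GentleQuiver V A} {ι ι' : Type}

theorem linearMap_ext_rows {M : Type*} [AddCommMonoid M] [Module (Alg k Q) M]
    {f g : (ι →₀ Alg k Q) →ₗ[Alg k Q] M}
    (h : ∀ i, f (Finsupp.single i 1) = g (Finsupp.single i 1)) : f = g :=
  Finsupp.lhom_ext' fun i => LinearMap.ext_ring (h i)

variable (k Q) in
/-- The left linear endomorphism multiplying the component `i` by the scalar `θ i`. -/
noncomputable def scale (θ : ι → k) : (ι →₀ Alg k Q) →ₗ[Alg k Q] (ι →₀ Alg k Q) :=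
  Finsupp.linearCombination (Alg k Q) fun i => Finsupp.single i (algebraMap k (Alg k Q) (θ i))

theorem scale_single (θ : ι → k) (i : ι) (r : Alg k Q) :
    scale k Q θ (Finsupp.single i r) = Finsupp.single i (θ i • r) := by
  simp [scale, ← Algebra.commutes, Algebra.smul_def]

theorem scale_scale (θ η : ι → k) (h : ∀ i, θ i * η i = 1) (u : ι →₀ Alg k Q) :
    scale k Q θ (scale k Q η u) = u := by
  have : scale k Q θ ∘ₗ scale k Q η = LinearMap.id := linearMap_ext_rows fun i => by
    simp [scale_single, smul_smul, h]
  exact LinearMap.congr_fun this u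

variable [Ring ι]

variable (k Q) in
open Classical in
/-- The scaled direct letter at the position `i`, or zero. -/
noncomputable def dirEntry (W : Walk V A ι) (coef : ι → k) (i : ι) : Alg k Q :=
  if i ∈ W.carrier ∧ i + 1 ∈ W.carrier then coef i • fwd k Q (some (W.letter i)) else 0

variable (k Q) in
open Classical in
/-- The scaled inverse letter at the position `i`, or zero. -/
noncomputable def invEntry (W : Walk V A ι) (coef : ι → k) (i : ι) : Alg k Q :=
  if i ∈ W.carrier ∧ i + 1 ∈ W.carrier then coef i • bwd k Q (some (W.letter i)) else 0

variable {W : Walk V A ι} {coef : ι → k}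

theorem dirEntry_of_mem {i : ι} (h : i ∈ W.carrier) (h' : i + 1 ∈ W.carrier) :
    dirEntry k Q W coef i = coef i • fwd k Q (some (W.letter i)) := if_pos ⟨h, h'⟩

theorem invEntry_of_mem {i : ι} (h : i ∈ W.carrier) (h' : i + 1 ∈ W.carrier) :
    invEntry k Q W coef i = coef i • bwd k Q (some (W.letter i)) := if_pos ⟨h, h'⟩

theorem row_eq (i : ι) : row k Q W coef i =
    Finsupp.single (i + 1) (dirEntry k Q W coef i) +
      Finsupp.single (i - 1) (invEntry k Q W coef (i - 1)) := by
  classical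
  unfold row dirEntry invEntry
  congr 1
  · by_cases h : i ∈ W.carrier ∧ i + 1 ∈ W.carrier
    · cases hd : (W.letter i).direct
      · simp [fwd_inverse hd]
      · simp [fwd_direct hd, h]
    · rw [if_neg h, if_neg (by tauto), Finsupp.single_zero]
  · rw [sub_add_cancel]
    by_cases h : i - 1 ∈ W.carrier ∧ i ∈ W.carrier
    · cases hd : (W.letter (i - 1)).direct
      · simp [bwd_inverse hd, h]
      · simp [bwd_direct hd]
    · rw [if_neg h, if_neg (by tauto), Finsupp.single_zero]

theorem diff_single (i : ι) (r : Alg k Q) :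
    diff k Q W coef (Finsupp.single i r) =
    Finsupp.single (i + 1) (r * dirEntry k Q W coef i) +
      Finsupp.single (i - 1) (r * invEntry k Q W coef (i - 1)) := by
  simp [diff, row_eq]

/-- A diagonal change of basis by `θ` multiplies the scalar of a letter by the ratio of `θ` at its
two ends. The inverse is the diagonal map of the inverses. -/
theorem nonempty_iso_of_scalars {hW : IsWalk Q W} {coef' : ι → k} {deg : ι → ℤ}
    {hdeg : IsGrading W deg} (θ : ι → k) (hθ : ∀ i, θ i ≠ 0)
    (h1 : ∀ i, (W.letter i).direct = true → θ i * coef' i = coef i * θ (i + 1))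
    (h2 : ∀ i, (W.letter i).direct = false → θ (i + 1) * coef' i = coef i * θ i) :
    Nonempty (walkComplex k hW coef hdeg ≅ walkComplex k hW coef' hdeg) := by
  have hmem : ∀ η : ι → k, ∀ n, ∀ u ∈ term k Q W deg n, scale k Q η u ∈ term k Q W deg n := by
    intro η n u hu
    refine linearCombination_mem_term (fun i hi hd u hu => ?_) hu
    rw [Finsupp.smul_single, smul_eq_mul, ← Algebra.commutes, ← Algebra.smul_def]
    exact single_mem_term (smul_mem_proj _ hu) fun _ => ⟨hi, hd⟩
  have hcomm : ∀ (η c c' : ι → k)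
      (_ : ∀ i, (W.letter i).direct = true → η i * c' i = c i * η (i + 1))
      (_ : ∀ i, (W.letter i).direct = false → η (i + 1) * c' i = c i * η i),
      ∀ u, diff k Q W c' (scale k Q η u) = scale k Q η (diff k Q W c u) := by
    intro η c c' h1 h2 u
    have : diff k Q W c' ∘ₗ scale k Q η = scale k Q η ∘ₗ diff k Q W c := by
      refine linearMap_ext_rows fun i => ?_
      simp only [LinearMap.comp_apply, scale_single, diff_single, one_mul, map_add, smul_one_mul]
      congr 2
      · unfold dirEntry
        split_ifs
        · cases hd : (W.letter i).direct
          · simp [fwd_inverse hd]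
          · rw [smul_smul, smul_smul, h1 i hd, mul_comm]
        · simp
      · unfold invEntry
        split_ifs
        · cases hd : (W.letter (i - 1)).direct
          · have := h2 (i - 1) hd
            rw [sub_add_cancel] at this
            rw [smul_smul, smul_smul, this, mul_comm]
          · simp [bwd_direct hd]
        · simp
    exact LinearMap.congr_fun this u
  have hθ' : ∀ i j, ∀ c c' : k, θ i * c' = c * θ j → (θ i)⁻¹ * c = c' * (θ j)⁻¹ := by
    intro i j c c' h
    have hi := hθ i
    have hj := hθ j
    field_simp
    linear_combination -h
  refine ⟨⟨linHom hW coef hdeg hW coef' hdeg (scale k Q θ) (hmem θ) (hcomm θ coef coef' h1 h2),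
    linHom hW coef' hdeg hW coef hdeg (scale k Q fun i => (θ i)⁻¹) (hmem _)
      (hcomm _ coef' coef (fun i hi => hθ' _ _ _ _ (h1 i hi)) fun i hi => hθ' _ _ _ _ (h2 i hi)),
    ?_, ?_⟩⟩
  · ext n : 1
    exact ModuleCat.hom_ext (LinearMap.ext fun u => Subtype.ext
      (scale_scale _ _ (fun i => inv_mul_cancel₀ (hθ i)) u.1))
  · ext n : 1
    exact ModuleCat.hom_ext (LinearMap.ext fun u => Subtype.ext
      (scale_scale _ _ (fun i => mul_inv_cancel₀ (hθ i)) u.1))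

end Rows

/-- The solution normalised by `θ 0 = 1`: products of `r` to the right of `0`, inverses of such
products to the left. -/
theorem exists_int_recurrence {k : Type*} [Field k] (r : ℤ → k) (hr : ∀ i, r i ≠ 0) :
    ∃ θ : ℤ → k, (∀ i, θ i ≠ 0) ∧ ∀ i, θ (i + 1) = r i * θ i := by
  let θ : ℤ → k := fun i => match i with
    | Int.ofNat n => ∏ j ∈ Finset.range n, r j
    | Int.negSucc n => (∏ j ∈ Finset.range (n + 1), r (-j - 1))⁻¹
  refine ⟨θ, fun i => ?_, fun i => ?_⟩
  · rcases i with n | n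
    · exact Finset.prod_ne_zero_iff.2 fun j _ => hr _
    · exact inv_ne_zero (Finset.prod_ne_zero_iff.2 fun j _ => hr _)
  · rcases i with n | n
    · change ∏ j ∈ Finset.range (n + 1), r j = _
      rw [Finset.prod_range_succ, mul_comm]
      rfl
    · rcases n with _ | n
      -- The step from `-1` to `0`, where the two formulas meet.
      · change (∏ j ∈ Finset.range 0, r j) = r (-1) * (∏ j ∈ Finset.range (0 + 1), r (-j - 1))⁻¹
        simp [hr]
      · change (∏ j ∈ Finset.range (n + 1), r (-j - 1))⁻¹ =
          r (Int.negSucc (n + 1)) * (∏ j ∈ Finset.range (n + 1 + 1), r (-j - 1))⁻¹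
        rw [Finset.prod_range_succ _ (n + 1), mul_inv,
          show (Int.negSucc (n + 1)) = -((n + 1 : ℕ) : ℤ) - 1 by omega]
        have := hr (-((n + 1 : ℕ) : ℤ) - 1)
        field_simp

/-- On a string the scalars on the letters may be changed to `1`. -/
theorem nonempty_iso_stringComplex {V : Type u} {A : Type v} [Fintype V] [Fintype A] {k : Type w}
    [Field k] {Q : GentleQuiver V A} {W : Walk V A ℤ} {hW : IsWalk Q W} {coef : ℤ → k}
    (hcoef : ∀ i, coef i ≠ 0) {deg : ℤ → ℤ} {hdeg : IsGrading W deg} :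
    Nonempty (walkComplex k hW coef hdeg ≅ walkComplex k hW (fun _ => 1) hdeg) := by
  obtain ⟨θ, hθ, h⟩ := exists_int_recurrence
    (fun i => if (W.letter i).direct then (coef i)⁻¹ else coef i) fun i => by
      split_ifs
      · exact inv_ne_zero (hcoef i)
      · exact hcoef i
  refine nonempty_iso_of_scalars θ hθ (fun i hi => ?_) fun i hi => ?_
  · simp [h i, hi, hcoef i]
  · simp [h i, hi]

/-! ### The walk of the mapping cone -/

section ConeWalk

variable {V : Type u} {A : Type v} {m : ℕ} {σ : Walk V A (ZMod m)}
  {τ : Walk V A ℤ} {s : ZMod m} {t : ℤ} {fL fR : List A}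

theorem coneWalk_vtx_le {i : ℤ} (h : i ≤ t) : (coneWalk σ τ s t fL fR).vtx i = τ.vtx i :=
  if_pos h

theorem coneWalk_vtx_mid {i : ℤ} (h : t < i) (h' : i ≤ t + m) :
    (coneWalk σ τ s t fL fR).vtx i = σ.vtx (s - ((i - t - 1 : ℤ) : ZMod m)) := by
  simp only [coneWalk]
  rw [if_neg (by omega), if_pos h']

theorem coneWalk_vtx_gt {i : ℤ} (h : t + m < i) :
    (coneWalk σ τ s t fL fR).vtx i = τ.vtx (i - m) := by
  simp only [coneWalk]
  rw [if_neg (by omega), if_neg (by omega)]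

theorem coneWalk_letter_lt {i : ℤ} (h : i < t) :
    (coneWalk σ τ s t fL fR).letter i = τ.letter i :=
  if_pos h

theorem coneWalk_letter_left : (coneWalk σ τ s t fL fR).letter t = ⟨fL, false⟩ := by
  simp [coneWalk]

theorem coneWalk_letter_mid {i : ℤ} (h : t < i) (h' : i < t + m) :
    (coneWalk σ τ s t fL fR).letter i = (σ.letter (s - ((i - t : ℤ) : ZMod m))).inv := by
  simp only [coneWalk]
  rw [if_neg (by omega), if_neg (by omega), if_pos h']

theorem coneWalk_letter_right (hm : 0 < m) {i : ℤ} (h : i = t + m) :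
    (coneWalk σ τ s t fL fR).letter i = ⟨fR, true⟩ := by
  simp only [coneWalk]
  rw [if_neg (by omega), if_neg (by omega), if_neg (by omega), if_pos h]

theorem coneWalk_letter_gt {i : ℤ} (h : t + m < i) :
    (coneWalk σ τ s t fL fR).letter i = τ.letter (i - m) := by
  simp only [coneWalk]
  rw [if_neg (by omega), if_neg (by omega), if_neg (by omega), if_neg (by omega)]

theorem mem_coneWalk_le {i : ℤ} (h : i ≤ t) :
    i ∈ (coneWalk σ τ s t fL fR).carrier ↔ i ∈ τ.carrier := by
  simp [coneWalk, h]

theorem mem_coneWalk_mid (hσ : σ.carrier = Set.univ) {i : ℤ} (h : t < i) (h' : i ≤ t + m) :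
    i ∈ (coneWalk σ τ s t fL fR).carrier := by
  simp [coneWalk, h', hσ, show ¬ i ≤ t by omega]

theorem mem_coneWalk_gt {i : ℤ} (h : t + m < i) :
    i ∈ (coneWalk σ τ s t fL fR).carrier ↔ i - m ∈ τ.carrier := by
  simp [coneWalk, show ¬ i ≤ t by omega, show ¬ i ≤ t + m by omega]

variable {degσ : ZMod m → ℤ} {degτ : ℤ → ℤ}

theorem coneDeg_le {i : ℤ} (h : i ≤ t) : coneDeg degσ degτ s t i = degτ i := if_pos h

theorem coneDeg_mid {i : ℤ} (h : t < i) (h' : i ≤ t + m) :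
    coneDeg degσ degτ s t i = degσ (s - ((i - t - 1 : ℤ) : ZMod m)) - 1 := by
  rw [coneDeg, if_neg (by omega), if_pos h']

theorem coneDeg_gt {i : ℤ} (h : t + m < i) :
    coneDeg degσ degτ s t i = degτ (i - m) := by
  rw [coneDeg, if_neg (by omega), if_neg (by omega)]

end ConeWalk

/-! ### The word `c` is a graded homotopy string -/

section ConeString

variable {V : Type u} {A : Type v} [Fintype V] [Fintype A]
  {Q : GentleQuiver V A} {m : ℕ} {σ : Walk V A (ZMod m)}
  {τ : Walk V A ℤ} {s : ZMod m} {t : ℤ} {fL fR : List A} {degσ : ZMod m → ℤ} {degτ : ℤ → ℤ}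

/-- A single letter cannot be balanced. Consequently `s + 1 ≠ s`, and at least one letter of σ
remains between the two letters coming from `f`. -/
theorem IsHomotopyBand.two_le [NeZero m] (hσ : IsHomotopyBand Q σ) : 2 ≤ m := by
  by_contra h
  obtain rfl : m = 1 := by have := NeZero.ne m; omega
  have hb := hσ.balanced
  cases h : (σ.letter 0).direct
  · rw [show {i | (σ.letter i).direct = true} = ∅ from
      Set.eq_empty_iff_forall_notMem.2 fun i => by simp [Subsingleton.elim i 0, h],
      show {i | (σ.letter i).direct = false} = Set.univ from
      Set.eq_univ_iff_forall.2 fun i => by simp [Subsingleton.elim i 0, h]] at hb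
    simp [Set.ncard_univ] at hb
  · rw [show {i | (σ.letter i).direct = false} = ∅ from
      Set.eq_empty_iff_forall_notMem.2 fun i => by simp [Subsingleton.elim i 0, h],
      show {i | (σ.letter i).direct = true} = Set.univ from
      Set.eq_univ_iff_forall.2 fun i => by simp [Subsingleton.elim i 0, h]] at hb
    simp [Set.ncard_univ] at hb

theorem IsHomotopyBand.joins' (hσ : IsHomotopyBand Q σ) (i : ZMod m) :
    (σ.letter i).Joins Q (σ.vtx i) (σ.vtx (i + 1)) :=
  hσ.joins i (by simp [hσ.carrier_eq]) (by simp [hσ.carrier_eq])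

theorem IsHomotopyBand.junction' (hσ : IsHomotopyBand Q σ) (i : ZMod m) :
    Junction Q (σ.letter i) (σ.letter (i + 1)) :=
  hσ.junction i (by simp [hσ.carrier_eq]) (by simp [hσ.carrier_eq]) (by simp [hσ.carrier_eq])

namespace IsDoubleData

variable (hd : IsDoubleData Q σ degσ τ degτ s t fL fR)
include hd

/-- Both are initial factors of the path f_L τ_C = σ_C f_R. -/
theorem head_eq (hσ : IsHomotopyBand Q σ) : fL.head? = (σ.letter s).path.head? := by
  have h := congrArg List.head? hd.comm
  rwa [List.head?_append_of_ne_nil _ hd.path_L.ne_nil, List.head?_append_of_ne_nil _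
    ((hσ.joins' s).isPath_of_direct hd.direct_s).ne_nil] at h

theorem isPath_t (hτ : IsWalk Q τ) : IsPath Q (τ.letter t).path (τ.vtx t) (τ.vtx (t + 1)) :=
  (hτ.joins t hd.t_mem hd.t_succ_mem).isPath_of_direct hd.direct_t

theorem isPath_s (hσ : IsHomotopyBand Q σ) :
    IsPath Q (σ.letter s).path (σ.vtx s) (σ.vtx (s + 1)) :=
  (hσ.joins' s).isPath_of_direct hd.direct_s

theorem isPath_comm (hτ : IsWalk Q τ) :
    IsPath Q (fL ++ (τ.letter t).path) (σ.vtx s) (τ.vtx (t + 1)) :=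
  isPath_append_of_not_hasZero hd.path_L (hd.isPath_t hτ) hd.nonzero

theorem last_eq (hτ : IsWalk Q τ) : fR.getLast? = (τ.letter t).path.getLast? := by
  have h := congrArg List.getLast? hd.comm
  rw [List.getLast?_append_of_ne_nil _ (hd.isPath_t hτ).ne_nil,
    List.getLast?_append_of_ne_nil _ hd.path_R.ne_nil] at h
  exact h.symm

/-- For τ_L inverse this is (L2). For τ_L direct, a common last arrow of τ_L and f_L would put the
relation between τ_L and τ_C inside the path f_L τ_C. `junction_σ_fR` is the corresponding argument
at the other end, with (R1) and the path σ_C f_R. -/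
theorem junction_τ_fL (hτ : IsWalk Q τ) (h : t - 1 ∈ τ.carrier) :
    Junction Q (τ.letter (t - 1)) ⟨fL, false⟩ := by
  have hj := hτ.joins (t - 1) h (by simpa using hd.t_mem)
  have hu := hτ.junction (t - 1) h (by simpa using hd.t_mem) (by simpa using hd.t_succ_mem)
  rw [sub_add_cancel] at hu hj
  cases hl : (τ.letter (t - 1)).direct
  · simpa only [Junction, hl] using
      hasZero_append hd.path_L (hj.isPath_of_inverse hl) (hd.L2 h hl)
  · simp only [Junction, hl, hd.direct_t] at hu ⊢
    obtain ⟨a, ha, b, hb, hr⟩ := hu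
    intro he
    exact ((hd.isPath_comm hτ).good_of_append (he ▸ ha) hb).2 hr

/-- For σ_L direct this is (L1). For σ_L inverse, f_L starts with the same arrow as σ_C and inherits
its junction with σ_L. `junction_fR_τ` argues likewise with (R2) and the last arrows of f_R and τ_C.
-/
theorem junction_fL_σ (hσ : IsHomotopyBand Q σ) :
    Junction Q ⟨fL, false⟩ (σ.letter (s - 1)).inv := by
  have hj := hσ.joins' (s - 1)
  have hu := hσ.junction' (s - 1)
  rw [sub_add_cancel] at hu hj
  cases hl : (σ.letter (s - 1)).direct
  · simp only [Junction, hl, hd.direct_s, Letter.inv_direct, Letter.inv_path, Bool.not_false]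
      at hu ⊢
    rw [hd.head_eq hσ]
    exact hu.symm
  · simpa only [Junction, hl, Letter.inv_direct, Letter.inv_path, Bool.not_true] using
      hasZero_append (hj.isPath_of_direct hl) hd.path_L (hd.L1 (by simp [hσ.carrier_eq]) hl)

theorem junction_σ_fR (hσ : IsHomotopyBand Q σ) (hτ : IsWalk Q τ) :
    Junction Q (σ.letter (s + 1)).inv ⟨fR, true⟩ := by
  have hj := hσ.joins' (s + 1)
  have hu := hσ.junction' s
  cases hl : (σ.letter (s + 1)).direct
  · simpa only [Junction, hl, Letter.inv_direct, Letter.inv_path, Bool.not_false] using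
      hasZero_append (hj.isPath_of_inverse hl) hd.path_R (hd.R1 (by simp [hσ.carrier_eq]) hl)
  · simp only [Junction, hl, hd.direct_s, Letter.inv_direct, Letter.inv_path, Bool.not_true]
      at hu ⊢
    obtain ⟨a, ha, b, hb, hr⟩ := hu
    intro he
    exact ((hd.comm ▸ hd.isPath_comm hτ).good_of_append ha (he ▸ hb)).2 hr

theorem junction_fR_τ (hτ : IsWalk Q τ) (h : t + 1 + 1 ∈ τ.carrier) :
    Junction Q ⟨fR, true⟩ (τ.letter (t + 1)) := by
  have hj := hτ.joins (t + 1) hd.t_succ_mem h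
  have hu := hτ.junction t hd.t_mem hd.t_succ_mem h
  cases hl : (τ.letter (t + 1)).direct
  · simp only [Junction, hl, hd.direct_t] at hu ⊢
    rw [hd.last_eq hτ]
    exact hu
  · simpa only [Junction, hl] using
      hasZero_append hd.path_R (hj.isPath_of_direct hl) (hd.R2 h hl)

/-- Only the four junctions next to f_L and f_R are new. All others come from τ, or from σ read
backwards. -/
theorem isWalk_coneWalk [NeZero m] (hσ : IsHomotopyBand Q σ) (hτ : IsWalk Q τ) :
    IsWalk Q (coneWalk σ τ s t fL fR) := by
  have hm := hσ.two_le
  have e1 : ∀ i : ℤ, s - ((i - t : ℤ) : ZMod m) + 1 = s - ((i - t - 1 : ℤ) : ZMod m) := fun i => by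
    push_cast; ring
  constructor
  · intro i hi hi'
    rcases lt_trichotomy i t with h | rfl | h
    · rw [coneWalk_letter_lt h, coneWalk_vtx_le h.le, coneWalk_vtx_le (by omega)]
      exact hτ.joins i ((mem_coneWalk_le h.le).1 hi) ((mem_coneWalk_le (by omega)).1 hi')
    · rw [coneWalk_letter_left, coneWalk_vtx_le le_rfl, coneWalk_vtx_mid (by omega) (by omega)]
      simpa [Letter.Joins] using hd.path_L
    rcases lt_trichotomy i (t + m) with h' | h' | h'
    · rw [coneWalk_letter_mid h h', coneWalk_vtx_mid h h'.le,
        coneWalk_vtx_mid (by omega) (by omega), ← e1 i, show i + 1 - t - 1 = i - t by ring]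
      exact (hσ.joins' _).inv
    · rw [coneWalk_letter_right (by omega) h', coneWalk_vtx_mid h h'.le,
        coneWalk_vtx_gt (by omega), ← e1]
      subst h'
      rw [show t + m + 1 - m = t + 1 by ring]
      simpa [Letter.Joins] using hd.path_R
    · rw [coneWalk_letter_gt h', coneWalk_vtx_gt h', coneWalk_vtx_gt (by omega),
        show i + 1 - m = i - m + 1 by ring]
      refine hτ.joins _ ((mem_coneWalk_gt h').1 hi) ?_
      rw [show i - m + 1 = i + 1 - m by ring]
      exact (mem_coneWalk_gt (by omega)).1 hi'
  · intro i hi hi' hi''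
    rcases lt_trichotomy (i + 1) t with h | h | h
    · rw [coneWalk_letter_lt (by omega), coneWalk_letter_lt h]
      exact hτ.junction i ((mem_coneWalk_le (by omega)).1 hi) ((mem_coneWalk_le h.le).1 hi')
        ((mem_coneWalk_le (by omega)).1 hi'')
    · obtain rfl : i = t - 1 := by omega
      rw [coneWalk_letter_lt (by omega), h, coneWalk_letter_left]
      exact hd.junction_τ_fL hτ ((mem_coneWalk_le (by omega)).1 hi)
    rcases (show t ≤ i by omega).eq_or_lt with rfl | h
    · rw [coneWalk_letter_left, coneWalk_letter_mid h (by omega)]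
      simpa using hd.junction_fL_σ hσ
    rcases lt_trichotomy (i + 1) (t + m) with h' | h' | h'
    · rw [coneWalk_letter_mid h (by omega), coneWalk_letter_mid (by omega) h',
        show s - ((i - t : ℤ) : ZMod m) = s - ((i + 1 - t : ℤ) : ZMod m) + 1 by push_cast; ring]
      exact (hσ.junction' _).inv
    · rw [coneWalk_letter_mid h (by omega), coneWalk_letter_right (by omega) h']
      obtain rfl : i = t + m - 1 := by omega
      -- Modulo `m`, the letter at `s - (m - 1)` is the one at `s + 1`, that is σ_R.
      have := hd.junction_σ_fR hσ hτ
      simpa [sub_sub] using this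
    rcases (show t + m ≤ i by omega).eq_or_lt with h2 | h2
    · subst h2
      rw [coneWalk_letter_right (by omega) rfl, coneWalk_letter_gt h',
        show t + m + 1 - m = t + 1 by ring]
      refine hd.junction_fR_τ hτ ?_
      rw [show t + 1 + 1 = t + m + 1 + 1 - m by ring]
      exact (mem_coneWalk_gt (by omega)).1 hi''
    · rw [coneWalk_letter_gt h2, coneWalk_letter_gt h', show i + 1 - m = i - m + 1 by ring]
      refine hτ.junction _ ((mem_coneWalk_gt h2).1 hi) ?_ ?_
      · rw [show i - m + 1 = i + 1 - m by ring]
        exact (mem_coneWalk_gt (by omega)).1 hi'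
      · rw [show i - m + 1 + 1 = i + 1 + 1 - m by ring]
        exact (mem_coneWalk_gt (by omega)).1 hi''

theorem isHomotopyString_coneWalk [NeZero m] (hσ : IsHomotopyBand Q σ)
    (hτ : IsHomotopyString Q τ) : IsHomotopyString Q (coneWalk σ τ s t fL fR) where
  toIsWalk := hd.isWalk_coneWalk hσ hτ.toIsWalk
  nonempty := ⟨t, (mem_coneWalk_le le_rfl).2 hd.t_mem⟩
  ordConnected := by
    have hoc := hτ.ordConnected
    refine ⟨fun x hx y hy z hz => ?_⟩
    rcases le_or_gt z t with h | h
    · rw [mem_coneWalk_le h]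
      exact hoc.out ((mem_coneWalk_le (hz.1.trans h)).1 hx) hd.t_mem ⟨hz.1, h⟩
    rcases le_or_gt z (t + m) with h' | h'
    · exact mem_coneWalk_mid hσ.carrier_eq h h'
    · rw [mem_coneWalk_gt h']
      exact hoc.out hd.t_mem ((mem_coneWalk_gt (h'.trans_le hz.2)).1 hy)
        ⟨by omega, by have := hz.2; omega⟩
  left_end h := by
    obtain ⟨n, hn⟩ := hτ.left_end fun ⟨b, hb⟩ => h ⟨min b t, fun i hi => by
      rcases le_or_gt i t with h' | h'
      · exact (min_le_left _ _).trans (hb ((mem_coneWalk_le h').1 hi))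
      · exact (min_le_right _ _).trans h'.le⟩
    refine ⟨min n (t - 1), fun i hi => ?_⟩
    rw [coneWalk_letter_lt (by omega)]
    exact hn i (by omega)
  right_end h := by
    obtain ⟨n, hn⟩ := hτ.right_end fun ⟨b, hb⟩ => h ⟨max (b + m) (t + m), fun i hi => by
      rcases le_or_gt i (t + m) with h' | h'
      · exact h'.trans (le_max_right _ _)
      · have := hb ((mem_coneWalk_gt h').1 hi)
        exact le_max_of_le_left (by omega)⟩
    refine ⟨max (n + m) (t + m + 1), fun i hi => ?_⟩
    rw [coneWalk_letter_gt (by omega)]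
    exact hn (i - m) (by omega)

/-- Moving σ down by one puts its positions `s` and `s + 1` one degree below the positions `t` and
`t + 1` of τ, as required by the new letters f_L and f_R. -/
theorem isGrading_coneWalk [NeZero m] (hσ : IsHomotopyBand Q σ) (hdσ : IsGrading σ degσ)
    (hdτ : IsGrading τ degτ) :
    IsGrading (coneWalk σ τ s t fL fR) (coneDeg degσ degτ s t) := by
  have hm := hσ.two_le
  have hs := hdσ s hd.s_mem hd.s_succ_mem
  have ht := hdτ t hd.t_mem hd.t_succ_mem
  rw [if_pos hd.direct_s] at hs
  rw [if_pos hd.direct_t] at ht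
  have hde := hd.deg_eq
  intro i hi hi'
  rcases lt_trichotomy i t with h | rfl | h
  · rw [coneWalk_letter_lt h, coneDeg_le h.le, coneDeg_le (by omega)]
    exact hdτ i ((mem_coneWalk_le h.le).1 hi) ((mem_coneWalk_le (by omega)).1 hi')
  · rw [coneWalk_letter_left, coneDeg_le le_rfl, coneDeg_mid (by omega) (by omega)]
    simp [hde]
  rcases lt_trichotomy i (t + m) with h' | h' | h'
  · rw [coneWalk_letter_mid h h', coneDeg_mid h h'.le, coneDeg_mid (by omega) (by omega),
      show i + 1 - t - 1 = i - t by ring]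
    have := hdσ (s - ((i - t : ℤ) : ZMod m)) (by simp [hσ.carrier_eq]) (by simp [hσ.carrier_eq])
    rw [show s - ((i - t : ℤ) : ZMod m) + 1 = s - ((i - t - 1 : ℤ) : ZMod m) by
      push_cast; ring] at this
    cases hl : (σ.letter (s - ((i - t : ℤ) : ZMod m))).direct <;>
      simp only [hl, Letter.inv_direct, Bool.not_false, Bool.not_true, if_true,
        Bool.false_eq_true, if_false] at this ⊢ <;> omega
  · rw [coneWalk_letter_right (by omega) h', coneDeg_mid h h'.le, coneDeg_gt (by omega)]
    subst h'
    rw [show t + m + 1 - m = t + 1 by ring,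
      show s - ((t + m - t - 1 : ℤ) : ZMod m) = s + 1 by simp]
    simp only [if_true]
    omega
  · rw [coneWalk_letter_gt h', coneDeg_gt h', coneDeg_gt (by omega), show i + 1 - m = i - m + 1 by ring]
    refine hdτ _ ((mem_coneWalk_gt h').1 hi) ?_
    rw [show i - m + 1 = i + 1 - m by ring]
    exact (mem_coneWalk_gt (by omega)).1 hi'

end IsDoubleData

end ConeString

/-! ### The two walks beside σ_C and τ_C, and the null-homotopy -/

section Sides

variable {V : Type u} {A : Type v} [Fintype V] [Fintype A] {k : Type w} [Field k]
  {Q : GentleQuiver V A} {m : ℕ} {σ : Walk V A (ZMod m)}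
  {τ : Walk V A ℤ} {s : ZMod m} {t : ℤ} {fL fR : List A} {degσ : ZMod m → ℤ} {degτ : ℤ → ℤ}

theorem neg_one_smul_alg (r : Alg k Q) : (-1 : k) • r = -r := by
  rw [Algebra.smul_def, map_neg, map_one, neg_one_mul]

theorem idem_mul_word {p : List A} {x y : V} (h : IsPath Q p x y) :
    idem k Q x * word k Q p = word k Q p := by
  obtain ⟨a, p, rfl⟩ := List.exists_cons_of_ne_nil h.ne_nil
  have ha : Q.tgt a = x := h.tgt_head a (by simp)
  have h1 : idem k Q x * arr k Q a = arr k Q a := by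
    subst ha
    unfold arr idem
    rw [← map_mul]
    exact Alg.mk_rel k Q (AlgRel.tgt a)
  rw [show a :: p = [a] ++ p from rfl, word_append, ← mul_assoc]
  simp [word, h1]

theorem diff_apply {ι : Type} [Ring ι] {W : Walk V A ι} {coef : ι → k} (u : ι →₀ Alg k Q) (j : ι) :
    diff k Q W coef u j =
      u (j - 1) * dirEntry k Q W coef (j - 1) + u (j + 1) * invEntry k Q W coef j := by
  classical
  have : (Finsupp.lapply j : (ι →₀ Alg k Q) →ₗ[Alg k Q] Alg k Q) ∘ₗ diff k Q W coef =
      LinearMap.toSpanSingleton (Alg k Q) (Alg k Q) (dirEntry k Q W coef (j - 1)) ∘ₗ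
        Finsupp.lapply (j - 1) +
      LinearMap.toSpanSingleton (Alg k Q) (Alg k Q) (invEntry k Q W coef j) ∘ₗ
        Finsupp.lapply (j + 1) := by
    refine linearMap_ext_rows fun i => ?_
    simp only [LinearMap.comp_apply, diff_single, one_mul, LinearMap.add_apply, map_add,
      Finsupp.lapply_apply, LinearMap.toSpanSingleton_apply, Finsupp.single_apply, smul_eq_mul,
      ite_mul, zero_mul, sub_eq_iff_eq_add, eq_sub_iff_add_eq]
    congr 1
    · split_ifs with h
      · rw [← h, add_sub_cancel_right]
      · rfl
    · split_ifs with h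
      · rw [h, add_sub_cancel_right]
      · rfl
  exact LinearMap.congr_fun this u

theorem Represents.comm {ι ι' : Type} [Ring ι] [Ring ι'] {W : Walk V A ι} {hW : IsWalk Q W}
    {coef : ι → k} {deg : ι → ℤ} {hdeg : IsGrading W deg}
    {W' : Walk V A ι'} {hW' : IsWalk Q W'} {coef' : ι' → k} {deg' : ι' → ℤ}
    {hdeg' : IsGrading W' deg'} {f : walkComplex k hW coef hdeg ⟶ walkComplex k hW' coef' hdeg'}
    {F : (ι →₀ Alg k Q) →ₗ[Alg k Q] (ι' →₀ Alg k Q)} (hf : Represents f F) {n : ℤ}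
    {u : ι →₀ Alg k Q} (hu : u ∈ term k Q W deg n) :
    diff k Q W' coef' (F u) = F (diff k Q W coef u) := by
  have h := f.comm n (n + 1)
  rw [walkComplex_d rfl, walkComplex_d rfl] at h
  have h' := congrArg Subtype.val
    (LinearMap.congr_fun (congrArg ModuleCat.Hom.hom h) (⟨u, hu⟩ : term k Q W deg n))
  rw [← hf n ⟨u, hu⟩]
  exact h'.trans (hf (n + 1) ⟨_, diff_mem W coef hW hdeg rfl u hu⟩)

variable (k Q) in
/-- The linear map with the two components `a fL` and `b fR`. -/
noncomputable def doubleMap (s : ZMod m) (t : ℤ) (a b : k) (fL fR : List A) :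
    (ZMod m →₀ Alg k Q) →ₗ[Alg k Q] (ℤ →₀ Alg k Q) :=
  Finsupp.lsingle t ∘ₗ LinearMap.toSpanSingleton (Alg k Q) (Alg k Q) (a • word k Q fL) ∘ₗ
    Finsupp.lapply s +
  Finsupp.lsingle (t + 1) ∘ₗ LinearMap.toSpanSingleton (Alg k Q) (Alg k Q) (b • word k Q fR) ∘ₗ
    Finsupp.lapply (s + 1)

theorem doubleMap_apply (a b : k) (u : ZMod m →₀ Alg k Q) :
    doubleMap k Q s t a b fL fR u = Finsupp.single t (u s * (a • word k Q fL)) +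
      Finsupp.single (t + 1) (u (s + 1) * (b • word k Q fR)) := rfl

variable (σ τ s t) in
open Classical in
/-- The letters of `τ` on the left of the position `t`, from right to left. -/
noncomputable def leftLetters (i : ℕ) : Option (Letter A) :=
  if t - 1 - i ∈ τ.carrier then some (τ.letter (t - 1 - i)) else none

variable (σ s) in
/-- The inverses of the letters of `σ` on the right of the position `s + 1`. -/
def rightLetters (i : ℕ) : Option (Letter A) := some (σ.letter (s + 1 + i)).inv

theorem mem_leftLetters {V : Type u} {A : Type v} {τ : Walk V A ℤ} {t : ℤ} {i : ℕ} {l : Letter A} (h : l ∈ leftLetters τ t i) :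
    t - 1 - i ∈ τ.carrier ∧ τ.letter (t - 1 - i) = l := by
  unfold leftLetters at h
  split_ifs at h with hc
  · exact ⟨hc, by simpa using h⟩
  · simp at h

theorem IsHomotopyString.mem_of_le (hτ : IsHomotopyString Q τ) {i j l : ℤ} (hi : i ∈ τ.carrier)
    (hl : l ∈ τ.carrier) (hij : i ≤ j) (hjl : j ≤ l) : j ∈ τ.carrier :=
  hτ.ordConnected.out hi hl ⟨hij, hjl⟩

theorem isLeftWalk_leftLetters (hτ : IsHomotopyString Q τ) (ht : t ∈ τ.carrier) :
    IsLeftWalk Q (fun i : ℕ => τ.vtx (t - i)) (leftLetters τ t) where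
  joins i l hl := by
    obtain ⟨h1, rfl⟩ := mem_leftLetters hl
    have := hτ.joins _ h1 (hτ.mem_of_le h1 ht (by omega) (by omega))
    rw [show t - 1 - i + 1 = t - (i : ℤ) by ring] at this
    rw [show t - ((i + 1 : ℕ) : ℤ) = t - 1 - i by push_cast; ring]
    exact this
  junction i l hl r hr := by
    obtain ⟨h1, rfl⟩ := mem_leftLetters hl
    obtain ⟨h2, rfl⟩ := mem_leftLetters hr
    have e : t - 1 - ((i + 1 : ℕ) : ℤ) + 1 = t - 1 - i := by push_cast; ring
    have := hτ.junction _ h1 (by rwa [e])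
      (hτ.mem_of_le h1 ht (by omega) (by omega))
    rwa [e] at this

theorem isLeftWalk_rightLetters (hσ : IsHomotopyBand Q σ) :
    IsLeftWalk Q (fun i : ℕ => σ.vtx (s + 1 + i)) (rightLetters σ s) where
  joins i l hl := by
    obtain rfl : _ = l := Option.some_inj.1 hl
    have := (hσ.joins' (s + 1 + i)).inv
    simpa [add_assoc] using this
  junction i l hl r hr := by
    obtain rfl : _ = l := Option.some_inj.1 hl
    obtain rfl : _ = r := Option.some_inj.1 hr
    have := (hσ.junction' (s + 1 + i)).inv
    simpa [add_assoc] using this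

theorem dirEntry_left (hτ : IsHomotopyString Q τ) (ht : t ∈ τ.carrier) (i : ℕ) :
    dirEntry k Q τ (fun _ => 1) (t - 1 - i) = fwd k Q (leftLetters τ t i) := by
  unfold leftLetters
  split_ifs with h
  · rw [dirEntry_of_mem h (hτ.mem_of_le h ht (by omega) (by omega)), one_smul]
  · rw [dirEntry, if_neg (by tauto), fwd_none]

theorem invEntry_left (hτ : IsHomotopyString Q τ) (ht : t ∈ τ.carrier) (i : ℕ) :
    invEntry k Q τ (fun _ => 1) (t - 1 - i) = bwd k Q (leftLetters τ t i) := by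
  unfold leftLetters
  split_ifs with h
  · rw [invEntry_of_mem h (hτ.mem_of_le h ht (by omega) (by omega)), one_smul]
  · rw [invEntry, if_neg (by tauto), bwd_none]

theorem dirEntry_band (hσ : IsHomotopyBand Q σ) (c : ZMod m → k) (i : ZMod m) :
    dirEntry k Q σ c i = c i • fwd k Q (some (σ.letter i)) :=
  dirEntry_of_mem (by simp [hσ.carrier_eq]) (by simp [hσ.carrier_eq])

theorem invEntry_band (hσ : IsHomotopyBand Q σ) (c : ZMod m → k) (i : ZMod m) :
    invEntry k Q σ c i = c i • bwd k Q (some (σ.letter i)) :=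
  invEntry_of_mem (by simp [hσ.carrier_eq]) (by simp [hσ.carrier_eq])

namespace IsDoubleData

variable (hd : IsDoubleData Q σ degσ τ degτ s t fL fR)
include hd

/-- At the start the degrees differ by one, since σ_C is direct and `s`, `t` have equal degree;
letters of equal direction preserve the difference. Hence a ladder from σ to τ has the degree `-1`
of a homotopy, and one from τ to σ has degree `0` in the cone. -/
theorem deg_of_agree (hσ : IsHomotopyBand Q σ)
    (hdσ : IsGrading σ degσ) (hdτ : IsGrading τ degτ) (i : ℕ)
    (h : ∀ j < i, ∃ l ∈ leftLetters τ t j, ∃ l' ∈ rightLetters σ s j, l.direct = l'.direct) :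
    t - i ∈ τ.carrier ∧ degσ (s + 1 + i) = degτ (t - i) + 1 := by
  induction i with
  | zero =>
    have := hdσ s hd.s_mem hd.s_succ_mem
    rw [if_pos hd.direct_s] at this
    simp [this, hd.deg_eq, hd.t_mem]
  | succ i ih =>
    obtain ⟨h1, h2⟩ := ih fun j hj => h j (by omega)
    obtain ⟨l, hl, l', hl', e⟩ := h i (by omega)
    obtain ⟨h3, rfl⟩ := mem_leftLetters hl
    obtain rfl : _ = l' := Option.some_inj.1 hl'
    rw [show t - ((i + 1 : ℕ) : ℤ) = t - 1 - i by push_cast; ring]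
    refine ⟨h3, ?_⟩
    have g1 := hdσ (s + 1 + i) (by simp [hσ.carrier_eq]) (by simp [hσ.carrier_eq])
    have g2 := hdτ _ h3 (by rwa [show t - 1 - i + 1 = t - (i : ℤ) by ring])
    rw [show t - 1 - i + 1 = t - (i : ℤ) by ring] at g2
    rw [show s + 1 + ((i + 1 : ℕ) : ZMod m) = s + 1 + i + 1 by push_cast; ring]
    rw [Letter.inv_direct] at e
    cases hx : (τ.letter (t - 1 - i)).direct <;> cases hy : (σ.letter (s + 1 + i)).direct <;>
      simp only [hx, hy, if_true, Bool.false_eq_true, if_false, Bool.not_true, Bool.not_false,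
        Bool.true_eq_false] at e g1 g2 <;> omega

/-- Commutation of `f` with the differentials, tested on the idempotent at `s` and read off at `t +
1`, compares two multiples of the nonzero path f_L τ_C = σ_C f_R. -/
theorem scalar_eq [NeZero m] (hσ : IsHomotopyBand Q σ) (hdσ : IsGrading σ degσ)
    (hτ : IsHomotopyString Q τ) (hdτ : IsGrading τ degτ) (c : ZMod m → k)
    {f : walkComplex k hσ.toIsWalk c hdσ ⟶ walkComplex k hτ.toIsWalk (fun _ => 1) hdτ} {a b : k}
    (hf : Represents f (doubleMap k Q s t a b fL fR)) : a = c s * b := by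
  have hm : Fact (1 < m) := ⟨hσ.two_le⟩
  have hu : Finsupp.single s (idem k Q (σ.vtx s)) ∈ term k Q σ degσ (degσ s) :=
    single_mem_term (idem_mem_proj _) fun _ => ⟨hd.s_mem, rfl⟩
  have h := DFunLike.congr_fun (hf.comm hu) (t + 1)
  have hs : s + 1 ≠ s := by simp
  have h1 : (s + 1 - 1 : ZMod m) = s := by ring
  -- For `m = 2` the position `s + 2` is `s` again, so σ_R could contribute a second term; (R1)
  -- kills it.
  have hR : invEntry k Q σ c (s + 1) * word k Q fR = 0 := by
    rw [invEntry_band hσ]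
    cases hl : (σ.letter (s + 1)).direct
    · rw [bwd_inverse hl, smul_mul_assoc, ← word_append,
        word_eq_zero_of_hasZero (hd.R1 (by simp [hσ.carrier_eq]) hl), smul_zero]
    · simp [bwd_direct hl]
  simp only [doubleMap_apply, diff_apply, Finsupp.add_apply, Finsupp.single_eq_same,
    Finsupp.single_eq_of_ne hs, zero_mul, h1, add_mul, mul_smul_comm,
    mul_assoc, hR] at h
  simp [dirEntry_of_mem hd.t_mem hd.t_succ_mem, dirEntry_band hσ, fwd_direct hd.direct_t,
    fwd_direct hd.direct_s, Finsupp.single_apply] at h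
  rw [if_neg (by omega), add_zero, mul_assoc, ← word_append, ← word_append, ← hd.comm, idem_mul_word (hd.isPath_comm hτ.toIsWalk),
    smul_smul, mul_comm b] at h
  by_contra hne
  have hw : algebraMap k (Alg k Q) (a - c s * b) * word k Q (fL ++ (τ.letter t).path) = 0 := by
    rw [map_sub, sub_mul, ← Algebra.smul_def, ← Algebra.smul_def, h, sub_self]
  apply word_ne_zero (k := k) (hd.isPath_comm hτ.toIsWalk)
  rw [← one_mul (word k Q _), ← map_one (algebraMap k (Alg k Q)),
    ← inv_mul_cancel₀ (sub_ne_zero.2 hne), map_mul, mul_assoc, hw, mul_zero]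

/-- The rungs, suitably scaled, form a homotopy. The squares of the ladder cancel, and only the two
products of the rung `0` with σ_C and τ_C survive; these are the components of `f`. -/
theorem map_eq_zero [NeZero m] (hσ : IsHomotopyBand Q σ) (hdσ : IsGrading σ degσ)
    (hτ : IsHomotopyString Q τ) (hdτ : IsGrading τ degτ) {c : ZMod m → k} (hc : ∀ i, c i ≠ 0)
    {f : walkComplex k hσ.toIsWalk c hdσ ⟶ walkComplex k hτ.toIsWalk (fun _ => 1) hdτ} {a b : k}
    (hf : Represents f (doubleMap k Q s t a b fL fR)) {G : ℕ → Alg k Q}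
    (hG : IsLadder (fun i : ℕ => σ.vtx (s + 1 + i)) (rightLetters σ s)
      (fun i : ℕ => τ.vtx (t - i)) (leftLetters τ t) G) {N : ℕ} (hN : ∀ i ≥ N, G i = 0)
    (hL : word k Q (σ.letter s).path * G 0 = word k Q fL)
    (hR : G 0 * word k Q (τ.letter t).path = word k Q fR) :
    (HomotopyCategory.quotient (ModuleCat.{max u v w} (Alg k Q)) (ComplexShape.up ℤ)).map f = 0 := by
  -- The scalar `-1` on the letters of τ makes the squares anticommute; the initial value `b` fits
  -- the rung `0` to f_R, and by `scalar_eq` also to f_L.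
  obtain ⟨ν, hν0, hν1, hν2⟩ := hG.exists_scalars (fun i => c (s + 1 + i)) (fun _ => -1)
    (fun i => hc _) (fun _ => by simp) b
  let e : ℕ → Alg k Q := fun i => ν i • G i
  have he : ∀ i ≥ N, e i = 0 := fun i hi => by simp [e, hN i hi]
  have e1 : ∀ i : ℕ, invEntry k Q σ c (s + 1 + i) * e i +
      e (i + 1) * dirEntry k Q τ (fun _ => 1) (t - 1 - i) = 0 := by
    intro i
    have := hν1 i
    rw [rightLetters, fwd_inv] at this
    rw [invEntry_band hσ, dirEntry_left hτ hd.t_mem, this, neg_one_smul_alg, mul_neg,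
      neg_add_cancel]
  have e2 : ∀ i : ℕ, dirEntry k Q σ c (s + 1 + i) * e (i + 1) +
      e i * invEntry k Q τ (fun _ => 1) (t - 1 - i) = 0 := by
    intro i
    have := hν2 i
    rw [rightLetters, bwd_inv] at this
    rw [dirEntry_band hσ, invEntry_left hτ hd.t_mem, this, neg_one_smul_alg, mul_neg,
      neg_add_cancel]
  -- The sum runs over rungs, not over positions of σ: a long ladder meets the same position of the
  -- band several times.
  let Φ : (ZMod m →₀ Alg k Q) →ₗ[Alg k Q] (ℤ →₀ Alg k Q) :=
    ∑ i ∈ Finset.range N, Finsupp.lsingle (t - i) ∘ₗ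
      LinearMap.toSpanSingleton (Alg k Q) (Alg k Q) (e i) ∘ₗ Finsupp.lapply (s + 1 + i)
  have hΦ : ∀ u, Φ u = ∑ i ∈ Finset.range N, Finsupp.single (t - i : ℤ) (u (s + 1 + i) * e i) :=
    fun u => by simp [Φ, LinearMap.sum_apply]
  refine map_eq_zero_of_homotopy hf Φ (fun n n' hn u hu => ?_) fun u => ?_
  · rw [hΦ]
    refine Submodule.sum_mem _ fun i _ => single_mem_term ?_ fun hne => ?_
    · by_cases h0 : G i = 0
      · simp [e, h0]
      · simp only [e, mul_smul_comm]
        exact smul_mem_proj _ (hG.mem i h0 _ (hu _).1)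
    · have hu0 : u (s + 1 + i) ≠ 0 := fun h => hne (by simp [h])
      have hG0 : G i ≠ 0 := fun h => hne (by simp [e, h])
      obtain ⟨h1, h2⟩ := hd.deg_of_agree hσ hdσ hdτ i fun j hj => by
        obtain ⟨-, l, hl, l', hl', h⟩ := hG.agree j (hG.ne_zero_of_le hj hG0)
        exact ⟨l', hl', l, hl, h.symm⟩
      have := ((hu _).2 hu0).2
      exact ⟨h1, by omega⟩
  · have hD : Φ (diff k Q σ c u) = ∑ i ∈ Finset.range N,
        (Finsupp.single (t - i : ℤ) (u (s + i) * (dirEntry k Q σ c (s + i) * e i)) +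
          Finsupp.single (t - i : ℤ) (u (s + 1 + i + 1) *
            (invEntry k Q σ c (s + 1 + i) * e i))) := by
      rw [hΦ]
      refine Finset.sum_congr rfl fun i _ => ?_
      rw [diff_apply, add_mul, Finsupp.single_add, mul_assoc, mul_assoc,
        show s + 1 + (i : ZMod m) - 1 = s + i by ring]
    have hD' : diff k Q τ (fun _ => (1 : k)) (Φ u) = ∑ i ∈ Finset.range N,
        (Finsupp.single (t - i + 1 : ℤ)
            (u (s + 1 + i) * (e i * dirEntry k Q τ (fun _ => 1) (t - i))) +
          Finsupp.single (t - i - 1 : ℤ)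
            (u (s + 1 + i) * (e i * invEntry k Q τ (fun _ => 1) (t - i - 1)))) := by
      rw [hΦ, map_sum]
      refine Finset.sum_congr rfl fun i _ => ?_
      rw [diff_single, mul_assoc, mul_assoc]
    -- Shifting the index splits off the term of the rung `0`; the rung `N` is zero.
    have hshift : ∀ g : ℕ → ℤ →₀ Alg k Q, g N = 0 →
        ∑ i ∈ Finset.range N, g i = ∑ i ∈ Finset.range N, g (i + 1) + g 0 := by
      intro g hg
      rw [← Finset.sum_range_succ', Finset.sum_range_succ, hg, add_zero]
    rw [hD, hD', Finset.sum_add_distrib, Finset.sum_add_distrib,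
      hshift (fun i : ℕ => Finsupp.single (t - i : ℤ) (u (s + i) * (dirEntry k Q σ c (s + i) * e i)))
        (by simp [he N le_rfl]),
      hshift (fun i : ℕ => Finsupp.single (t - i + 1 : ℤ)
            (u (s + 1 + i) * (e i * dirEntry k Q τ (fun _ => 1) (t - i)))) (by simp [he N le_rfl])]
    -- `c1` and `c2` are the cancellations in the squares between the rungs `i` and `i + 1`, by `e2`
    -- and `e1` respectively.
    have c1 : ∑ i ∈ Finset.range N, Finsupp.single (t - ((i + 1 : ℕ) : ℤ)) (u (s + ((i + 1 : ℕ) : ZMod m)) *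
        (dirEntry k Q σ c (s + ((i + 1 : ℕ) : ZMod m)) * e (i + 1))) +
        ∑ i ∈ Finset.range N, Finsupp.single (t - i - 1 : ℤ)
            (u (s + 1 + i) * (e i * invEntry k Q τ (fun _ => 1) (t - i - 1))) = 0 := by
      rw [← Finset.sum_add_distrib]
      refine Finset.sum_eq_zero fun i _ => ?_
      rw [show s + ((i + 1 : ℕ) : ZMod m) = s + 1 + i by push_cast; ring,
        show t - ((i + 1 : ℕ) : ℤ) = t - 1 - i by push_cast; ring,
        show t - i - 1 = t - 1 - (i : ℤ) by ring, ← Finsupp.single_add, ← mul_add, e2 i, mul_zero,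
        Finsupp.single_zero]
    have c2 : ∑ i ∈ Finset.range N, Finsupp.single (t - ((i + 1 : ℕ) : ℤ) + 1)
            (u (s + 1 + ((i + 1 : ℕ) : ZMod m)) * (e (i + 1) *
              dirEntry k Q τ (fun _ => 1) (t - ((i + 1 : ℕ) : ℤ)))) +
        ∑ i ∈ Finset.range N, Finsupp.single (t - i : ℤ) (u (s + 1 + i + 1) *
            (invEntry k Q σ c (s + 1 + i) * e i)) = 0 := by
      rw [← Finset.sum_add_distrib]
      refine Finset.sum_eq_zero fun i _ => ?_
      rw [show s + 1 + ((i + 1 : ℕ) : ZMod m) = s + 1 + i + 1 by push_cast; ring,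
        show t - ((i + 1 : ℕ) : ℤ) = t - 1 - i by push_cast; ring,
        show t - 1 - i + 1 = t - (i : ℤ) by ring, ← Finsupp.single_add, ← mul_add,
        add_comm (e (i + 1) * _), e1 i, mul_zero, Finsupp.single_zero]
    have z1 : dirEntry k Q σ c s * e 0 = a • word k Q fL := by
      rw [dirEntry_band hσ, fwd_direct hd.direct_s, smul_mul_smul_comm, hν0, hL,
        hd.scalar_eq hσ hdσ hτ hdτ c hf]
    have z2 : e 0 * dirEntry k Q τ (fun _ => 1) t = b • word k Q fR := by
      rw [dirEntry_of_mem hd.t_mem hd.t_succ_mem, fwd_direct hd.direct_t, one_smul, smul_mul_assoc,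
        hν0, hR]
    rw [doubleMap_apply, ← z1, ← z2]
    simp only [Nat.cast_zero, add_zero, sub_zero]
    have key : ∀ S1 S2 S3 S4 x y : ℤ →₀ Alg k Q, S1 + S4 = 0 → S3 + S2 = 0 →
        x + y = S1 + x + S2 + (S3 + y + S4) := by
      intro S1 S2 S3 S4 x y h h'
      rw [eq_neg_of_add_eq_zero_left h, eq_neg_of_add_eq_zero_left h']
      abel
    exact key _ _ _ _ _ _ c1 c2

end IsDoubleData

end Sides

/-! ### Unipotent shifts -/

section Shift

variable {V : Type u} {A : Type v} [Fintype V] [Fintype A] {k : Type w} [Field k]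
  {Q : GentleQuiver V A}

variable (k Q) in
/-- The linear map sending the basis element `i` to the basis element `g i`. -/
noncomputable def push {ι ι' : Type} (g : ι → ι') :
    (ι →₀ Alg k Q) →ₗ[Alg k Q] (ι' →₀ Alg k Q) :=
  Finsupp.linearCombination (Alg k Q) fun i => Finsupp.single (g i) 1

theorem push_single {ι ι' : Type} (g : ι → ι') (i : ι) (r : Alg k Q) :
    push k Q g (Finsupp.single i r) = Finsupp.single (g i) r := by
  simp [push]

theorem push_eq_mapDomain {ι ι' : Type} (g : ι → ι') (u : ι →₀ Alg k Q) :
    push k Q g u = Finsupp.mapDomain g u := by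
  simp [push, Finsupp.linearCombination_apply, Finsupp.mapDomain]

/-- The linear map `1 - N`, where `N` sends the basis element `j` to `n j` times the basis element
`j + d`. -/
noncomputable def unipotent (d : ℤ) (n : ℤ → Alg k Q) :
    (ℤ →₀ Alg k Q) →ₗ[Alg k Q] (ℤ →₀ Alg k Q) :=
  LinearMap.id - Finsupp.linearCombination (Alg k Q) fun j => Finsupp.single (j + d) (n j)

variable {d t : ℤ} {n : ℤ → Alg k Q}

theorem unipotent_single (j : ℤ) (r : Alg k Q) : unipotent d n (Finsupp.single j r) =
    Finsupp.single j r - Finsupp.single (j + d) (r * n j) := by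
  simp [unipotent]

theorem shift_apply (z : ℤ →₀ Alg k Q) (l : ℤ) :
    Finsupp.linearCombination (Alg k Q) (fun j => Finsupp.single (j + d) (n j)) z l =
      z (l - d) * n (l - d) := by
  classical
  have : (Finsupp.lapply l : (ℤ →₀ Alg k Q) →ₗ[Alg k Q] Alg k Q) ∘ₗ
      Finsupp.linearCombination (Alg k Q) (fun j => Finsupp.single (j + d) (n j)) =
      LinearMap.toSpanSingleton (Alg k Q) (Alg k Q) (n (l - d)) ∘ₗ Finsupp.lapply (l - d) := by
    refine linearMap_ext_rows fun i => ?_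
    simp only [LinearMap.comp_apply, Finsupp.linearCombination_single, one_smul,
      Finsupp.lapply_apply, LinearMap.toSpanSingleton_apply, Finsupp.single_apply, smul_eq_mul,
      ite_mul, one_mul, zero_mul, eq_sub_iff_add_eq]
    split_ifs with h
    · rw [← h, add_sub_cancel_right]
    · rfl
  exact LinearMap.congr_fun this z

/-- The support is finite, so boundedly many steps of length `d` carry all of it beyond `t`, where
the shift vanishes. The bound `r` drives the two inductions below. -/
theorem exists_support_bound (hd : 0 < d) (t : ℤ) (z : ℤ →₀ Alg k Q) :
    ∃ r : ℕ, ∀ j, z j ≠ 0 → t < j + r * d := by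
  refine ⟨z.support.sup fun j => (t - j).toNat + 1, fun j hj => ?_⟩
  have h1 : (t - j).toNat + 1 ≤ z.support.sup fun j => (t - j).toNat + 1 :=
    Finset.le_sup (f := fun j => (t - j).toNat + 1) (Finsupp.mem_support_iff.2 hj)
  have h2 : (t - j) + 1 ≤ ((z.support.sup fun j => (t - j).toNat + 1 : ℕ) : ℤ) := by omega
  nlinarith

theorem unipotent_bound_succ {r : ℕ} {z : ℤ →₀ Alg k Q}
    (hz : ∀ j, z j ≠ 0 → t < j + (r + 1 : ℕ) * d) (j : ℤ)
    (hj : Finsupp.linearCombination (Alg k Q) (fun j => Finsupp.single (j + d) (n j)) z j ≠ 0) :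
    t < j + r * d := by
  rw [shift_apply] at hj
  have := hz (j - d) fun h => hj (by rw [h, zero_mul])
  push_cast at this
  linarith

theorem shift_eq_zero (hn : ∀ j, t < j → n j = 0) {z : ℤ →₀ Alg k Q}
    (hz : ∀ j, z j ≠ 0 → t < j + (0 : ℕ) * d) :
    Finsupp.linearCombination (Alg k Q) (fun j => Finsupp.single (j + d) (n j)) z = 0 := by
  ext l
  rw [shift_apply]
  by_cases h : z (l - d) = 0
  · simp [h]
  · simp [hn _ (by simpa using hz _ h)]

/-- A kernel element is fixed by the locally nilpotent shift, so its bound can be lowered to zero.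
-/
theorem unipotent_injective (hd : 0 < d) (hn : ∀ j, t < j → n j = 0) {z : ℤ →₀ Alg k Q}
    (hz : unipotent d n z = 0) : z = 0 := by
  obtain ⟨r, hr⟩ := exists_support_bound hd t z
  have h : z = Finsupp.linearCombination (Alg k Q) (fun j => Finsupp.single (j + d) (n j)) z :=
    sub_eq_zero.1 hz
  induction r with
  | zero => rw [h, shift_eq_zero hn hr]
  | succ r ih => exact ih fun j hj => unipotent_bound_succ (n := n) hr j (h ▸ hj)

/-- The geometric series of the shift, finite on each element, stays inside every invariant
submodule `S`. This allows one degree to be treated at a time. -/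
theorem unipotent_surjective (hd : 0 < d) (hn : ∀ j, t < j → n j = 0)
    {S : Submodule (Alg k Q) (ℤ →₀ Alg k Q)}
    (hS : ∀ z ∈ S, Finsupp.linearCombination (Alg k Q)
      (fun j => Finsupp.single (j + d) (n j)) z ∈ S) {z : ℤ →₀ Alg k Q} (hz : z ∈ S) :
    ∃ w ∈ S, unipotent d n w = z := by
  obtain ⟨r, hr⟩ := exists_support_bound hd t z
  induction r generalizing z with
  | zero => exact ⟨z, hz, by
      rw [unipotent, LinearMap.sub_apply, shift_eq_zero hn hr, sub_zero, LinearMap.id_apply]⟩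
  | succ r ih =>
    obtain ⟨w, hw, h⟩ := ih (hS z hz) fun j hj => unipotent_bound_succ hr j hj
    refine ⟨z + w, add_mem hz hw, ?_⟩
    rw [map_add, h]
    simp [unipotent]

end Shift

/-! ### The positions of the mapping cone -/

section Positions

variable {m : ℕ}

/-- The position in the cone of a position of `τ`. -/
def stringPos (m : ℕ) (t j : ℤ) : ℤ := if j ≤ t then j else j + m

/-- The position in the cone of a position of `σ`. -/
def bandPos (s : ZMod m) (t : ℤ) (q : ZMod m) : ℤ := t + 1 + (s - q).val

theorem stringPos_le {t j : ℤ} (h : j ≤ t) : stringPos m t j = j := if_pos h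

theorem stringPos_gt {t j : ℤ} (h : t < j) : stringPos m t j = j + m := if_neg (by omega)

theorem stringPos_injective (t : ℤ) : Function.Injective (stringPos m t) := by
  intro i j h
  unfold stringPos at h
  split_ifs at h <;> omega

variable [NeZero m]

theorem bandPos_gt {m : ℕ} (s : ZMod m) (t : ℤ) (q : ZMod m) : t < bandPos s t q := by
  unfold bandPos; omega

theorem bandPos_le (s : ZMod m) (t : ℤ) (q : ZMod m) : bandPos s t q ≤ t + m := by
  have := ZMod.val_lt (s - q)
  unfold bandPos; omega

theorem cast_bandPos (s : ZMod m) (t : ℤ) (q : ZMod m) :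
    s - ((bandPos s t q - t - 1 : ℤ) : ZMod m) = q := by
  have : bandPos s t q - t - 1 = ((s - q).val : ℤ) := by unfold bandPos; ring
  rw [this]
  simp

theorem bandPos_injective (s : ZMod m) (t : ℤ) : Function.Injective (bandPos s t) := fun q q' h => by
  rw [← cast_bandPos s t q, h, cast_bandPos]

theorem bandPos_sub {m : ℕ} {s : ZMod m} {t : ℤ} {i : ℤ} (h : t < i) (h' : i ≤ t + m) :
    bandPos s t (s - ((i - t - 1 : ℤ) : ZMod m)) = i := by
  obtain ⟨r, hr⟩ := Int.eq_ofNat_of_zero_le (show 0 ≤ i - t - 1 by omega)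
  rw [hr]
  unfold bandPos
  rw [sub_sub_cancel, Int.cast_natCast, ZMod.val_natCast_of_lt (by omega)]
  omega

theorem stringPos_ne_bandPos (s : ZMod m) (t j : ℤ) (q : ZMod m) :
    stringPos m t j ≠ bandPos s t q := by
  have h1 := bandPos_gt s t q
  have h2 := bandPos_le s t q
  unfold stringPos
  split_ifs <;> omega

end Positions

/-! ### Entries of the cone differential, and the two identities for the map out of the cone -/

section ConeMaps

variable {V : Type u} {A : Type v} [Fintype V] [Fintype A] {k : Type w} [Field k]
  {Q : GentleQuiver V A} {m : ℕ} {σ : Walk V A (ZMod m)}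
  {τ : Walk V A ℤ} {s : ZMod m} {t : ℤ} {fL fR : List A}

open Classical in
/-- The scalars of the mapping cone. -/
noncomputable def coneCoef (c : ZMod m → k) (s : ZMod m) (t : ℤ) (a b : k) (i : ℤ) : k :=
  if i < t then 1 else if i = t then a else if i < t + m then -c (s - ((i - t : ℤ) : ZMod m))
  else if i = t + m then b else 1

theorem coneCoef_ne_zero {c : ZMod m → k} (hc : ∀ i, c i ≠ 0) {a b : k} (ha : a ≠ 0) (hb : b ≠ 0)
    (i : ℤ) : coneCoef c s t a b i ≠ 0 := by
  unfold coneCoef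
  split_ifs
  · exact one_ne_zero
  · exact ha
  · exact neg_ne_zero.2 (hc _)
  · exact hb
  · exact one_ne_zero

namespace IsDoubleData

variable {degσ : ZMod m → ℤ} {degτ : ℤ → ℤ} (hd : IsDoubleData Q σ degσ τ degτ s t fL fR)
include hd

variable {c : ZMod m → k} {a b : k}

local notation "DC" => dirEntry k Q (coneWalk σ τ s t fL fR) (coneCoef c s t a b)
local notation "IC" => invEntry k Q (coneWalk σ τ s t fL fR) (coneCoef c s t a b)

omit hd in
theorem entry_lt {i : ℤ} (h : i < t) : DC i = dirEntry k Q τ (fun _ => 1) i ∧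
    IC i = invEntry k Q τ (fun _ => 1) i := by
  have h1 := mem_coneWalk_le (σ := σ) (τ := τ) (s := s) (fL := fL) (fR := fR) h.le
  have h2 := mem_coneWalk_le (σ := σ) (τ := τ) (s := s) (fL := fL) (fR := fR)
    (show i + 1 ≤ t by omega)
  have hc : coneCoef c s t a b i = 1 := if_pos h
  classical
  constructor <;> refine if_congr (and_congr h1 h2) ?_ rfl <;> rw [coneWalk_letter_lt h, hc]

theorem entry_left [NeZero m] (hσ : IsHomotopyBand Q σ) : DC t = 0 ∧ IC t = a • word k Q fL := by
  have hm := NeZero.pos m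
  have h1 : t ∈ (coneWalk σ τ s t fL fR).carrier := (mem_coneWalk_le le_rfl).2 hd.t_mem
  have h2 : t + 1 ∈ (coneWalk σ τ s t fL fR).carrier :=
    mem_coneWalk_mid hσ.carrier_eq (by omega) (by omega)
  rw [dirEntry_of_mem h1 h2, invEntry_of_mem h1 h2, coneWalk_letter_left]
  simp [fwd, bwd, coneCoef]

omit hd in
-- Reading σ backwards exchanges direct and inverse entries; the sign is that of the shift in the
-- cone.
theorem entry_mid (hσ : IsHomotopyBand Q σ) {i : ℤ} (h : t < i) (h' : i < t + m) :
    DC i = -invEntry k Q σ c (s - ((i - t : ℤ) : ZMod m)) ∧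
    IC i = -dirEntry k Q σ c (s - ((i - t : ℤ) : ZMod m)) := by
  have h1 : i ∈ (coneWalk σ τ s t fL fR).carrier := mem_coneWalk_mid hσ.carrier_eq h h'.le
  have h2 : i + 1 ∈ (coneWalk σ τ s t fL fR).carrier :=
    mem_coneWalk_mid hσ.carrier_eq (by omega) (by omega)
  have hc : coneCoef c s t a b i = -1 * c (s - ((i - t : ℤ) : ZMod m)) := by
    rw [coneCoef, if_neg (by omega), if_neg (by omega), if_pos h', neg_one_mul]
  rw [dirEntry_of_mem h1 h2, invEntry_of_mem h1 h2, coneWalk_letter_mid h h', dirEntry_band hσ,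
    invEntry_band hσ, fwd_inv, bwd_inv, hc, ← smul_smul, ← smul_smul, neg_one_smul_alg,
    neg_one_smul_alg]
  exact ⟨rfl, rfl⟩

theorem entry_right [NeZero m] (hσ : IsHomotopyBand Q σ) :
    DC (t + m) = b • word k Q fR ∧ IC (t + m) = 0 := by
  have hm := NeZero.pos m
  have h1 : t + m ∈ (coneWalk σ τ s t fL fR).carrier :=
    mem_coneWalk_mid hσ.carrier_eq (by omega) le_rfl
  have h2 : t + m + 1 ∈ (coneWalk σ τ s t fL fR).carrier := by
    rw [mem_coneWalk_gt (by omega), show t + m + 1 - m = t + 1 by ring]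
    exact hd.t_succ_mem
  have hc : coneCoef c s t a b (t + m) = b := by
    rw [coneCoef, if_neg (by omega), if_neg (by omega), if_neg (by omega), if_pos rfl]
  rw [dirEntry_of_mem h1 h2, invEntry_of_mem h1 h2, coneWalk_letter_right hm rfl, hc]
  simp [fwd, bwd]

omit hd in
theorem entry_gt {i : ℤ} (h : t < i) : DC (i + m) = dirEntry k Q τ (fun _ => 1) i ∧
    IC (i + m) = invEntry k Q τ (fun _ => 1) i := by
  have e : i + m + 1 - m = i + 1 := by ring
  have hc : coneCoef c s t a b (i + m) = 1 := by
    rw [coneCoef, if_neg (by omega), if_neg (by omega), if_neg (by omega), if_neg (by omega)]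
  have h1 := mem_coneWalk_gt (σ := σ) (τ := τ) (s := s) (fL := fL) (fR := fR)
    (show t + m < i + m by omega)
  have h2 := mem_coneWalk_gt (σ := σ) (τ := τ) (s := s) (fL := fL) (fR := fR)
    (show t + m < i + m + 1 by omega)
  rw [add_sub_cancel_right] at h1
  rw [e] at h2
  classical
  constructor <;> refine if_congr (and_congr h1 h2) ?_ rfl <;>
    rw [coneWalk_letter_gt (by omega), hc, add_sub_cancel_right]

variable {n : ℤ → Alg k Q}

/-- `E1` and `E2` make the shift compatible with the letters to the left of `t`. The letter τ_C,
absent from `c`, is recovered by `T1` as the detour from `t` through the shift to `t + m` and then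
along f_R. -/
theorem string_comm [NeZero m] (hσ : IsHomotopyBand Q σ) (hn : ∀ j, t < j → n j = 0)
    (E1 : ∀ j < t, dirEntry k Q τ (fun _ => 1) j * n (j + 1) = n j * DC (j + m))
    (E2 : ∀ j < t, invEntry k Q τ (fun _ => 1) j * n j = n (j + 1) * IC (j + m))
    (T1 : dirEntry k Q τ (fun _ => 1) t + n t * DC (t + m) = 0) (u : ℤ →₀ Alg k Q) :
    diff k Q (coneWalk σ τ s t fL fR) (coneCoef c s t a b)
      (unipotent m n (push k Q (stringPos m t) u)) =
    unipotent m n (push k Q (stringPos m t) (diff k Q τ (fun _ => 1) u)) := by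
  have hm := NeZero.pos m
  have hit : invEntry k Q τ (fun _ => (1 : k)) t = 0 := by
    rw [invEntry_of_mem hd.t_mem hd.t_succ_mem, bwd_direct hd.direct_t, smul_zero]
  suffices h : diff k Q (coneWalk σ τ s t fL fR) (coneCoef c s t a b) ∘ₗ
      unipotent m n ∘ₗ push k Q (stringPos m t) =
      unipotent m n ∘ₗ push k Q (stringPos m t) ∘ₗ diff k Q τ (fun _ => 1) from
    LinearMap.congr_fun h u
  refine linearMap_ext_rows fun j => ?_
  simp only [LinearMap.comp_apply, diff_single, one_mul, push_single, unipotent_single, map_add,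
    map_sub]
  rcases lt_trichotomy j t with h | rfl | h
  · have e2 := E2 (j - 1) (by omega)
    rw [sub_add_cancel] at e2
    rw [stringPos_le h.le, stringPos_le (by omega), stringPos_le (by omega), E1 j h, e2,
      (entry_lt h).1, (entry_lt (show j - 1 < t by omega)).2,
      show j + 1 + (m : ℤ) = j + m + 1 by ring, show j - 1 + (m : ℤ) = j + m - 1 by ring]
    abel
  · have e2 := E2 (j - 1) (by omega)
    rw [sub_add_cancel] at e2
    rw [stringPos_le le_rfl, stringPos_gt (by omega), stringPos_le (by omega), hn (j + 1 + m)
      (by omega), e2, (hd.entry_left hσ).1, (entry_lt (show j - 1 < j by omega)).2,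
      eq_neg_of_add_eq_zero_left T1,
      show j + 1 + (m : ℤ) = j + m + 1 by ring, show j - 1 + (m : ℤ) = j + m - 1 by ring]
    simp only [mul_zero, Finsupp.single_zero, Finsupp.single_neg]
    abel
  · have h0 : n (stringPos m t j) = 0 := hn _ (by rw [stringPos_gt h]; omega)
    have h1 : n (stringPos m t (j + 1)) = 0 := hn _ (by rw [stringPos_gt (by omega)]; omega)
    rw [h0, h1, stringPos_gt h, stringPos_gt (show t < j + 1 by omega), (entry_gt h).1]
    -- The left neighbour of the position `t + 1` of τ is τ_C in τ and f_R in `c`. Both are direct,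
    -- so nothing leaves to the left in either complex.
    rcases eq_or_lt_of_le (show t + 1 ≤ j by omega) with rfl | h'
    · rw [show t + 1 + (m : ℤ) - 1 = t + m by ring, (hd.entry_right hσ).2, add_sub_cancel_right,
        hit]
      simp only [mul_zero, zero_mul, Finsupp.single_zero]
      rw [show t + 1 + (m : ℤ) + 1 = t + 1 + 1 + m by ring]
      abel
    · have h2 : n (stringPos m t (j - 1)) = 0 := hn _ (by rw [stringPos_gt (by omega)]; omega)
      rw [h2, stringPos_gt (show t < j - 1 by omega), show j + (m : ℤ) - 1 = j - 1 + m by ring,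
        (entry_gt (show t < j - 1 by omega)).2]
      simp only [mul_zero, zero_mul, Finsupp.single_zero]
      rw [show j + (m : ℤ) + 1 = j + 1 + m by ring]
      abel

/-- The shift vanishes on the positions of σ, so it enters only after f_L has led to `t`. By `T2`,
f_L followed by the shift supplies the letter σ_C missing from `c`. -/
theorem band_comm [NeZero m] (hσ : IsHomotopyBand Q σ) (hn : ∀ j, t < j → n j = 0)
    (T2 : IC t * n t + dirEntry k Q σ c s = 0) (u : ZMod m →₀ Alg k Q) :
    diff k Q (coneWalk σ τ s t fL fR) (coneCoef c s t a b)
      (unipotent m n (push k Q (bandPos s t) u)) +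
      unipotent m n (push k Q (bandPos s t) (diff k Q σ c u)) =
    unipotent m n (push k Q (stringPos m t) (doubleMap k Q s t a b fL fR u)) := by
  have hm := hσ.two_le
  have : Fact (1 < m) := ⟨hm⟩
  have hs : s + 1 ≠ s := by simp
  have his : invEntry k Q σ c s = 0 := by
    rw [invEntry_band hσ, bwd_direct hd.direct_s, smul_zero]
  suffices h : diff k Q (coneWalk σ τ s t fL fR) (coneCoef c s t a b) ∘ₗ
      unipotent m n ∘ₗ push k Q (bandPos s t) +
      unipotent m n ∘ₗ push k Q (bandPos s t) ∘ₗ diff k Q σ c =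
      unipotent m n ∘ₗ push k Q (stringPos m t) ∘ₗ doubleMap k Q s t a b fL fR from
    LinearMap.congr_fun h u
  refine linearMap_ext_rows fun q => ?_
  obtain ⟨i, hi, hi', rfl⟩ : ∃ i, t < i ∧ i ≤ t + m ∧ s - ((i - t - 1 : ℤ) : ZMod m) = q :=
    ⟨_, bandPos_gt s t q, bandPos_le s t q, cast_bandPos s t q⟩
  have hb : ∀ q, n (bandPos s t q) = 0 := fun q => hn _ (bandPos_gt s t q)
  simp only [LinearMap.comp_apply, LinearMap.add_apply, diff_single, one_mul, push_single,
    unipotent_single, map_add, hb, mul_zero, Finsupp.single_zero, sub_zero, bandPos_sub hi hi',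
    doubleMap_apply, hn i hi]
  have hright : i < t + m → bandPos s t (s - ((i - t - 1 : ℤ) : ZMod m) - 1) = i + 1 ∧
      DC i = -invEntry k Q σ c (s - ((i - t - 1 : ℤ) : ZMod m) - 1) := fun h => by
    have e : s - ((i - t - 1 : ℤ) : ZMod m) - 1 = s - ((i - t : ℤ) : ZMod m) := by
      push_cast; ring
    rw [(entry_mid hσ hi h).1, e, show i - t = i + 1 - t - 1 by ring,
      bandPos_sub (by omega) (by omega)]
    exact ⟨rfl, rfl⟩
  have hleft : t < i - 1 → bandPos s t (s - ((i - t - 1 : ℤ) : ZMod m) + 1) = i - 1 ∧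
      IC (i - 1) = -dirEntry k Q σ c (s - ((i - t - 1 : ℤ) : ZMod m)) := fun h => by
    have e : s - ((i - t - 1 : ℤ) : ZMod m) + 1 = s - ((i - 1 - t - 1 : ℤ) : ZMod m) := by
      push_cast; ring
    rw [(entry_mid hσ h (by omega)).2, e, bandPos_sub (by omega) (by omega),
      show i - 1 - t = i - t - 1 by ring]
    exact ⟨rfl, rfl⟩
  have hne : ∀ q q' : ZMod m, q ≠ q' → ∀ r : Alg k Q, (Finsupp.single q r) q' = 0 :=
    fun q q' h r => by rw [Finsupp.single_apply, if_neg h]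
  -- The position `s` of σ, where f_L starts and σ_C is missing.
  rcases eq_or_lt_of_le (show t + 1 ≤ i by omega) with rfl | h1
  · have e : s - ((t + 1 - t - 1 : ℤ) : ZMod m) = s := by simp
    obtain ⟨h2, h3⟩ := hright (by omega)
    rw [h2, h3, add_sub_cancel_right, (hd.entry_left hσ).2, e, show s + 1 = s - ((t + m - t - 1 : ℤ) : ZMod m) by simp,
      bandPos_sub (by omega) le_rfl, show s - ((t + m - t - 1 : ℤ) : ZMod m) = s + 1 by simp,
      hne s (s + 1) hs.symm, Finsupp.single_eq_same, stringPos_le le_rfl,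
      eq_neg_of_add_eq_zero_right T2, (hd.entry_left hσ).2]
    simp only [zero_mul, one_mul, Finsupp.single_zero, Finsupp.single_neg]
    abel
  -- The position `s + 1` of σ, where f_R starts.
  rcases eq_or_lt_of_le hi' with rfl | h2
  · have e : s - ((t + m - t - 1 : ℤ) : ZMod m) = s + 1 := by simp
    obtain ⟨h3, h4⟩ := hleft (by omega)
    rw [h3, h4, (hd.entry_right hσ).1, e,
      add_sub_cancel_right, his, hne _ _ hs, Finsupp.single_eq_same, stringPos_le le_rfl,
      stringPos_gt (by omega), hn (t + 1 + m) (by omega)]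
    simp only [zero_mul, one_mul, mul_zero, Finsupp.single_zero, Finsupp.single_neg]
    rw [show t + (m : ℤ) + 1 = t + 1 + m by ring]
    abel
  · obtain ⟨h3, h4⟩ := hleft (by omega)
    obtain ⟨h5, h6⟩ := hright h2
    have e1 : s - ((i - t - 1 : ℤ) : ZMod m) ≠ s := by
      intro h
      have := bandPos_sub (s := s) hi hi'
      rw [h, bandPos] at this
      simp at this; omega
    have e2 : s - ((i - t - 1 : ℤ) : ZMod m) ≠ s + 1 := by
      intro h
      have := bandPos_sub (s := s) hi hi'
      rw [h, show s + 1 = s - ((t + m - t - 1 : ℤ) : ZMod m) by simp,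
        bandPos_sub (by omega) le_rfl] at this
      omega
    rw [hne _ _ e1, hne _ _ e2]
    rw [h3, h4, h5, h6]
    simp only [zero_mul, Finsupp.single_zero, Finsupp.single_neg]
    abel

end IsDoubleData

end ConeMaps

/-! ### The change of basis along a ladder from τ to σ -/

section ConeIso

variable {V : Type u} {A : Type v} [Fintype V] [Fintype A] {k : Type w} [Field k]
  {Q : GentleQuiver V A} {m : ℕ} [NeZero m] {σ : Walk V A (ZMod m)}
  {τ : Walk V A ℤ} {s : ZMod m} {t : ℤ} {fL fR : List A}
  {degσ : ZMod m → ℤ} {degτ : ℤ → ℤ}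

namespace IsDoubleData

variable (hd : IsDoubleData Q σ degσ τ degτ s t fL fR)
  (hσ : IsHomotopyBand Q σ) (hτ : IsHomotopyString Q τ)
  {G : ℕ → Alg k Q}
  (hG : IsLadder (fun i : ℕ => τ.vtx (t - i)) (leftLetters τ t)
      (fun i : ℕ => σ.vtx (s + 1 + i)) (rightLetters σ s) G)
include hd hσ hτ hG

omit [NeZero m] hτ in
theorem deg_of_ladder (hdσ : IsGrading σ degσ) (hdτ : IsGrading τ degτ) {i : ℕ} (hi : G i ≠ 0) :
    t - i ∈ τ.carrier ∧ degσ (s + 1 + i) = degτ (t - i) + 1 :=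
  hd.deg_of_agree hσ hdσ hdτ i fun _ hj => (hG.agree _ (hG.ne_zero_of_le hj hi)).2

omit [NeZero m] hd hσ hτ in
-- After one turn of the band the ladder compares τ with itself: the letters of the two walks agree
-- `m` steps earlier, and those of σ are periodic. As `m ≥ 2`, that earlier place lies far enough
-- before the last rung for `agree_succ`.
theorem letter_of_ladder {i : ℕ} (hi : G i ≠ 0) (hmi : m ≤ i) (hm : 2 ≤ m) :
    t - 1 - i + m ∈ τ.carrier ∧ τ.letter (t - 1 - i + m) = (σ.letter (s + 1 + i)).inv := by
  obtain ⟨j, rfl⟩ := Nat.exists_eq_add_of_le hmi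
  have h2 := hG.agree_succ j (hG.ne_zero_of_le (by omega) hi)
  obtain ⟨h3, h4⟩ := mem_leftLetters (h2.trans rfl : leftLetters τ t j = some _)
  rw [show t - 1 - ((m + j : ℕ) : ℤ) + m = t - 1 - j by push_cast; ring]
  exact ⟨h3, h4.trans (by simp)⟩

/-- For `i < m` the target of the rung is a position of σ. For `i ≥ m` it is one of τ, which by
`letter_of_ladder` carries the same vertex as the corresponding position of σ; the degrees match
because `deg_of_ladder` applies at both `i` and `i - m`. -/
theorem position_of_ladder (hdσ : IsGrading σ degσ) (hdτ : IsGrading τ degτ) {i : ℕ}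
    (hi : G i ≠ 0) : t - i + m ∈ (coneWalk σ τ s t fL fR).carrier ∧
      (coneWalk σ τ s t fL fR).vtx (t - i + m) = σ.vtx (s + 1 + i) ∧
      coneDeg degσ degτ s t (t - i + m) = degτ (t - i) := by
  have hm := hσ.two_le
  obtain ⟨h1, h2⟩ := hd.deg_of_ladder hσ hG hdσ hdτ hi
  rcases Nat.lt_or_ge i m with h | h
  · have e : s - ((t - i + m - t - 1 : ℤ) : ZMod m) = s + 1 + i := by push_cast; simp; ring
    refine ⟨mem_coneWalk_mid hσ.carrier_eq (by omega) (by omega), ?_, ?_⟩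
    · rw [coneWalk_vtx_mid (by omega) (by omega), e]
    · rw [coneDeg_mid (by omega) (by omega), e]
      omega
  · obtain ⟨l1, l2⟩ := letter_of_ladder hG hi h hm
    have hp : t - 1 - i + m + 1 = t - i + m := by ring
    have hmem : t - i + m ∈ τ.carrier := hτ.mem_of_le h1 hd.t_mem (by omega) (by omega)
    refine ⟨(mem_coneWalk_le (by omega)).2 hmem, ?_, ?_⟩
    · rw [coneWalk_vtx_le (by omega)]
      have j1 := hτ.joins _ l1 (by rwa [hp])
      have j2 := (hσ.joins' (s + 1 + i)).inv
      rw [l2, hp] at j1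
      cases hl : (σ.letter (s + 1 + i)).inv.direct
      · exact (j1.isPath_of_inverse hl).eq_left (j2.isPath_of_inverse hl)
      · exact (j1.isPath_of_direct hl).eq_right (j2.isPath_of_direct hl)
    · rw [coneDeg_le (by omega)]
      obtain ⟨j, rfl⟩ := Nat.exists_eq_add_of_le h
      obtain ⟨-, h3⟩ := hd.deg_of_ladder hσ hG hdσ hdτ
        (hG.ne_zero_of_le (show j ≤ m + j by omega) hi)
      rw [show t - ((m + j : ℕ) : ℤ) + m = t - j by push_cast; ring]
      rw [show s + 1 + ((m + j : ℕ) : ZMod m) = s + 1 + j by simp] at h2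
      omega

/-- Along a ladder, `c` to the left of `t + m` reads like the periodic continuation of σ. The only
letter of `c` there that is not already one of σ or τ is f_L, and `hG1` identifies it with σ_C; a
ladder with a single rung does not reach it. -/
theorem entry_of_ladder (hG1 : G 1 ≠ 0 → fL = (σ.letter s).path) (c : ZMod m → k) (a b : k) {i : ℕ}
    (hi : G i ≠ 0) :
    dirEntry k Q (coneWalk σ τ s t fL fR) (coneCoef c s t a b) (t - 1 - i + m) =
      coneCoef c s t a b (t - 1 - i + m) • fwd k Q (rightLetters σ s i) ∧
    invEntry k Q (coneWalk σ τ s t fL fR) (coneCoef c s t a b) (t - 1 - i + m) =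
      coneCoef c s t a b (t - 1 - i + m) • bwd k Q (rightLetters σ s i) := by
  have hm := hσ.two_le
  suffices h : t - 1 - i + m ∈ (coneWalk σ τ s t fL fR).carrier ∧
      t - 1 - i + m + 1 ∈ (coneWalk σ τ s t fL fR).carrier ∧
      (coneWalk σ τ s t fL fR).letter (t - 1 - i + m) = (σ.letter (s + 1 + i)).inv by
    obtain ⟨h1, h2, h3⟩ := h
    rw [dirEntry_of_mem h1 h2, invEntry_of_mem h1 h2, h3]
    exact ⟨rfl, rfl⟩
  rcases lt_trichotomy (i + 1) m with h | h | h
  · refine ⟨mem_coneWalk_mid hσ.carrier_eq (by omega) (by omega),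
      mem_coneWalk_mid hσ.carrier_eq (by omega) (by omega), ?_⟩
    rw [coneWalk_letter_mid (by omega) (by omega)]
    congr 2
    push_cast; simp; ring
  -- The full turn: σ_C is met in σ and f_L in `c`. Here `i ≥ 1`, so the rung `1` is nonzero and
  -- `hG1` applies.
  · have e : t - 1 - i + m = t := by omega
    rw [e, coneWalk_letter_left, hG1 (hG.ne_zero_of_le (by omega) hi)]
    have e' : s + 1 + (i : ZMod m) = s := by
      have : ((i + 1 : ℕ) : ZMod m) = 0 := by rw [h]; simp
      push_cast at this
      rw [add_assoc, add_comm 1, this, add_zero]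
    refine ⟨(mem_coneWalk_le le_rfl).2 hd.t_mem,
      mem_coneWalk_mid hσ.carrier_eq (by omega) (by omega), ?_⟩
    simp [e', Letter.inv, hd.direct_s]
  · obtain ⟨l1, l2⟩ := letter_of_ladder hG hi (by omega) hm
    refine ⟨(mem_coneWalk_le (by omega)).2 l1, (mem_coneWalk_le (by omega)).2
      (hτ.mem_of_le l1 hd.t_mem (by omega) (by omega)), ?_⟩
    rw [coneWalk_letter_lt (by omega), l2]

/-- The shift of the cone by `m` along a ladder from `τ` to `σ`. -/
theorem exists_shift (hdσ : IsGrading σ degσ) (hdτ : IsGrading τ degτ) {c : ZMod m → k}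
    (hc : ∀ i, c i ≠ 0) {a b : k} (ha : a ≠ 0) (hb : b ≠ 0) (hac : a = c s * b)
    (hL : word k Q fL * G 0 = word k Q (σ.letter s).path)
    (hR : G 0 * word k Q fR = word k Q (τ.letter t).path)
    (hG1 : G 1 ≠ 0 → fL = (σ.letter s).path) :
    ∃ n : ℤ → Alg k Q, (∀ j, t < j → n j = 0) ∧
      (∀ j < t, dirEntry k Q τ (fun _ => 1) j * n (j + 1) =
        n j * dirEntry k Q (coneWalk σ τ s t fL fR) (coneCoef c s t a b) (j + m) ∧
      invEntry k Q τ (fun _ => 1) j * n j =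
        n (j + 1) * invEntry k Q (coneWalk σ τ s t fL fR) (coneCoef c s t a b) (j + m)) ∧
      dirEntry k Q τ (fun _ => (1 : k)) t +
        n t * dirEntry k Q (coneWalk σ τ s t fL fR) (coneCoef c s t a b) (t + m) = 0 ∧
      invEntry k Q (coneWalk σ τ s t fL fR) (coneCoef c s t a b) t * n t +
        dirEntry k Q σ c s = 0 ∧
      ∀ e, ∀ z ∈ term k Q (coneWalk σ τ s t fL fR) (coneDeg degσ degτ s t) e,
        Finsupp.linearCombination (Alg k Q) (fun j : ℤ => Finsupp.single (j + m) (n j)) z ∈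
          term k Q (coneWalk σ τ s t fL fR) (coneDeg degσ degτ s t) e := by
  have hm := hσ.two_le
  -- The initial scalar `-b⁻¹` is dictated by `T1`; `T2` then holds because `a = c s * b`.
  obtain ⟨ν, hν0, hν1, hν2⟩ := hG.exists_scalars (fun _ => 1)
    (fun i => coneCoef c s t a b (t - 1 - i + m)) (fun _ => one_ne_zero)
    (fun i => coneCoef_ne_zero hc ha hb _) (-1 * b⁻¹)
  let n : ℤ → Alg k Q := fun j => if j ≤ t then ν (t - j).toNat • G (t - j).toNat else 0
  have hn : ∀ j, t < j → n j = 0 := fun j hj => if_neg (by omega)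
  have hn' : ∀ i : ℕ, n (t - i) = ν i • G i := fun i => by simp [n]
  have hnt : n t = -(b⁻¹ • G 0) := by
    have := hn' 0
    rw [Nat.cast_zero, sub_zero, hν0, ← smul_smul, neg_one_smul_alg] at this
    exact this
  have hzero : ∀ i, G i = 0 → G (i + 1) = 0 := fun i h => by
    by_contra h'
    exact (hG.agree i h').1 h
  have hE : ∀ j < t, dirEntry k Q τ (fun _ => 1) j * n (j + 1) =
        n j * dirEntry k Q (coneWalk σ τ s t fL fR) (coneCoef c s t a b) (j + m) ∧
      invEntry k Q τ (fun _ => 1) j * n j =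
        n (j + 1) * invEntry k Q (coneWalk σ τ s t fL fR) (coneCoef c s t a b) (j + m) := by
    intro j hj
    obtain ⟨i, rfl⟩ : ∃ i : ℕ, j = t - 1 - i := ⟨(t - 1 - j).toNat, by omega⟩
    rw [show t - 1 - i + 1 = t - (i : ℤ) by ring, hn' i,
      show t - 1 - (i : ℤ) = t - (i + 1 : ℕ) by push_cast; ring, hn' (i + 1),
      show t - ((i + 1 : ℕ) : ℤ) = t - 1 - i by push_cast; ring,
      dirEntry_left hτ hd.t_mem, invEntry_left hτ hd.t_mem]
    by_cases h0 : G i = 0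
    · simp [h0, hzero i h0]
    · obtain ⟨e1, e2⟩ := hd.entry_of_ladder hσ hτ hG hG1 c a b h0
      have h1 := hν1 i
      have h2 := hν2 i
      rw [one_smul] at h1 h2
      rw [e1, e2]
      exact ⟨h1, h2⟩
  have T1 : dirEntry k Q τ (fun _ => (1 : k)) t +
      n t * dirEntry k Q (coneWalk σ τ s t fL fR) (coneCoef c s t a b) (t + m) = 0 := by
    rw [dirEntry_of_mem hd.t_mem hd.t_succ_mem, one_smul, fwd_direct hd.direct_t,
      (hd.entry_right hσ).1, hnt, neg_mul, smul_mul_smul_comm, inv_mul_cancel₀ hb, one_smul, hR,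
      add_neg_cancel]
  have T2 : invEntry k Q (coneWalk σ τ s t fL fR) (coneCoef c s t a b) t * n t +
      dirEntry k Q σ c s = 0 := by
    rw [dirEntry_band hσ, fwd_direct hd.direct_s, (hd.entry_left hσ).2, hnt, mul_neg,
      smul_mul_smul_comm, hL, hac, mul_assoc, mul_inv_cancel₀ hb, mul_one, neg_add_cancel]
  refine ⟨n, hn, hE, T1, T2, ?_⟩
  refine fun e z hz => linearCombination_mem_term (fun j hj hje u hu => ?_) hz
  rw [Finsupp.smul_single, smul_eq_mul]
  rcases lt_or_ge t j with h | h
  · rw [hn j h, mul_zero, Finsupp.single_zero]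
    exact zero_mem _
  obtain ⟨i, rfl⟩ : ∃ i : ℕ, j = t - i := ⟨(t - j).toNat, by omega⟩
  rw [hn' i]
  by_cases h0 : G i = 0
  · rw [h0, smul_zero, mul_zero, Finsupp.single_zero]
    exact zero_mem _
  obtain ⟨p1, p2, p3⟩ := hd.position_of_ladder hσ hτ hG hdσ hdτ h0
  rw [coneWalk_vtx_le (by omega)] at hu
  rw [coneDeg_le (by omega)] at hje
  refine single_mem_term ?_ fun _ => ⟨p1, p3.trans hje⟩
  rw [p2, mul_smul_comm]
  exact smul_mem_proj _ (hG.mem i h0 u hu)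

end IsDoubleData

variable (hσ : IsHomotopyBand Q σ)

omit [Fintype V] [Fintype A] in
theorem coneWalk_vtx_bandPos (q : ZMod m) :
    (coneWalk σ τ s t fL fR).vtx (bandPos s t q) = σ.vtx q := by
  rw [coneWalk_vtx_mid (bandPos_gt s t q) (bandPos_le s t q), cast_bandPos]

omit [Fintype V] [Fintype A] in
theorem coneDeg_bandPos (q : ZMod m) : coneDeg degσ degτ s t (bandPos s t q) = degσ q - 1 := by
  rw [coneDeg_mid (bandPos_gt s t q) (bandPos_le s t q), cast_bandPos]

omit [NeZero m] [Fintype V] [Fintype A] in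
theorem coneWalk_vtx_stringPos (j : ℤ) :
    (coneWalk σ τ s t fL fR).vtx (stringPos m t j) = τ.vtx j := by
  rcases le_or_gt j t with h | h
  · rw [stringPos_le h, coneWalk_vtx_le h]
  · rw [stringPos_gt h, coneWalk_vtx_gt (by omega), add_sub_cancel_right]

omit [NeZero m] in
theorem coneDeg_stringPos (j : ℤ) : coneDeg degσ degτ s t (stringPos m t j) = degτ j := by
  rcases le_or_gt j t with h | h
  · rw [stringPos_le h, coneDeg_le h]
  · rw [stringPos_gt h, coneDeg_gt (by omega), add_sub_cancel_right]

omit [NeZero m] [Fintype V] [Fintype A] in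
theorem mem_coneWalk_stringPos (j : ℤ) :
    stringPos m t j ∈ (coneWalk σ τ s t fL fR).carrier ↔ j ∈ τ.carrier := by
  rcases le_or_gt j t with h | h
  · rw [stringPos_le h, mem_coneWalk_le h]
  · rw [stringPos_gt h, mem_coneWalk_gt (by omega), add_sub_cancel_right]

include hσ in
theorem push_bandPos_mem {e e' : ℤ} (he : e + (-1) = e') {u : ZMod m →₀ Alg k Q}
    (hu : u ∈ term k Q σ degσ e) : push k Q (bandPos s t) u ∈
      term k Q (coneWalk σ τ s t fL fR) (coneDeg degσ degτ s t) e' := by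
  refine linearCombination_mem_term (fun q _ hq r hr => ?_) hu
  rw [Finsupp.smul_single, smul_eq_mul, mul_one]
  refine single_mem_term (by rwa [coneWalk_vtx_bandPos]) fun _ =>
    ⟨mem_coneWalk_mid hσ.carrier_eq (bandPos_gt s t q) (bandPos_le s t q), ?_⟩
  rw [coneDeg_bandPos]
  omega

omit [NeZero m] in
theorem push_stringPos_mem {e : ℤ} {u : ℤ →₀ Alg k Q} (hu : u ∈ term k Q τ degτ e) :
    push k Q (stringPos m t) u ∈
      term k Q (coneWalk σ τ s t fL fR) (coneDeg degσ degτ s t) e := by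
  refine linearCombination_mem_term (fun j hj hje r hr => ?_) hu
  rw [Finsupp.smul_single, smul_eq_mul, mul_one]
  exact single_mem_term (by rwa [coneWalk_vtx_stringPos]) fun _ =>
    ⟨(mem_coneWalk_stringPos j).2 hj, by rw [coneDeg_stringPos, hje]⟩

/-- The positions of σ and of τ in the cone are disjoint; that they exhaust `ℤ` is used in
`exists_push_add_push`. -/
theorem push_add_push_eq_zero {x : ZMod m →₀ Alg k Q} {y : ℤ →₀ Alg k Q}
    (h0 : push k Q (bandPos s t) x + push k Q (stringPos m t) y = 0) : x = 0 ∧ y = 0 := by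
  rw [push_eq_mapDomain, push_eq_mapDomain] at h0
  constructor
  · ext q
    have := DFunLike.congr_fun h0 (bandPos s t q)
    rwa [Finsupp.add_apply, Finsupp.mapDomain_apply (bandPos_injective s t),
      Finsupp.mapDomain_of_notMem_range, add_zero] at this
    rintro ⟨j, hj⟩
    exact stringPos_ne_bandPos s t j q hj
  · ext j
    have := DFunLike.congr_fun h0 (stringPos m t j)
    rwa [Finsupp.add_apply, Finsupp.mapDomain_apply (stringPos_injective t),
      Finsupp.mapDomain_of_notMem_range, zero_add] at this
    rintro ⟨q, hq⟩
    exact stringPos_ne_bandPos s t j q hq.symm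

include hσ in
theorem exists_push_add_push {e : ℤ} {z : ℤ →₀ Alg k Q}
    (hz : z ∈ term k Q (coneWalk σ τ s t fL fR) (coneDeg degσ degτ s t) e) :
    ∃ x ∈ term k Q σ degσ (e + 1), ∃ y ∈ term k Q τ degτ e,
      push k Q (bandPos s t) x + push k Q (stringPos m t) y = z := by
  refine ⟨Finsupp.comapDomain (bandPos s t) z (bandPos_injective s t).injOn, fun q => ?_,
    Finsupp.comapDomain (stringPos m t) z (stringPos_injective t).injOn, fun j => ?_, ?_⟩
  · rw [Finsupp.comapDomain_apply]
    obtain ⟨h1, h2⟩ := hz (bandPos s t q)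
    rw [coneWalk_vtx_bandPos] at h1
    refine ⟨h1, fun h => ⟨by simp [hσ.carrier_eq], ?_⟩⟩
    have := (h2 h).2
    rw [coneDeg_bandPos] at this
    omega
  · rw [Finsupp.comapDomain_apply]
    obtain ⟨h1, h2⟩ := hz (stringPos m t j)
    rw [coneWalk_vtx_stringPos] at h1
    refine ⟨h1, fun h => ⟨(mem_coneWalk_stringPos j).1 (h2 h).1, ?_⟩⟩
    have := (h2 h).2
    rwa [coneDeg_stringPos] at this
  · rw [push_eq_mapDomain, push_eq_mapDomain]
    ext i
    rw [Finsupp.add_apply]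
    by_cases hi : t < i ∧ i ≤ t + m
    · have e' := bandPos_sub (s := s) hi.1 hi.2
      rw [← e', Finsupp.mapDomain_apply (bandPos_injective s t),
        Finsupp.mapDomain_of_notMem_range, add_zero, Finsupp.comapDomain_apply]
      rintro ⟨j, hj⟩
      exact stringPos_ne_bandPos s t j _ hj
    · obtain ⟨j, rfl⟩ : ∃ j, stringPos m t j = i := by
        rcases le_or_gt i t with h | h
        · exact ⟨i, stringPos_le h⟩
        · exact ⟨i - m, by rw [stringPos_gt (by omega), sub_add_cancel]⟩
      rw [Finsupp.mapDomain_apply (stringPos_injective t),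
        Finsupp.mapDomain_of_notMem_range, zero_add, Finsupp.comapDomain_apply]
      rintro ⟨q, hq⟩
      exact stringPos_ne_bandPos s t j q hq.symm

namespace IsDoubleData

/-- The map out of the cone is the obvious matching of summands followed by `1 - N`. Both are
bijective, and the two identities `string_comm` and `band_comm` make it a chain map. -/
theorem nonempty_cone_iso (hd : IsDoubleData Q σ degσ τ degτ s t fL fR) (hσ : IsHomotopyBand Q σ)
    (hτ : IsHomotopyString Q τ) {G : ℕ → Alg k Q}
    (hG : IsLadder (fun i : ℕ => τ.vtx (t - i)) (leftLetters τ t)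
      (fun i : ℕ => σ.vtx (s + 1 + i)) (rightLetters σ s) G)
    (hdσ : IsGrading σ degσ) (hdτ : IsGrading τ degτ) {c : ZMod m → k}
    (hc : ∀ i, c i ≠ 0) {a b : k} (ha : a ≠ 0) (hb : b ≠ 0)
    {f : walkComplex k hσ.toIsWalk c hdσ ⟶ walkComplex k hτ.toIsWalk (fun _ => 1) hdτ}
    (hf : Represents f (doubleMap k Q s t a b fL fR))
    (hL : word k Q fL * G 0 = word k Q (σ.letter s).path)
    (hR : G 0 * word k Q fR = word k Q (τ.letter t).path)
    (hG1 : G 1 ≠ 0 → fL = (σ.letter s).path) :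
    Nonempty (CochainComplex.mappingCone f ≅
      walkComplex k (hd.isWalk_coneWalk hσ hτ.toIsWalk) (coneCoef c s t a b)
        (hd.isGrading_coneWalk hσ hdσ hdτ)) := by
  have hm : (0 : ℤ) < m := by have := hσ.two_le; omega
  obtain ⟨n, hn, hE, T1, T2, hS⟩ := hd.exists_shift hσ hτ hG hdσ hdτ hc ha hb
    (hd.scalar_eq hσ hdσ hτ hdτ c hf) hL hR hG1
  have hunip : ∀ e, ∀ z ∈ term k Q (coneWalk σ τ s t fL fR) (coneDeg degσ degτ s t) e,
      unipotent m n z ∈ term k Q (coneWalk σ τ s t fL fR) (coneDeg degσ degτ s t) e :=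
    fun e z hz => sub_mem hz (hS e z hz)
  refine nonempty_mappingCone_iso hf (unipotent m n ∘ₗ push k Q (bandPos s t))
    (unipotent m n ∘ₗ push k Q (stringPos m t))
    (fun e e' he u hu => ?_) (fun e u hu => ?_) (fun u => ?_) (fun u => ?_) (fun x y hxy => ?_)
    fun e z hz => ?_
  · rw [LinearMap.comp_apply]
    exact hunip _ _ (push_bandPos_mem hσ he hu)
  · rw [LinearMap.comp_apply]
    exact hunip _ _ (push_stringPos_mem hu)
  · rw [LinearMap.comp_apply, LinearMap.comp_apply]
    exact hd.string_comm hσ hn (fun j hj => (hE j hj).1) (fun j hj => (hE j hj).2) T1 u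
  · rw [LinearMap.comp_apply, LinearMap.comp_apply, LinearMap.comp_apply]
    exact hd.band_comm hσ hn T2 u
  · rw [LinearMap.comp_apply, LinearMap.comp_apply, ← map_add] at hxy
    exact push_add_push_eq_zero (unipotent_injective hm hn hxy)
  · obtain ⟨z', hz', rfl⟩ := unipotent_surjective hm hn (hS e) hz
    obtain ⟨x, hx, y, hy, h⟩ := exists_push_add_push hσ hz'
    exact ⟨x, hx, y, hy, by rw [LinearMap.comp_apply, LinearMap.comp_apply, ← map_add, h]⟩

end IsDoubleData

end ConeIso

/-! ### The three cases and the conclusion -/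

section Main

variable {V : Type u} {A : Type v} [Fintype V] [Fintype A] {k : Type w} [Field k]
  {Q : GentleQuiver V A} {m : ℕ} {σ : Walk V A (ZMod m)}
  {τ : Walk V A ℤ} {s : ZMod m} {t : ℤ} {fL fR : List A}
  {degσ : ZMod m → ℤ} {degτ : ℤ → ℤ}

namespace IsDoubleData

variable (hd : IsDoubleData Q σ degσ τ degτ s t fL fR)
  (hσ : IsHomotopyBand Q σ) (hτ : IsHomotopyString Q τ)
include hd hσ hτ

/-- The case that `fL` and `fR` are proper factors of `σ_C` and `τ_C`. -/
theorem isLadder_of_short {h : List A} (hne : h ≠ []) (e1 : (σ.letter s).path = fL ++ h)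
    (e2 : (τ.letter t).path = h ++ fR) :
    IsLadder (fun i : ℕ => τ.vtx (t - i)) (leftLetters τ t)
      (fun i : ℕ => σ.vtx (s + 1 + i)) (rightLetters σ s)
      (fun i => if i = 0 then word k Q h else 0) := by
  have hs := hd.isPath_s hσ
  have hh : IsPath Q h (τ.vtx t) (σ.vtx (s + 1)) := (e1 ▸ hs).right_of_append hne hd.path_L
  refine isLadder_single ?_ ?_ fun r _ => by simpa using mul_mem_proj hh r
  · rcases hl : leftLetters τ t 0 with _ | l
    · simp
    obtain ⟨h1, rfl⟩ := mem_leftLetters hl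
    cases hdl : (τ.letter (t - 1 - ((0 : ℕ) : ℤ))).direct
    · rw [fwd_inverse hdl, zero_mul]
    rw [fwd_direct hdl]
    simp only [Nat.cast_zero, sub_zero] at h1 hdl ⊢
    have hj := hτ.junction (t - 1) h1 (by simpa using hd.t_mem) (by simpa using hd.t_succ_mem)
    rw [sub_add_cancel] at hj
    simp only [Junction, hdl, hd.direct_t] at hj
    obtain ⟨a, ha, b, hb, hr⟩ := hj
    -- τ_C starts with `h`, so the relation between τ_L and τ_C already kills `h`.
    rw [e2, List.head?_append_of_ne_nil _ hne] at hb
    exact word_mul_word ha hb hr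
  · rw [rightLetters, bwd_inv, Nat.cast_zero, add_zero]
    cases hdl : (σ.letter (s + 1)).direct
    · rw [fwd_inverse hdl, mul_zero]
    rw [fwd_direct hdl]
    have hj := hσ.junction' s
    simp only [Junction, hdl, hd.direct_s] at hj
    obtain ⟨a, ha, b, hb, hr⟩ := hj
    rw [e1, List.getLast?_append_of_ne_nil _ hne] at ha
    exact word_mul_word ha hb hr

/-- The case that `σ_C` and `τ_C` are proper factors of `fL` and `fR`. -/
theorem isLadder_of_long {h : List A} (hne : h ≠ []) (e1 : fL = (σ.letter s).path ++ h)
    (e2 : fR = h ++ (τ.letter t).path) :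
    IsLadder (fun i : ℕ => σ.vtx (s + 1 + i)) (rightLetters σ s)
      (fun i : ℕ => τ.vtx (t - i)) (leftLetters τ t)
      (fun i => if i = 0 then word k Q h else 0) := by
  have hs := hd.isPath_s hσ
  have hh : IsPath Q h (σ.vtx (s + 1)) (τ.vtx t) := (e1 ▸ hd.path_L).right_of_append hne hs
  refine isLadder_single ?_ ?_ fun r _ => by simpa using mul_mem_proj hh r
  · rw [rightLetters, fwd_inv, Nat.cast_zero, add_zero]
    cases hdl : (σ.letter (s + 1)).direct
    · rw [bwd_inverse hdl]
      obtain ⟨a, ha, b, hb, hr⟩ := hasZero_append ((hσ.joins' (s + 1)).isPath_of_inverse hdl)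
        hd.path_R (hd.R1 (by simp [hσ.carrier_eq]) hdl)
      -- f_R starts with `h`, so (R1) gives a relation between σ_R and `h`; below, (L2) plays this
      -- role for τ_L.
      rw [e2, List.head?_append_of_ne_nil _ hne] at hb
      exact word_mul_word ha hb hr
    · rw [bwd_direct hdl, zero_mul]
  · rcases hl : leftLetters τ t 0 with _ | l
    · simp
    obtain ⟨h1, rfl⟩ := mem_leftLetters hl
    cases hdl : (τ.letter (t - 1 - ((0 : ℕ) : ℤ))).direct
    · rw [bwd_inverse hdl]
      simp only [Nat.cast_zero, sub_zero] at h1 hdl ⊢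
      have hj := hτ.joins (t - 1) h1 (by simpa using hd.t_mem)
      obtain ⟨a, ha, b, hb, hr⟩ := hasZero_append hd.path_L (hj.isPath_of_inverse hdl)
        (hd.L2 h1 hdl)
      rw [e1, List.getLast?_append_of_ne_nil _ hne] at ha
      exact word_mul_word ha hb hr
    · rw [bwd_direct hdl, mul_zero]

/-- The case that `fL = σ_C` and `fR = τ_C`. -/
theorem exists_isLadder_of_eq (e1 : fL = (σ.letter s).path) (e2 : fR = (τ.letter t).path) :
    (∃ G : ℕ → Alg k Q, IsLadder (fun i : ℕ => τ.vtx (t - i)) (leftLetters τ t)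
      (fun i : ℕ => σ.vtx (s + 1 + i)) (rightLetters σ s) G ∧ G 0 = 1) ∨
    (∃ G : ℕ → Alg k Q, IsLadder (fun i : ℕ => σ.vtx (s + 1 + i)) (rightLetters σ s)
      (fun i : ℕ => τ.vtx (t - i)) (leftLetters τ t) G ∧ G 0 = 1 ∧ ∃ n, ∀ i ≥ n, G i = 0) := by
  -- The equality τ_C = f_R gives both walks the same right neighbour: τ_L precedes τ_C in τ, and
  -- the inverse of σ_R precedes f_R in `c`.
  have hz : τ.letter t = ⟨fR, true⟩ := by rw [e2, ← hd.direct_t]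
  refine exists_isLadder (isLeftWalk_leftLetters hτ hd.t_mem) (isLeftWalk_rightLetters hσ)
    (z := τ.letter t) (z' := τ.vtx (t + 1)) ?_ ?_ ?_ ?_
  · simpa using hd.path_L.eq_right (e1 ▸ hd.isPath_s hσ)
  · simpa using hτ.joins t hd.t_mem hd.t_succ_mem
  · intro l hl
    obtain ⟨h1, rfl⟩ := mem_leftLetters hl
    simp only [Nat.cast_zero, sub_zero] at h1 ⊢
    simpa using hτ.junction (t - 1) h1 (by simpa using hd.t_mem) (by simpa using hd.t_succ_mem)
  · intro l hl
    obtain rfl : _ = l := Option.some_inj.1 hl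
    rw [Nat.cast_zero, add_zero, hz]
    exact hd.junction_σ_fR hσ hτ.toIsWalk

/-- If the double map is not null-homotopic, then its mapping cone is a string complex. -/
theorem nonempty_mappingCone_iso_stringComplex [NeZero m] (hdσ : IsGrading σ degσ)
    (hdτ : IsGrading τ degτ) {c : ZMod m → k} (hc : ∀ i, c i ≠ 0) {a b : k} (ha : a ≠ 0)
    (hb : b ≠ 0)
    {f : walkComplex k hσ.toIsWalk c hdσ ⟶ walkComplex k hτ.toIsWalk (fun _ => 1) hdτ}
    (hf : Represents f (doubleMap k Q s t a b fL fR))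
    (hf0 : (HomotopyCategory.quotient (ModuleCat.{max u v w} (Alg k Q))
      (ComplexShape.up ℤ)).map f ≠ 0) :
    Nonempty (CochainComplex.mappingCone f ≅ stringComplex k (hd.isHomotopyString_coneWalk hσ hτ)
      (hd.isGrading_coneWalk hσ hdσ hdτ)) := by
  have key : ∀ {G : ℕ → Alg k Q}, IsLadder (fun i : ℕ => τ.vtx (t - i)) (leftLetters τ t)
      (fun i : ℕ => σ.vtx (s + 1 + i)) (rightLetters σ s) G →
      word k Q fL * G 0 = word k Q (σ.letter s).path →
      G 0 * word k Q fR = word k Q (τ.letter t).path → (G 1 ≠ 0 → fL = (σ.letter s).path) →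
      Nonempty (CochainComplex.mappingCone f ≅
        stringComplex k (hd.isHomotopyString_coneWalk hσ hτ)
          (hd.isGrading_coneWalk hσ hdσ hdτ)) := fun hG h1 h2 h3 => by
    obtain ⟨i1⟩ := hd.nonempty_cone_iso hσ hτ hG hdσ hdτ hc ha hb hf h1 h2 h3
    obtain ⟨i2⟩ := nonempty_iso_stringComplex (hW := hd.isWalk_coneWalk hσ hτ.toIsWalk)
      (hdeg := hd.isGrading_coneWalk hσ hdσ hdτ)
      (coneCoef_ne_zero (s := s) (t := t) hc ha hb)
    exact ⟨i1 ≪≫ i2⟩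
  -- Two factorisations of the same path: either f_L is an initial factor of σ_C or conversely, with
  -- the same `h` completing the right ends. The case of equality, `h = []`, occurs in both
  -- branches.
  rcases List.append_eq_append_iff.1 hd.comm with ⟨h, e1, e2⟩ | ⟨h, e1, e2⟩
  · by_cases hne : h = []
    · subst hne
      rw [List.append_nil] at e1
      rw [List.nil_append] at e2
      rcases hd.exists_isLadder_of_eq (k := k) hσ hτ e1.symm e2.symm with
        ⟨G, hG, h0⟩ | ⟨G, hG, h0, N, hN⟩
      · exact key hG (by rw [h0, mul_one, e1]) (by rw [h0, one_mul, e2]) fun _ => e1.symm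
      · exact absurd (hd.map_eq_zero hσ hdσ hτ hdτ hc hf hG hN (by rw [h0, mul_one, e1])
          (by rw [h0, one_mul, e2])) hf0
    · exact key (hd.isLadder_of_short hσ hτ hne e1 e2) (by simp [e1, word_append])
        (by simp [e2, word_append]) (by simp)
  · by_cases hne : h = []
    · subst hne
      rw [List.append_nil] at e1
      rw [List.nil_append] at e2
      rcases hd.exists_isLadder_of_eq (k := k) hσ hτ e1 e2 with
        ⟨G, hG, h0⟩ | ⟨G, hG, h0, N, hN⟩
      · exact key hG (by rw [h0, mul_one, e1]) (by rw [h0, one_mul, e2]) fun _ => e1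
      · exact absurd (hd.map_eq_zero hσ hdσ hτ hdτ hc hf hG hN (by rw [h0, mul_one, e1])
          (by rw [h0, one_mul, e2])) hf0
    · exact absurd (hd.map_eq_zero hσ hdσ hτ hdτ hc hf (hd.isLadder_of_long hσ hτ hne e1 e2)
        (N := 1) (fun i hi => if_neg (by omega)) (by simp [e1, word_append])
        (by simp [e2, word_append])) hf0

end IsDoubleData

end Main

end Gentle

theorem mainTheorem12 {V : Type u} {A : Type v} [Fintype V] [Fintype A]
    (k : Type w) [Field k] [IsAlgClosed k] (Q : Gentle.GentleQuiver V A)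
    {m : ℕ} [NeZero m]
    (σ : Gentle.Walk V A (ZMod m)) (hσ : Gentle.IsHomotopyBand Q σ)
    (degσ : ZMod m → ℤ) (hdσ : Gentle.IsGrading σ degσ)
    (p : ZMod m) (hp : (σ.letter p).direct = true) (lam : k) (hlam : lam ≠ 0)
    (τ : Gentle.Walk V A ℤ) (hτ : Gentle.IsHomotopyString Q τ)
    (degτ : ℤ → ℤ) (hdτ : Gentle.IsGrading τ degτ)
    (s : ZMod m) (t : ℤ) (fL fR : List A)
    (hdata : Gentle.IsDoubleData Q σ degσ τ degτ s t fL fR)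
    (f : Gentle.bandComplex hσ p lam hdσ ⟶ Gentle.stringComplex k hτ hdτ)
    (hf : Gentle.HasComponents f s t fL fR)
    (hf0 : (HomotopyCategory.quotient (ModuleCat.{max u v w} (Gentle.Alg k Q))
      (ComplexShape.up ℤ)).map f ≠ 0) :
    ∃ (hc : Gentle.IsHomotopyString Q (Gentle.coneWalk σ τ s t fL fR))
      (hdc : Gentle.IsGrading (Gentle.coneWalk σ τ s t fL fR) (Gentle.coneDeg degσ degτ s t)),
      Nonempty
        ((HomotopyCategory.quotient (ModuleCat.{max u v w} (Gentle.Alg k Q))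
            (ComplexShape.up ℤ)).obj (CochainComplex.mappingCone f) ≅
          (HomotopyCategory.quotient (ModuleCat.{max u v w} (Gentle.Alg k Q))
            (ComplexShape.up ℤ)).obj (Gentle.stringComplex k hc hdc)) := by
  classical
  obtain ⟨a, b, ha, hb, hf⟩ := hf
  have hc : ∀ i : ZMod m, (if i = p then lam else 1 : k) ≠ 0 := fun i => by
    split_ifs
    · exact hlam
    · exact one_ne_zero
  obtain ⟨e⟩ := hdata.nonempty_mappingCone_iso_stringComplex hσ hτ hdσ hdτ
    (fun i => by convert hc i) ha hb (f := f) hf hf0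
  exact ⟨hdata.isHomotopyString_coneWalk hσ hτ, hdata.isGrading_coneWalk hσ hdσ hdτ,
    ⟨(HomotopyCategory.quotient _ _).mapIso e⟩⟩
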